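/- Let $(Y_i,D_i,X_i)_{i\ge 1}$ be i.i.d. with $D_i\in\{0,1\}$ and $X_i$ having Lebesgue density $f$, let $c\in\mathbb R$, and write $j\in\{+,-\}$ for the right and left side of $c$. **Assumptions.** For an open set $V$ let $\mathcal G_k(V)$ be the set of $g\in C^k(V)$ with $|g^{(k)}(x)-g^{(k)}(y)|\le M|x-y|^\alpha$ on $V$ for some $M>0$, $0<\alpha\le1$. (1) $K:\mathbb R\to\mathbb R$ is a continuous, compactly supported, symmetric second-order kernel ($\int K=1$, $\int uK=0$, $\int u^2K\ne0$). With $\mu_k=\int_0^\infty u^kK(u)\,du$ and $\nu_k=\int_0^\infty u^kK(u)^2\,du$, $\Delta:=\mu_0\mu_2-\mu_1^2\neq0$ (automatic if $K\ge0$). The bandwidths $h_\pm=h_\pm(n)>0$ satisfy $h_\pm\to0$ and $nh_\pm\to\infty$. (2) $f$ is bounded, $f(c)>0$, and $f\in\mathcal G_1$ on an open neighbourhood of $c$. (3) For some $\delta>0$, on each of $(c,c+\delta)$ and $(c-\delta,c)$: the conditional means $m_Y(x)=E(Y|X=x)$ and $m_D(x)=E(D|X=x)$ have versions in $\mathcal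 G_3$, and $\sigma_Y^2(x)=\mathrm{Var}(Y|X=x)<\infty$ and $\sigma_{YD}(x)=\mathrm{Cov}(Y,D|X=x)$ have versions in $\mathcal G_0$. The one-sided limits at $c$ of $m_k$, $m_k^{(2)}$, $m_k^{(3)}$, $\sigma_k^2$ ($k=Y,D$) and $\sigma_{YD}$ exist and are finite; they are denoted $m_{kj}(c)$, $m_{kj}^{(2)}(c)$, $m_{kj}^{(3)}(c)$, $\sigma^2_{kj}(c)$, $\sigma_{YDj}(c)$. (4) $\tau_D:=m_{D+}(c)-m_{D-}(c)\ne0$. Put $\tau:=(m_{Y+}(c)-m_{Y-}(c))/\tau_D$. **Estimator.** For $k=Y,D$ let $\hat m_{kj}$ be the local linear estimator at $c$, i.e. the intercept of the $K((X_i-c)/h_j)$-weighted least squares regression (solution of the normal equations) of the variable $k$ on $1$ and $X_i-c$, over the observations $i\le n$ with $X_i\ge c$ if $j=+$ and $X_i<c$ if $j=-$. Let $\hat\tau_k=\hat m_{k+}-\hat m_{k-}$ and $\hat\tau=\hat\tau_Y/\hat\tau_D$. Let $S_{j,l}=\frac1{nh_j}\sum_i K(u_i)u_i^l$ with $u_i=(X_i-c)/h_j$,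 summed over the same observations. Fix any $\eta$ with $0<\eta<\min\{|\tau_D|,\ f(c)^2|\Delta|\}$ and let $A_n$ be the event that the sample is non-degenerate: $$|S_{j,0}S_{j,2}-S_{j,1}^2|\ge\eta\ \ (j=+,-)\quad\text{and}\quad|\hat\tau_D|\ge\eta .$$ **Conclusion.** There are $C$ and $\kappa>0$ with $P(A_n^c)\le C e^{-\kappa n\min(h_+,h_-)}$ for all $n$. For all large $n$ the mean squared error over non-degenerate samples, $MSE_n=E[(\hat\tau-\tau)^2\mathbf 1_{A_n}]$, is finite, and as $n\to\infty$ $$MSE_n=\frac1{\tau_D^2}\Big\{[\phi_+h_+^2-\phi_-h_-^2]+[\psi_+h_+^3-\psi_-h_-^3]+o(h_+^3+h_-^3)\Big\}^2+\frac{v}{nf(c)\tau_D^2}\Big\{\frac{\omega_+}{h_+}+\frac{\omega_-}{h_-}\Big\}+o\Big(\frac1{nh_+}+\frac1{nh_-}\Big),$$ where $\omega_j=\sigma_{Yj}^2(c)+\tau^2\sigma_{Dj}^2(c)-2\tau\sigma_{YDj}(c)$, $\phi_j=C_1[m_{Yj}^{(2)}(c)-\tau m_{Dj}^{(2)}(c)]$,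 $\psi_j=\zeta_{Yj}-\tau\zeta_{Dj}$, $$\zeta_{k\pm}=\pm\Big\{\xi_1\Big[\frac{m_{k\pm}^{(2)}(c)}2\frac{f'(c)}{f(c)}+\frac{m_{k\pm}^{(3)}(c)}6\Big]-\xi_2\frac{m_{k\pm}^{(2)}(c)}2\frac{f'(c)}{f(c)}\Big\},$$ $C_1=\frac{\mu_2^2-\mu_1\mu_3}{2\Delta}$, $v=\frac{\mu_2^2\nu_0-2\mu_1\mu_2\nu_1+\mu_1^2\nu_2}{\Delta^2}$, $\xi_1=\frac{\mu_2\mu_3-\mu_1\mu_4}{\Delta}$, $\xi_2=\frac{(\mu_2^2-\mu_1\mu_3)(\mu_0\mu_3-\mu_1\mu_2)}{\Delta^2}$. -/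

import Mathlib

open MeasureTheory ProbabilityTheory Filter Asymptotics
open scoped Topology

noncomputable section

namespace FuzzyRD

/-! ### The two sides of the cut-off point -/

/-- The two sides of the cut-off: `pos` is `+` (right), `neg` is `-` (left). -/
inductive Side : Type
  | pos
  | neg

/-- The sign `+1` or `-1` of a side. -/
def Side.sign : Side → ℝ
  | .pos => 1
  | .neg => -1

/-- The half line of observations used on a side: `[c, ∞)` on the right, `(-∞, c)` on the left. -/
def Side.half (c : ℝ) : Side → Set ℝ
  | .pos => Set.Ici c
  | .neg => Set.Iio c

/-- The one-sided open neighbourhood `(c, c + δ)` or `(c - δ, c)`. -/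
def Side.nbhd (c δ : ℝ) : Side → Set ℝ
  | .pos => Set.Ioo c (c + δ)
  | .neg => Set.Ioo (c - δ) c

/-- The filter of the one-sided limit `x ↘ c` or `x ↗ c`. -/
def Side.toC (c : ℝ) : Side → Filter ℝ
  | .pos => 𝓝[>] c
  | .neg => 𝓝[<] c

/-! ### Regularity classes, kernels -/

/-- `g` is `k` times continuously differentiable on the open set `U`, with `k`-th derivative
Hölder continuous on `U` of some order `α ∈ (0, 1]`. -/
def HolderClass (k : ℕ) (U : Set ℝ) (g : ℝ → ℝ) : Prop :=
  ContDiffOn ℝ k g U ∧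
    ∃ M : ℝ, 0 < M ∧ ∃ α : ℝ, 0 < α ∧ α ≤ 1 ∧ ∀ x ∈ U, ∀ y ∈ U,
      |iteratedDeriv k g x - iteratedDeriv k g y| ≤ M * |x - y| ^ α

/-- A continuous, compactly supported, symmetric kernel of second order. -/
structure IsKernel (K : ℝ → ℝ) : Prop where
  continuous : Continuous K
  compactSupport : HasCompactSupport K
  symm : ∀ u, K (-u) = K u
  integral_eq_one : ∫ u, K u = 1
  first_moment : ∫ u, u * K u = 0
  second_moment : ∫ u, u ^ 2 * K u ≠ 0

/-- `μ_k = ∫_0^∞ u^k K(u) du`. -/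
def kmu (K : ℝ → ℝ) (k : ℕ) : ℝ := ∫ u in Set.Ioi (0 : ℝ), u ^ k * K u

/-- `ν_k = ∫_0^∞ u^k K(u)^2 du`. -/
def knu (K : ℝ → ℝ) (k : ℕ) : ℝ := ∫ u in Set.Ioi (0 : ℝ), u ^ k * K u ^ 2

/-- `μ_0 μ_2 - μ_1^2`. -/
def kdet (K : ℝ → ℝ) : ℝ := kmu K 0 * kmu K 2 - kmu K 1 ^ 2

def C1 (K : ℝ → ℝ) : ℝ := (kmu K 2 ^ 2 - kmu K 1 * kmu K 3) / (2 * kdet K)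

def vConst (K : ℝ → ℝ) : ℝ :=
  (kmu K 2 ^ 2 * knu K 0 - 2 * kmu K 1 * kmu K 2 * knu K 1 + kmu K 1 ^ 2 * knu K 2) / kdet K ^ 2

def xi1 (K : ℝ → ℝ) : ℝ := (kmu K 2 * kmu K 3 - kmu K 1 * kmu K 4) / kdet K

def xi2 (K : ℝ → ℝ) : ℝ :=
  (kmu K 2 ^ 2 - kmu K 1 * kmu K 3) * (kmu K 0 * kmu K 3 - kmu K 1 * kmu K 2) / kdet K ^ 2

/-! ### Population quantities -/

/-- On `U`, the functions `mY, mD, sY, sD, sYD` are versions of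
`E(Y | X = x)`, `E(D | X = x)`, `Var(Y | X = x)`, `Var(D | X = x)`, `Cov(Y, D | X = x)`,
computed from the regular conditional distribution of `(Y, D)` given `X = x`. -/
def IsCondMoments {Ω : Type*} [MeasurableSpace Ω] (P : Measure Ω) [IsFiniteMeasure P]
    (Y D X : Ω → ℝ) (U : Set ℝ) (mY mD sY sD sYD : ℝ → ℝ) : Prop :=
  ∀ᵐ x ∂(P.map X), x ∈ U →
    MemLp (Prod.fst : ℝ × ℝ → ℝ) 2 (condDistrib (fun ω => (Y ω, D ω)) X P x) ∧
    mY x = ∫ p, p.1 ∂(condDistrib (fun ω => (Y ω, D ω)) X P x) ∧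
    mD x = ∫ p, p.2 ∂(condDistrib (fun ω => (Y ω, D ω)) X P x) ∧
    sY x = variance Prod.fst (condDistrib (fun ω => (Y ω, D ω)) X P x) ∧
    sD x = variance Prod.snd (condDistrib (fun ω => (Y ω, D ω)) X P x) ∧
    sYD x = covariance Prod.fst Prod.snd (condDistrib (fun ω => (Y ω, D ω)) X P x)

/-- Values at the cut-off, from one side, of the conditional means, of their second and third
derivatives, and of the conditional variances and covariance. -/
structure BoundaryValues : Type where
  (mY mD mY2 mD2 mY3 mD3 sY sD sYD : ℝ)

/-- `b` collects the limits along `l` of the given functions and of the derivatives of the first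
two of them. -/
structure BoundaryValues.IsLimit (b : BoundaryValues) (l : Filter ℝ)
    (mY mD sY sD sYD : ℝ → ℝ) : Prop where
  lim_mY : Tendsto mY l (𝓝 b.mY)
  lim_mD : Tendsto mD l (𝓝 b.mD)
  lim_mY2 : Tendsto (iteratedDeriv 2 mY) l (𝓝 b.mY2)
  lim_mD2 : Tendsto (iteratedDeriv 2 mD) l (𝓝 b.mD2)
  lim_mY3 : Tendsto (iteratedDeriv 3 mY) l (𝓝 b.mY3)
  lim_mD3 : Tendsto (iteratedDeriv 3 mD) l (𝓝 b.mD3)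
  lim_sY : Tendsto sY l (𝓝 b.sY)
  lim_sD : Tendsto sD l (𝓝 b.sD)
  lim_sYD : Tendsto sYD l (𝓝 b.sYD)

/-- `τ_D = m_{D+}(c) - m_{D-}(c)`. -/
def tauD (b : Side → BoundaryValues) : ℝ := (b .pos).mD - (b .neg).mD

/-- `τ = (m_{Y+}(c) - m_{Y-}(c)) / (m_{D+}(c) - m_{D-}(c))`. -/
def tau (b : Side → BoundaryValues) : ℝ := ((b .pos).mY - (b .neg).mY) / tauD b

/-- `ω_j = σ²_{Yj}(c) + τ² σ²_{Dj}(c) - 2 τ σ_{YDj}(c)`. -/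
def omegaConst (b : Side → BoundaryValues) (j : Side) : ℝ :=
  (b j).sY + tau b ^ 2 * (b j).sD - 2 * tau b * (b j).sYD

/-- `φ_j = C₁ (m''_{Yj}(c) - τ m''_{Dj}(c))`. -/
def phi (K : ℝ → ℝ) (b : Side → BoundaryValues) (j : Side) : ℝ :=
  C1 K * ((b j).mY2 - tau b * (b j).mD2)

/-- `ζ_j` for a conditional mean with one-sided second and third derivatives `m2`, `m3`, where
`f0 = f(c)` and `f1 = f'(c)`. -/
def zeta (K : ℝ → ℝ) (f0 f1 m2 m3 : ℝ) (j : Side) : ℝ :=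
  j.sign * (xi1 K * (m2 / 2 * (f1 / f0) + m3 / 6) - xi2 K * (m2 / 2 * (f1 / f0)))

/-- `ψ_j = ζ_{Yj} - τ ζ_{Dj}`, where `f0 = f(c)` and `f1 = f'(c)`. -/
def psi (K : ℝ → ℝ) (f0 f1 : ℝ) (b : Side → BoundaryValues) (j : Side) : ℝ :=
  zeta K f0 f1 (b j).mY2 (b j).mY3 j - tau b * zeta K f0 f1 (b j).mD2 (b j).mD3 j

/-! ### The estimator, for data `x, y, d` of which the first `n` observations are used -/

/-- The normalized weighted moment `(n h)⁻¹ ∑ K(u_i) u_i^k z_i`, `u_i = (x_i - c) / h`, over the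
observations `i < n` on side `j`. -/
def localMoment (K : ℝ → ℝ) (c : ℝ) (j : Side) (h : ℝ) (n k : ℕ) (x z : ℕ → ℝ) : ℝ :=
  (n * h)⁻¹ * ∑ i ∈ Finset.range n,
    (j.half c).indicator (fun t => K ((t - c) / h) * ((t - c) / h) ^ k) (x i) * z i

/-- Determinant of the normalized local design matrix. -/
def localDet (K : ℝ → ℝ) (c : ℝ) (j : Side) (h : ℝ) (n : ℕ) (x : ℕ → ℝ) : ℝ :=
  localMoment K c j h n 0 x 1 * localMoment K c j h n 2 x 1 - localMoment K c j h n 1 x 1 ^ 2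

/-- The local linear regression estimator at `c` from side `j`: the intercept of the
kernel-weighted least squares regression of `z_i` on `1` and `x_i - c`, i.e. of the solution of
the normal equations. -/
def localLinear (K : ℝ → ℝ) (c : ℝ) (j : Side) (h : ℝ) (n : ℕ) (x z : ℕ → ℝ) : ℝ :=
  (localMoment K c j h n 2 x 1 * localMoment K c j h n 0 x z
    - localMoment K c j h n 1 x 1 * localMoment K c j h n 1 x z) / localDet K c j h n x

/-- Estimated jump at `c` of the regression of `z` on `x`, with bandwidth `h j` on side `j`. -/
def jumpHat (K : ℝ → ℝ) (c : ℝ) (h : Side → ℝ) (n : ℕ) (x z : ℕ → ℝ) : ℝ :=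
  localLinear K c .pos (h .pos) n x z - localLinear K c .neg (h .neg) n x z

/-- The fuzzy regression discontinuity estimator. -/
def tauHat (K : ℝ → ℝ) (c : ℝ) (h : Side → ℝ) (n : ℕ) (x y d : ℕ → ℝ) : ℝ :=
  jumpHat K c h n x y / jumpHat K c h n x d

/-- The event on which the estimator is non-degenerate at level `η`: the determinants of the two
local design matrices and the estimated jump of `D` are at least `η` in absolute value. -/
def regularEvent {Ω : Type*} (D X : ℕ → Ω → ℝ) (K : ℝ → ℝ) (c : ℝ) (h : Side → ℝ) (n : ℕ)
    (η : ℝ) : Set Ω :=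
  {ω | (∀ j : Side, η ≤ |localDet K c j (h j) n (fun i => X i ω)|) ∧
    η ≤ |jumpHat K c h n (fun i => X i ω) (fun i => D i ω)|}

/-- The squared error of the fuzzy regression discontinuity estimator of `τ₀`. -/
def sqError {Ω : Type*} (Y D X : ℕ → Ω → ℝ) (K : ℝ → ℝ) (c : ℝ) (h : Side → ℝ) (n : ℕ)
    (τ₀ : ℝ) (ω : Ω) : ℝ :=
  (tauHat K c h n (fun i => X i ω) (fun i => Y i ω) (fun i => D i ω) - τ₀) ^ 2

/-- The mean squared error over the non-degenerate samples, `E[(τ̂ - τ₀)²; regularEvent]`. -/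
def mse {Ω : Type*} [MeasurableSpace Ω] (P : Measure Ω) (Y D X : ℕ → Ω → ℝ) (K : ℝ → ℝ) (c : ℝ)
    (h : Side → ℝ) (n : ℕ) (η τ₀ : ℝ) : ℝ :=
  ∫ ω in regularEvent D X K c h n η, sqError Y D X K c h n τ₀ ω ∂P

end FuzzyRD

end

open FuzzyRD

/-! On a non-degenerate sample the error is `(τ̂_Y - τ τ̂_D) / τ̂_D`. Local linear regression is
linear in the response and reproduces affine functions, so the one-sided linear approximations of
the conditional means may be subtracted at no cost. Their boundary values cancel in the numerator
because `τ τ_D` is the jump of `m_Y`. What remains has the form `∑ R_p γ_p(W)`. The four `R_p` are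
kernel-weighted sums of residuals of `Y - τ D`. The ten coordinates of `W` are the moments of the
design and the kernel-weighted sums of residuals of `D`. The `γ_p` are fixed rational functions,
with numerator linear in `W` (`tauHat_sub_eq`).

Linearize by replacing `γ_p(W)` with `γ_p(E W)`. Cut off outside the non-degenerate set, `γ_p` has
linear growth, since its denominator is bounded below there, and it is smooth near the limit of `E
W`. Hence the replacement costs at most a constant times `∑ |W_i - E W_i|` on the whole sample space
(`exists_lipschitz_stCoef`). Write `H = h₊ + h₋` and `q` for the rate `1/(n h₊) + 1/(n h₋)`. The
`R_p` have mean `O(H²)` and variance `O(q)`, and the variances of the `W_i` are `O(q)`. The summands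
of `W` are bounded because `D` is binary, so the mixed fourth moments of centred `R_p` and `W_i` are
`O(q²)` although `Y` has only two conditional moments (`integral_sq_mul_sq_rowSum_le`). The
remainder therefore has mean `O(H⁴ + q)` and second moment `O(q (H⁴ + q))` (`exists_remainder_le`),
the latter being `o(q)`, so it does not affect the variance to the order required.

The bias of the linear part follows from third order one-sided Taylor expansions of the conditional
means and a first order expansion of `f` (`sideBias_expansion`). The denominator at `E W` is `τ_D +
o(H)`, and it multiplies a bias of order `H²`, so it enters only at order `o(H³)`. The variance of
the linear part is that of an i.i.d. sum; the two sides contribute separately because their weights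
have disjoint supports (`variance_linSum_sub`). In squared mean plus variance, the `O(H⁴)` error of
the mean is placed inside the square. Its `O(q)` error is multiplied by factors tending to zero and
joins the variance remainder (`exists_mse_remainders`).

A degenerate sample forces some coordinate of `W` away from its mean by a fixed amount. A Chernoff
bound for bounded summands makes this exponentially unlikely (`measureReal_rowSum_ge_le`). -/

namespace FuzzyRD

/-! ### Sums of functions of i.i.d. observations -/

section RowSum

/-- A sequence of independent, identically distributed random elements. -/
structure IsIID {Ω S : Type*} [MeasurableSpace Ω] [MeasurableSpace S] (ξ : ℕ → Ω → S)
    (P : Measure Ω) : Prop where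
  measurable : ∀ i, Measurable (ξ i)
  indep : iIndepFun ξ P
  ident : ∀ i, IdentDistrib (ξ i) (ξ 0) P P

/-- `∑_{i < n} a(ξ_i)`. -/
def rowSum {Ω S : Type*} (ξ : ℕ → Ω → S) (n : ℕ) (a : S → ℝ) (ω : Ω) : ℝ :=
  ∑ i ∈ Finset.range n, a (ξ i ω)

set_option linter.unusedSectionVars false

variable {Ω S : Type*} [MeasurableSpace Ω] [MeasurableSpace S] {P : Measure Ω}
  [IsProbabilityMeasure P] {ξ : ℕ → Ω → S}

theorem measurable_rowSum (hξ : IsIID ξ P) (n : ℕ) {a : S → ℝ} (ha : Measurable a) :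
    Measurable (rowSum ξ n a) :=
  Finset.measurable_sum _ fun i _ => ha.comp (hξ.measurable i)

theorem IsIID.memLp (hξ : IsIID ξ P) {a : S → ℝ} (ha : Measurable a)
    (h2 : MemLp (fun ω => a (ξ 0 ω)) 2 P) (i : ℕ) : MemLp (fun ω => a (ξ i ω)) 2 P :=
  ((hξ.ident i).comp ha).memLp_iff.2 h2

theorem IsIID.integral_eq (hξ : IsIID ξ P) {a : S → ℝ} (ha : Measurable a) (i : ℕ) :
    ∫ ω, a (ξ i ω) ∂P = ∫ ω, a (ξ 0 ω) ∂P :=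
  ((hξ.ident i).comp ha).integral_eq

theorem IsIID.ae_of_zero (hξ : IsIID ξ P) {p : S → Prop} (hp : MeasurableSet {x | p x})
    (h0 : ∀ᵐ ω ∂P, p (ξ 0 ω)) (i : ℕ) : ∀ᵐ ω ∂P, p (ξ i ω) :=
  (hξ.ident i).symm.ae_snd hp h0

theorem memLp_rowSum (hξ : IsIID ξ P) (n : ℕ) {a : S → ℝ} (ha : Measurable a)
    (h2 : MemLp (fun ω => a (ξ 0 ω)) 2 P) : MemLp (rowSum ξ n a) 2 P :=
  memLp_finsetSum _ fun i _ => hξ.memLp ha h2 i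

theorem integral_rowSum (hξ : IsIID ξ P) (n : ℕ) {a : S → ℝ} (ha : Measurable a)
    (h2 : MemLp (fun ω => a (ξ 0 ω)) 2 P) :
    ∫ ω, rowSum ξ n a ω ∂P = n * ∫ ω, a (ξ 0 ω) ∂P := by
  unfold rowSum
  rw [integral_finsetSum _ fun i _ => (hξ.memLp ha h2 i).integrable (by norm_num)]
  simp [fun i => hξ.integral_eq ha i]

theorem variance_rowSum (hξ : IsIID ξ P) (n : ℕ) {a : S → ℝ} (ha : Measurable a)
    (h2 : MemLp (fun ω => a (ξ 0 ω)) 2 P) :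
    Var[rowSum ξ n a; P] = n * Var[fun ω => a (ξ 0 ω); P] := by
  have h := IndepFun.variance_sum (μ := P) (X := fun i ω => a (ξ i ω)) (s := Finset.range n)
    (fun i _ => hξ.memLp ha h2 i)
    (fun i _ j _ hij => (hξ.indep.indepFun hij).comp ha ha)
  have e : rowSum ξ n a = ∑ i ∈ Finset.range n, fun ω => a (ξ i ω) := by
    ext ω; simp [rowSum]
  rw [e, h]
  have : ∀ i, Var[fun ω => a (ξ i ω); P] = Var[fun ω => a (ξ 0 ω); P] := fun i =>
    ((hξ.ident i).comp ha).variance_eq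
  simp [this]

theorem variance_rowSum_le (hξ : IsIID ξ P) (n : ℕ) {a : S → ℝ} (ha : Measurable a)
    (h2 : MemLp (fun ω => a (ξ 0 ω)) 2 P) :
    Var[rowSum ξ n a; P] ≤ n * ∫ ω, a (ξ 0 ω) ^ 2 ∂P := by
  rw [variance_rowSum hξ n ha h2]
  gcongr
  exact variance_le_expectation_sq h2.1

/-- Independence is stated for the pair of partial sums jointly, so that any monomial in both sums
factors against any function of the next observation. This drives the inductions on `n` below. -/
theorem indepFun_rowSum_prodMk (hξ : IsIID ξ P) (n : ℕ) {a b : S → ℝ} (ha : Measurable a)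
    (hb : Measurable b) :
    IndepFun (fun ω => (rowSum ξ n a ω, rowSum ξ n b ω)) (ξ n) P := by
  have h := hξ.indep.indepFun_finset (Finset.range n) {n} (by simp) hξ.measurable
  have hφ : Measurable (fun z : (Finset.range n → S) => (∑ i, a (z i), ∑ i, b (z i))) :=
    (Finset.measurable_sum _ fun i _ => ha.comp (measurable_pi_apply i)).prodMk
      (Finset.measurable_sum _ fun i _ => hb.comp (measurable_pi_apply i))
  have hψ : Measurable (fun z : (({n} : Finset ℕ) → S) => z ⟨n, by simp⟩) := measurable_pi_apply _
  have := h.comp hφ hψ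
  convert this using 1
  ext ω
  · simp only [rowSum, Function.comp]
    rw [← Finset.sum_coe_sort]
  · simp only [rowSum, Function.comp]
    rw [← Finset.sum_coe_sort]
  · rfl

/-- Powers of a bounded factor cost no integrability, so two moments of the unbounded factor
suffice. -/
theorem integrable_pow_mul_pow {X Y : Ω → ℝ} (hX : MemLp X 2 P) (hY : AEStronglyMeasurable Y P)
    {β : ℝ} (hβ : ∀ᵐ ω ∂P, |Y ω| ≤ β) {i : ℕ} (hi : i ≤ 2) (j : ℕ) :
    Integrable (fun ω => X ω ^ i * Y ω ^ j) P := by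
  have h1 : Integrable (fun ω => X ω ^ i) P := by
    interval_cases i
    · simp
    · simpa using hX.integrable (by norm_num)
    · exact hX.integrable_sq
  refine h1.mul_bdd (c := β ^ j) (hY.pow j) ?_
  filter_upwards [hβ] with ω hω
  rw [norm_pow]
  exact pow_le_pow_left₀ (norm_nonneg _) hω j

theorem rowSum_abs_le (hξ : IsIID ξ P) (n : ℕ) {b : S → ℝ} (hb : Measurable b) {β : ℝ}
    (hβ : ∀ᵐ ω ∂P, |b (ξ 0 ω)| ≤ β) : ∀ᵐ ω ∂P, |rowSum ξ n b ω| ≤ n * β := by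
  have : ∀ᵐ ω ∂P, ∀ i, |b (ξ i ω)| ≤ β :=
    ae_all_iff.2 fun i => hξ.ae_of_zero (p := fun x => |b x| ≤ β)
      (measurableSet_le (hb.abs) measurable_const) hβ i
  filter_upwards [this] with ω hω
  calc |rowSum ξ n b ω| ≤ ∑ i ∈ Finset.range n, |b (ξ i ω)| := Finset.abs_sum_le_sum_abs _ _
    _ ≤ ∑ i ∈ Finset.range n, β := Finset.sum_le_sum fun i _ => hω i
    _ = n * β := by simp

theorem memLp_of_abs_le {b : S → ℝ} (hξ : IsIID ξ P) (hb : Measurable b) {β : ℝ}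
    (hβ : ∀ᵐ ω ∂P, |b (ξ 0 ω)| ≤ β) : MemLp (fun ω => b (ξ 0 ω)) 2 P :=
  MemLp.of_bound (hb.comp (hξ.measurable 0)).aestronglyMeasurable β hβ

/-- Cauchy–Schwarz, from the discriminant of the nonnegative quadratic `t ↦ E (X + t Y)²`. -/
theorem sq_integral_mul_le {X Y : Ω → ℝ} (hX : MemLp X 2 P) (hY : MemLp Y 2 P) :
    (∫ ω, X ω * Y ω ∂P) ^ 2 ≤ (∫ ω, X ω ^ 2 ∂P) * ∫ ω, Y ω ^ 2 ∂P := by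
  have hXY : Integrable (fun ω => X ω * Y ω) P := hX.integrable_mul hY
  have key : ∀ t : ℝ, 0 ≤ (∫ ω, Y ω ^ 2 ∂P) * (t * t) + (2 * ∫ ω, X ω * Y ω ∂P) * t
      + ∫ ω, X ω ^ 2 ∂P := by
    intro t
    have : 0 ≤ ∫ ω, (X ω + t * Y ω) ^ 2 ∂P := integral_nonneg fun _ => sq_nonneg _
    have e : ∫ ω, (X ω + t * Y ω) ^ 2 ∂P
        = ∫ ω, ((t * t) * Y ω ^ 2 + (2 * t) * (X ω * Y ω)) + X ω ^ 2 ∂P := by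
      congr 1; ext ω; ring
    rw [e, integral_add ((hY.integrable_sq.const_mul _).fun_add (hXY.const_mul _)) hX.integrable_sq,
      integral_add (hY.integrable_sq.const_mul _) (hXY.const_mul _), integral_const_mul,
      integral_const_mul] at this
    linarith
  have := discrim_le_zero key
  rw [discrim] at this
  nlinarith

/-- By induction on `n`: the cross products of a partial sum with the new summand have mean zero, by
independence and centring. -/
theorem integral_rowSum_mul (hξ : IsIID ξ P) {a b : S → ℝ} (ha : Measurable a)
    (hb : Measurable b) (ha2 : MemLp (fun ω => a (ξ 0 ω)) 2 P)
    (hb2 : MemLp (fun ω => b (ξ 0 ω)) 2 P)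
    (ha0 : ∫ ω, a (ξ 0 ω) ∂P = 0) (hb0 : ∫ ω, b (ξ 0 ω) ∂P = 0) (n : ℕ) :
    ∫ ω, rowSum ξ n a ω * rowSum ξ n b ω ∂P = n * ∫ ω, a (ξ 0 ω) * b (ξ 0 ω) ∂P := by
  induction n with
  | zero => simp [rowSum]
  | succ n ih =>
    have hind := indepFun_rowSum_prodMk hξ n ha hb
    have e : ∀ ω, rowSum ξ (n + 1) a ω * rowSum ξ (n + 1) b ω
        = ((rowSum ξ n a ω * rowSum ξ n b ω + rowSum ξ n a ω * b (ξ n ω))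
          + rowSum ξ n b ω * a (ξ n ω)) + a (ξ n ω) * b (ξ n ω) := by
      intro ω; simp only [rowSum, Finset.sum_range_succ]; ring
    have hA := memLp_rowSum hξ n ha ha2
    have hB := memLp_rowSum hξ n hb hb2
    have han := hξ.memLp ha ha2 n
    have hbn := hξ.memLp hb hb2 n
    have j1 : Integrable (fun ω => rowSum ξ n a ω * rowSum ξ n b ω) P := hA.integrable_mul hB
    have j2 : Integrable (fun ω => rowSum ξ n a ω * b (ξ n ω)) P := hA.integrable_mul hbn
    have j3 : Integrable (fun ω => rowSum ξ n b ω * a (ξ n ω)) P := hB.integrable_mul han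
    have j4 : Integrable (fun ω => a (ξ n ω) * b (ξ n ω)) P := han.integrable_mul hbn
    have i1 : ∫ ω, rowSum ξ n a ω * b (ξ n ω) ∂P = 0 := by
      have := (hind.comp measurable_fst hb).integral_fun_mul_eq_mul_integral hA.1 hbn.1
      simp only [Function.comp] at this
      rw [this, hξ.integral_eq hb n, hb0, mul_zero]
    have i2 : ∫ ω, rowSum ξ n b ω * a (ξ n ω) ∂P = 0 := by
      have := (hind.comp measurable_snd ha).integral_fun_mul_eq_mul_integral hB.1 han.1
      simp only [Function.comp] at this
      rw [this, hξ.integral_eq ha n, ha0, mul_zero]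
    have i3 : ∫ ω, a (ξ n ω) * b (ξ n ω) ∂P = ∫ ω, a (ξ 0 ω) * b (ξ 0 ω) ∂P :=
      hξ.integral_eq (a := fun x => a x * b x) (ha.mul hb) n
    simp_rw [e]
    rw [integral_add ((j1.fun_add j2).fun_add j3) j4, integral_add (j1.fun_add j2) j3,
      integral_add j1 j2, ih, i1, i2, i3]
    push_cast; ring

theorem integral_sq_rowSum_eq (hξ : IsIID ξ P) {a : S → ℝ} (ha : Measurable a)
    (ha2 : MemLp (fun ω => a (ξ 0 ω)) 2 P) (ha0 : ∫ ω, a (ξ 0 ω) ∂P = 0) (n : ℕ) :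
    ∫ ω, rowSum ξ n a ω ^ 2 ∂P = n * ∫ ω, a (ξ 0 ω) ^ 2 ∂P := by
  simpa only [sq] using integral_rowSum_mul hξ ha ha ha2 ha2 ha0 ha0 n

/-- Mixed fourth moment bound for centred sums, one of which has bounded summands. -/
theorem integral_sq_mul_sq_rowSum_le (hξ : IsIID ξ P) {a b : S → ℝ} (ha : Measurable a)
    (hb : Measurable b) (ha2 : MemLp (fun ω => a (ξ 0 ω)) 2 P) {β : ℝ}
    (hβ : ∀ᵐ ω ∂P, |b (ξ 0 ω)| ≤ β)
    (ha0 : ∫ ω, a (ξ 0 ω) ∂P = 0) (hb0 : ∫ ω, b (ξ 0 ω) ∂P = 0) (n : ℕ) :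
    Integrable (fun ω => rowSum ξ n a ω ^ 2 * rowSum ξ n b ω ^ 2) P ∧
    ∫ ω, rowSum ξ n a ω ^ 2 * rowSum ξ n b ω ^ 2 ∂P
      ≤ n * (β ^ 2 * ∫ ω, a (ξ 0 ω) ^ 2 ∂P)
        + 3 * n ^ 2 * ((∫ ω, a (ξ 0 ω) ^ 2 ∂P) * ∫ ω, b (ξ 0 ω) ^ 2 ∂P) := by
  have hb2 := memLp_of_abs_le hξ hb hβ
  have hint : ∀ n, Integrable (fun ω => rowSum ξ n a ω ^ 2 * rowSum ξ n b ω ^ 2) P := fun n =>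
    integrable_pow_mul_pow (memLp_rowSum hξ n ha ha2)
      (measurable_rowSum hξ n hb).aestronglyMeasurable (rowSum_abs_le hξ n hb hβ) le_rfl 2
  refine ⟨hint n, ?_⟩
  induction n with
  | zero => simp [rowSum]
  | succ n ih =>
    set A := rowSum ξ n a with hAdef
    set B := rowSum ξ n b with hBdef
    have hind := indepFun_rowSum_prodMk hξ n ha hb
    have hA := memLp_rowSum hξ n ha ha2
    have hB := memLp_rowSum hξ n hb hb2
    have hBm := (measurable_rowSum hξ n hb).aestronglyMeasurable (μ := P)
    have hBb := rowSum_abs_le hξ n hb hβ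
    have han := hξ.memLp ha ha2 n
    have hbn := hξ.memLp hb hb2 n
    have hbnb : ∀ᵐ ω ∂P, |b (ξ n ω)| ≤ β := hξ.ae_of_zero (p := fun x => |b x| ≤ β)
      (measurableSet_le (hb.abs) measurable_const) hβ n
    -- Every monomial of the expansion of `(A + a)² (B + b)²` splits into a factor of the first `n`
    -- observations and a factor of the new one.
    have T : ∀ i ≤ 2, ∀ j ≤ 2, ∀ k ≤ 2, ∀ l ≤ 2,
        Integrable (fun ω => (A ω ^ i * B ω ^ j) * (a (ξ n ω) ^ k * b (ξ n ω) ^ l)) P ∧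
        ∫ ω, (A ω ^ i * B ω ^ j) * (a (ξ n ω) ^ k * b (ξ n ω) ^ l) ∂P
          = (∫ ω, A ω ^ i * B ω ^ j ∂P) * ∫ ω, a (ξ 0 ω) ^ k * b (ξ 0 ω) ^ l ∂P := by
      intro i hi j hj k hk l hl
      have h1 := integrable_pow_mul_pow hA hBm hBb hi j
      have h2 := integrable_pow_mul_pow han hbn.1 hbnb hk l
      have hi' : IndepFun (fun ω => A ω ^ i * B ω ^ j)
          (fun ω => a (ξ n ω) ^ k * b (ξ n ω) ^ l) P :=
        hind.comp (φ := fun z : ℝ × ℝ => z.1 ^ i * z.2 ^ j)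
          (ψ := fun x => a x ^ k * b x ^ l) (by fun_prop) (by fun_prop)
      refine ⟨hi'.integrable_mul h1 h2, ?_⟩
      rw [hi'.integral_fun_mul_eq_mul_integral h1.1 h2.1,
        hξ.integral_eq (a := fun x => a x ^ k * b x ^ l) (by fun_prop) n]
    have e : ∀ ω, rowSum ξ (n + 1) a ω ^ 2 * rowSum ξ (n + 1) b ω ^ 2
        = (A ω ^ 2 * B ω ^ 2) * (a (ξ n ω) ^ 0 * b (ξ n ω) ^ 0)
        + (2 * ((A ω ^ 2 * B ω ^ 1) * (a (ξ n ω) ^ 0 * b (ξ n ω) ^ 1))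
        + ((A ω ^ 2 * B ω ^ 0) * (a (ξ n ω) ^ 0 * b (ξ n ω) ^ 2)
        + (2 * ((A ω ^ 1 * B ω ^ 2) * (a (ξ n ω) ^ 1 * b (ξ n ω) ^ 0))
        + (4 * ((A ω ^ 1 * B ω ^ 1) * (a (ξ n ω) ^ 1 * b (ξ n ω) ^ 1))
        + (2 * ((A ω ^ 1 * B ω ^ 0) * (a (ξ n ω) ^ 1 * b (ξ n ω) ^ 2))
        + ((A ω ^ 0 * B ω ^ 2) * (a (ξ n ω) ^ 2 * b (ξ n ω) ^ 0)
        + (2 * ((A ω ^ 0 * B ω ^ 1) * (a (ξ n ω) ^ 2 * b (ξ n ω) ^ 1))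
        + (A ω ^ 0 * B ω ^ 0) * (a (ξ n ω) ^ 2 * b (ξ n ω) ^ 2)))))))) := by
      intro ω
      simp only [hAdef, hBdef, rowSum, Finset.sum_range_succ]; ring
    have t1 := T 2 le_rfl 2 le_rfl 0 (by norm_num) 0 (by norm_num)
    have t2 := T 2 le_rfl 1 (by norm_num) 0 (by norm_num) 1 (by norm_num)
    have t3 := T 2 le_rfl 0 (by norm_num) 0 (by norm_num) 2 le_rfl
    have t4 := T 1 (by norm_num) 2 le_rfl 1 (by norm_num) 0 (by norm_num)
    have t5 := T 1 (by norm_num) 1 (by norm_num) 1 (by norm_num) 1 (by norm_num)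
    have t6 := T 1 (by norm_num) 0 (by norm_num) 1 (by norm_num) 2 le_rfl
    have t7 := T 0 (by norm_num) 2 le_rfl 2 le_rfl 0 (by norm_num)
    have t8 := T 0 (by norm_num) 1 (by norm_num) 2 le_rfl 1 (by norm_num)
    have t9 := T 0 (by norm_num) 0 (by norm_num) 2 le_rfl 2 le_rfl
    have s8 := (t8.1.const_mul 2).fun_add t9.1
    have s7 := t7.1.fun_add s8
    have s6 := (t6.1.const_mul 2).fun_add s7
    have s5 := (t5.1.const_mul 4).fun_add s6
    have s4 := (t4.1.const_mul 2).fun_add s5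
    have s3 := t3.1.fun_add s4
    have s2 := (t2.1.const_mul 2).fun_add s3
    simp_rw [e]
    rw [integral_add t1.1 s2, integral_add (t2.1.const_mul 2) s3, integral_add t3.1 s4,
      integral_add (t4.1.const_mul 2) s5, integral_add (t5.1.const_mul 4) s6,
      integral_add (t6.1.const_mul 2) s7, integral_add t7.1 s8,
      integral_add (t8.1.const_mul 2) t9.1]
    simp only [integral_const_mul]
    rw [t1.2, t2.2, t3.2, t4.2, t5.2, t6.2, t7.2, t8.2, t9.2]
    -- Centring kills four of the nine terms. With `α = E a²` and `γ = E b²`, the increment consists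
    -- of `2 n α γ`, of `4 n (E ab)² ≤ 4 n α γ` and of `E a²b² ≤ β² α`. Its part `6 n α γ` is
    -- covered by `3 ((n + 1)² - n²) = 6 n + 3`.
    have hAint : ∫ ω, A ω ∂P = 0 := by rw [integral_rowSum hξ n ha ha2, ha0, mul_zero]
    have hBint : ∫ ω, B ω ∂P = 0 := by rw [integral_rowSum hξ n hb hb2, hb0, mul_zero]
    have hA2 := integral_sq_rowSum_eq hξ ha ha2 ha0 n
    have hB2 := integral_sq_rowSum_eq hξ hb hb2 hb0 n
    have hAB := integral_rowSum_mul hξ ha hb ha2 hb2 ha0 hb0 n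
    simp only [pow_zero, pow_one, mul_one, one_mul, integral_const, probReal_univ, smul_eq_mul,
      ha0, hb0, hAint, hBint, mul_zero, zero_mul, zero_add]
    rw [← hAdef] at hA2 hAB
    rw [← hBdef] at hB2 hAB
    have hcs := sq_integral_mul_le ha2 hb2
    have hlast : ∫ ω, a (ξ 0 ω) ^ 2 * b (ξ 0 ω) ^ 2 ∂P ≤ β ^ 2 * ∫ ω, a (ξ 0 ω) ^ 2 ∂P := by
      rw [← integral_const_mul]
      refine integral_mono_ae (integrable_pow_mul_pow ha2 hb2.1 hβ le_rfl 2)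
        (ha2.integrable_sq.const_mul _) ?_
      filter_upwards [hβ] with ω hω
      have : b (ξ 0 ω) ^ 2 ≤ β ^ 2 := by
        rw [← sq_abs]; exact pow_le_pow_left₀ (abs_nonneg _) hω 2
      nlinarith [sq_nonneg (a (ξ 0 ω))]
    rw [hA2, hB2, hAB]
    have hn : (0 : ℝ) ≤ n := n.cast_nonneg
    have hα : 0 ≤ (∫ ω, a (ξ 0 ω) ^ 2 ∂P) * ∫ ω, b (ξ 0 ω) ^ 2 ∂P :=
      mul_nonneg (integral_nonneg fun _ => sq_nonneg _) (integral_nonneg fun _ => sq_nonneg _)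
    push_cast
    linarith [mul_le_mul_of_nonneg_left hcs hn]

/-- Exponential bound for sums of bounded centred functions with small variance. -/
theorem measureReal_rowSum_ge_le (hξ : IsIID ξ P) {b : S → ℝ} (hb : Measurable b) {n : ℕ}
    {t C : ℝ} (ht : 0 < t) (hC : 0 < C) (hβ : ∀ᵐ ω ∂P, |b (ξ 0 ω)| ≤ C / t)
    (hb0 : ∫ ω, b (ξ 0 ω) ∂P = 0) (hv : n * ∫ ω, b (ξ 0 ω) ^ 2 ∂P ≤ C / t) {ρ : ℝ} {l : ℝ}
    (hl : 0 ≤ l) (hl1 : l * C ≤ 1) (hl2 : 2 * l * C ≤ ρ) :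
    P.real {ω | ρ ≤ rowSum ξ n b ω} ≤ Real.exp (-(l * ρ / 2) * t) := by
  have hb2 := memLp_of_abs_le hξ hb hβ
  have hexpb : ∀ i, ∀ᵐ ω ∂P, |(l * t) * b (ξ i ω)| ≤ 1 := by
    intro i
    filter_upwards [hξ.ae_of_zero (p := fun x => |b x| ≤ C / t)
      (measurableSet_le (hb.abs) measurable_const) hβ i] with ω hω
    rw [abs_mul, abs_of_nonneg (by positivity)]
    calc l * t * |b (ξ i ω)| ≤ l * t * (C / t) := by gcongr
      _ = l * C := by field_simp
      _ ≤ 1 := hl1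
  -- For `|x| ≤ 1` one has `exp x ≤ 1 + x + x²`. The linear term integrates to zero, and `1 + y ≤
  -- exp y` restores the exponential form.
  have hmgf : ∀ i, mgf (fun ω => b (ξ i ω)) P (l * t)
      ≤ Real.exp ((l * t) ^ 2 * ∫ ω, b (ξ 0 ω) ^ 2 ∂P) := by
    intro i
    have hbi := hξ.memLp hb hb2 i
    have e1 : mgf (fun ω => b (ξ i ω)) P (l * t)
        ≤ ∫ ω, (1 + (l * t) * b (ξ i ω)) + (l * t) ^ 2 * b (ξ i ω) ^ 2 ∂P := by
      unfold mgf
      refine integral_mono_ae ?_ (((integrable_const (1 : ℝ)).fun_add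
        ((hbi.integrable (by norm_num)).const_mul _)).fun_add (hbi.integrable_sq.const_mul _)) ?_
      · refine Integrable.of_bound (C := Real.exp 1) ?_ ?_
        · exact (((hb.comp (hξ.measurable i)).const_mul _).exp).aestronglyMeasurable
        · filter_upwards [hexpb i] with ω hω
          rw [Real.norm_eq_abs, Real.abs_exp]
          exact Real.exp_le_exp.2 ((le_abs_self _).trans hω)
      · filter_upwards [hexpb i] with ω hω
        have := (abs_le.1 (Real.abs_exp_sub_one_sub_id_le hω)).2
        linarith [mul_pow (l * t) (b (ξ i ω)) 2]
    rw [integral_add ((integrable_const (1 : ℝ)).fun_add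
        ((hbi.integrable (by norm_num)).const_mul _)) (hbi.integrable_sq.const_mul _),
      integral_add (integrable_const 1) ((hbi.integrable (by norm_num)).const_mul _),
      integral_const_mul, integral_const_mul, hξ.integral_eq hb i, hb0,
      hξ.integral_eq (a := fun x => b x ^ 2) (hb.pow_const 2) i] at e1
    simp only [integral_const, probReal_univ, smul_eq_mul, mul_one, mul_zero, add_zero] at e1
    refine e1.trans ?_
    have := Real.add_one_le_exp ((l * t) ^ 2 * ∫ ω, b (ξ 0 ω) ^ 2 ∂P)
    linarith
  have hsum : rowSum ξ n b = ∑ i ∈ Finset.range n, fun ω => b (ξ i ω) := by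
    ext ω; simp [rowSum]
  have hmg : mgf (rowSum ξ n b) P (l * t) ≤ Real.exp (l ^ 2 * C * t) := by
    rw [hsum, iIndepFun.mgf_sum (X := fun i ω => b (ξ i ω)) (hξ.indep.comp (fun _ => b) fun _ => hb)
      (fun i => hb.comp (hξ.measurable i))]
    calc ∏ i ∈ Finset.range n, mgf (fun ω => b (ξ i ω)) P (l * t)
        ≤ ∏ i ∈ Finset.range n, Real.exp ((l * t) ^ 2 * ∫ ω, b (ξ 0 ω) ^ 2 ∂P) :=
          Finset.prod_le_prod (fun i _ => mgf_nonneg) fun i _ => hmgf i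
      _ = Real.exp ((l * t) ^ 2 * (n * ∫ ω, b (ξ 0 ω) ^ 2 ∂P)) := by
          rw [Finset.prod_const, Finset.card_range, ← Real.exp_nat_mul]; congr 1; ring
      _ ≤ Real.exp ((l * t) ^ 2 * (C / t)) := by gcongr
      _ = Real.exp (l ^ 2 * C * t) := by congr 1; field_simp
  have hint : Integrable (fun ω => Real.exp (l * t * rowSum ξ n b ω)) P := by
    refine Integrable.of_bound (C := Real.exp (l * t * (n * (C / t)))) ?_ ?_
    · exact ((measurable_rowSum hξ n hb).const_mul _).exp.aestronglyMeasurable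
    · filter_upwards [rowSum_abs_le hξ n hb hβ] with ω hω
      rw [Real.norm_eq_abs, Real.abs_exp]
      have := (le_abs_self _).trans hω
      gcongr
  refine (measure_ge_le_exp_mul_mgf ρ (by positivity) hint).trans ?_
  calc Real.exp (-(l * t) * ρ) * mgf (rowSum ξ n b) P (l * t)
      ≤ Real.exp (-(l * t) * ρ) * Real.exp (l ^ 2 * C * t) := by gcongr
    _ = Real.exp (-(l * t) * ρ + l ^ 2 * C * t) := (Real.exp_add _ _).symm
    _ ≤ _ := by
      apply Real.exp_le_exp.2
      -- The condition `2 l C ≤ ρ` makes the quadratic term `l² C t` at most half of the gain `l ρ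
      -- t`.
      nlinarith [mul_le_mul_of_nonneg_left hl2 (mul_nonneg hl ht.le)]

end RowSum

/-! ### Perturbation of a linear statistic -/

section Perturbation

variable {Ω : Type*} [MeasurableSpace Ω] {P : Measure Ω} [IsProbabilityMeasure P]

/-- Moment bounds for `∑ R_p D_p` when the `D_p` are dominated by small variables `V_k`. -/
theorem remainder_moments {ι κ : Type*} [Fintype ι] [Fintype κ] {R : ι → Ω → ℝ} {V : κ → Ω → ℝ}
    {D : ι → Ω → ℝ} (hR : ∀ p, MemLp (R p) 2 P) (hV : ∀ k, MemLp (V k) 2 P)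
    (hD : ∀ p, AEStronglyMeasurable (D p) P) {C M Q Q' : ℝ} (hC : 0 ≤ C)
    (hDV : ∀ p ω, |D p ω| ≤ C * ∑ k, |V k ω|) (hM : ∀ p, |∫ ω, R p ω ∂P| ≤ M)
    (hQ : ∀ p, Var[R p; P] ≤ Q) (hVQ : ∀ k, ∫ ω, V k ω ^ 2 ∂P ≤ Q)
    (hint : ∀ p k, Integrable (fun ω => (R p ω - ∫ ω, R p ω ∂P) ^ 2 * V k ω ^ 2) P)
    (hQ' : ∀ p k, ∫ ω, (R p ω - ∫ ω, R p ω ∂P) ^ 2 * V k ω ^ 2 ∂P ≤ Q') :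
    MemLp (fun ω => ∑ p, R p ω * D p ω) 2 P ∧
    |∫ ω, ∑ p, R p ω * D p ω ∂P| ≤ C * Fintype.card (ι × κ) * (M ^ 2 + Q) ∧
    ∫ ω, (∑ p, R p ω * D p ω) ^ 2 ∂P
      ≤ C ^ 2 * Fintype.card (ι × κ) ^ 2 * (2 * Q' + 2 * M ^ 2 * Q) := by
  set N : ℝ := ((Fintype.card (ι × κ) : ℕ) : ℝ) with hN
  have hmeas : AEStronglyMeasurable (fun ω => ∑ p, R p ω * D p ω) P := by
    have := Finset.aestronglyMeasurable_sum (μ := P) Finset.univ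
      (f := fun p ω => R p ω * D p ω) fun p _ => (hR p).1.mul (hD p)
    convert this using 1
    ext ω; simp
  have habs : ∀ ω, |∑ p, R p ω * D p ω| ≤ C * ∑ x : ι × κ, |R x.1 ω| * |V x.2 ω| := by
    intro ω
    refine (Finset.abs_sum_le_sum_abs _ _).trans ?_
    rw [Fintype.sum_prod_type, Finset.mul_sum]
    refine Finset.sum_le_sum fun p _ => ?_
    dsimp only
    rw [abs_mul, ← Finset.mul_sum, mul_left_comm]
    exact mul_le_mul_of_nonneg_left (hDV p ω) (abs_nonneg _)
  have hsq : ∀ ω, (∑ p, R p ω * D p ω) ^ 2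
      ≤ C ^ 2 * N * ∑ x : ι × κ, (2 * ((R x.1 ω - ∫ ω, R x.1 ω ∂P) ^ 2 * V x.2 ω ^ 2)
        + 2 * M ^ 2 * V x.2 ω ^ 2) := by
    intro ω
    rw [← sq_abs]
    calc |∑ p, R p ω * D p ω| ^ 2 ≤ (C * ∑ x : ι × κ, |R x.1 ω| * |V x.2 ω|) ^ 2 :=
          pow_le_pow_left₀ (abs_nonneg _) (habs ω) 2
      _ = C ^ 2 * (∑ x : ι × κ, |R x.1 ω| * |V x.2 ω|) ^ 2 := by ring
      _ ≤ C ^ 2 * (N * ∑ x : ι × κ, (|R x.1 ω| * |V x.2 ω|) ^ 2) := by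
          gcongr
          have := sq_sum_le_card_mul_sum_sq (s := (Finset.univ : Finset (ι × κ)))
            (f := fun x => |R x.1 ω| * |V x.2 ω|)
          simpa [hN] using this
      _ ≤ C ^ 2 * (N * ∑ x : ι × κ, (2 * ((R x.1 ω - ∫ ω, R x.1 ω ∂P) ^ 2 * V x.2 ω ^ 2)
        + 2 * M ^ 2 * V x.2 ω ^ 2)) := by
          gcongr with x
          rw [mul_pow, sq_abs, sq_abs]
          have h1 : (∫ ω, R x.1 ω ∂P) ^ 2 ≤ M ^ 2 := by
            rw [← sq_abs]; exact pow_le_pow_left₀ (abs_nonneg _) (hM _) 2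
          have h2 : R x.1 ω ^ 2 ≤ 2 * (R x.1 ω - ∫ ω, R x.1 ω ∂P) ^ 2 + 2 * M ^ 2 := by
            nlinarith [sq_nonneg (R x.1 ω - 2 * ∫ ω, R x.1 ω ∂P)]
          nlinarith [sq_nonneg (V x.2 ω)]
      _ = _ := by ring
  have hbi : ∀ x : ι × κ, Integrable (fun ω => 2 * ((R x.1 ω - ∫ ω, R x.1 ω ∂P) ^ 2 * V x.2 ω ^ 2)
        + 2 * M ^ 2 * V x.2 ω ^ 2) P := fun x =>
    ((hint x.1 x.2).const_mul 2).fun_add ((hV x.2).integrable_sq.const_mul _)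
  have hbsum : Integrable (fun ω => C ^ 2 * N * ∑ x : ι × κ,
      (2 * ((R x.1 ω - ∫ ω, R x.1 ω ∂P) ^ 2 * V x.2 ω ^ 2) + 2 * M ^ 2 * V x.2 ω ^ 2)) P :=
    (integrable_finsetSum _ fun x _ => hbi x).const_mul _
  have hsqint : Integrable (fun ω => (∑ p, R p ω * D p ω) ^ 2) P := by
    refine hbsum.mono' (hmeas.pow 2) (Eventually.of_forall fun ω => ?_)
    rw [Real.norm_of_nonneg (sq_nonneg _)]
    exact hsq ω
  refine ⟨(memLp_two_iff_integrable_sq hmeas).2 hsqint, ?_, ?_⟩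
  · have hRV : ∀ x : ι × κ, Integrable (fun ω => R x.1 ω ^ 2 + V x.2 ω ^ 2) P := fun x =>
      (hR x.1).integrable_sq.fun_add (hV x.2).integrable_sq
    calc |∫ ω, ∑ p, R p ω * D p ω ∂P|
        ≤ ∫ ω, C * ∑ x : ι × κ, (1 / 2) * (R x.1 ω ^ 2 + V x.2 ω ^ 2) ∂P := by
          rw [← Real.norm_eq_abs]
          refine norm_integral_le_of_norm_le
            ((integrable_finsetSum _ fun x _ => (hRV x).const_mul _).const_mul _)
            (Eventually.of_forall fun ω => (habs ω).trans ?_)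
          refine mul_le_mul_of_nonneg_left (Finset.sum_le_sum fun x _ => ?_) hC
          -- This is `|R| |V| ≤ (R² + V²) / 2`. No independence of `R` and `V` is used.
          nlinarith [sq_nonneg (|R x.1 ω| - |V x.2 ω|), sq_abs (R x.1 ω), sq_abs (V x.2 ω)]
      _ = C * ∑ x : ι × κ, (1 / 2) * ((∫ ω, R x.1 ω ^ 2 ∂P) + ∫ ω, V x.2 ω ^ 2 ∂P) := by
          rw [integral_const_mul, integral_finsetSum _ fun x _ => (hRV x).const_mul _]
          congr 1
          refine Finset.sum_congr rfl fun x _ => ?_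
          rw [integral_const_mul, integral_add (hR x.1).integrable_sq (hV x.2).integrable_sq]
      _ ≤ C * ∑ x : ι × κ, (M ^ 2 + Q) := by
          gcongr with x
          have h1 : (∫ ω, R x.1 ω ∂P) ^ 2 ≤ M ^ 2 := by
            rw [← sq_abs]; exact pow_le_pow_left₀ (abs_nonneg _) (hM _) 2
          have h2 := variance_eq_sub (hR x.1)
          have h3 : ∫ ω, R x.1 ω ^ 2 ∂P = Var[R x.1; P] + (∫ ω, R x.1 ω ∂P) ^ 2 := by
            rw [h2]; simp only [Pi.pow_apply]; ring
          nlinarith [hQ x.1, hVQ x.2]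
      _ = _ := by
          rw [Finset.sum_const, Finset.card_univ, nsmul_eq_mul]; ring
  · calc ∫ ω, (∑ p, R p ω * D p ω) ^ 2 ∂P
        ≤ ∫ ω, C ^ 2 * N * ∑ x : ι × κ,
          (2 * ((R x.1 ω - ∫ ω, R x.1 ω ∂P) ^ 2 * V x.2 ω ^ 2) + 2 * M ^ 2 * V x.2 ω ^ 2) ∂P :=
          integral_mono hsqint hbsum hsq
      _ = C ^ 2 * N * ∑ x : ι × κ,
          (2 * (∫ ω, (R x.1 ω - ∫ ω, R x.1 ω ∂P) ^ 2 * V x.2 ω ^ 2 ∂P)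
            + 2 * M ^ 2 * ∫ ω, V x.2 ω ^ 2 ∂P) := by
          rw [integral_const_mul, integral_finsetSum _ fun x _ => hbi x]
          congr 1
          refine Finset.sum_congr rfl fun x _ => ?_
          rw [integral_add ((hint x.1 x.2).const_mul 2) ((hV x.2).integrable_sq.const_mul _),
            integral_const_mul, integral_const_mul]
      _ ≤ C ^ 2 * N * ∑ x : ι × κ, (2 * Q' + 2 * M ^ 2 * Q) := by
          gcongr with x
          · exact hQ' _ _
          · exact hVQ _
      _ = _ := by
          rw [Finset.sum_const, Finset.card_univ, nsmul_eq_mul]; ring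

/-- Nonnegativity of the variances of `t L ± Z` bounds twice the covariance by `t Var L + Var Z /
t`. The free parameter `t` is later sent to zero slowly enough that both contributions are
negligible. -/
theorem abs_variance_add_sub_le {L Z : Ω → ℝ} (hL : MemLp L 2 P) (hZ : MemLp Z 2 P) {t : ℝ}
    (ht : 0 < t) :
    |Var[fun ω => L ω + Z ω; P] - Var[L; P]|
      ≤ t * Var[L; P] + (1 / t + 1) * ∫ ω, Z ω ^ 2 ∂P := by
  have h1 := variance_fun_add hL hZ
  have hp := variance_fun_add (hL.const_mul t) hZ
  have hm := variance_fun_sub (hL.const_mul t) hZ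
  rw [variance_const_mul, covariance_const_mul_left] at hp hm
  have hp0 := variance_nonneg (fun ω => t * L ω + Z ω) P
  have hm0 := variance_nonneg (fun ω => t * L ω - Z ω) P
  rw [hp] at hp0
  rw [hm] at hm0
  have hZ2 := variance_le_expectation_sq (μ := P) hZ.1
  simp only [Pi.pow_apply] at hZ2
  have hZ0 := variance_nonneg Z P
  rw [h1]
  set v := Var[L; P]
  set z := Var[Z; P]
  set k := cov[L, Z; P]
  set e := ∫ ω, Z ω ^ 2 ∂P
  have k1 : |2 * k| ≤ t * v + z / t := by
    rw [abs_le, ← mul_le_mul_iff_right₀ ht, ← mul_le_mul_iff_right₀ (b := 2 * k) ht]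
    have : t * (t * v + z / t) = t ^ 2 * v + z := by field_simp
    constructor <;> nlinarith
  have k2 : z / t ≤ e / t := by gcongr
  calc |v + 2 * k + z - v| = |2 * k + z| := by ring_nf
    _ ≤ |2 * k| + |z| := abs_add_le _ _
    _ ≤ (t * v + z / t) + z := by rw [abs_of_nonneg hZ0]; linarith
    _ ≤ t * v + (1 / t + 1) * e := by
      have : (1 / t + 1) * e = e / t + e := by ring
      linarith

end Perturbation

/-! ### One-sided Taylor expansion from limits of derivatives -/

section Taylor

/-- Mean value inequality on `[x, y]`, an interval that stays away from `c`; no value or derivative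
at `c` itself is involved. -/
theorem abs_sub_le_of_isLittleO_deriv {g g' : ℝ → ℝ} {c δ ε : ℝ} {k : ℕ} (hε : 0 ≤ ε)
    (hg : ∀ x ∈ Set.Ioo c (c + δ), HasDerivAt g (g' x) x)
    (hb : ∀ x ∈ Set.Ioo c (c + δ), |g' x| ≤ ε * (x - c) ^ k) {x y : ℝ}
    (hx : x ∈ Set.Ioo c (c + δ)) (hy : y ∈ Set.Ioo c (c + δ)) (hxy : x ≤ y) :
    |g y - g x| ≤ ε * (y - c) ^ (k + 1) := by
  have hsub : ∀ z ∈ Set.Icc x y, z ∈ Set.Ioo c (c + δ) := fun z hz =>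
    ⟨hx.1.trans_le hz.1, hz.2.trans_lt hy.2⟩
  have h := (convex_Icc x y).norm_image_sub_le_of_norm_hasDerivWithin_le
    (f := g) (f' := g') (C := ε * (y - c) ^ k)
    (fun z hz => (hg z (hsub z hz)).hasDerivWithinAt)
    (fun z hz => (hb z (hsub z hz)).trans (by
      have h1 : 0 ≤ z - c := by linarith [(hsub z hz).1]
      have h2 : z - c ≤ y - c := by linarith [hz.2]
      gcongr)) (Set.left_mem_Icc.2 hxy) (Set.right_mem_Icc.2 hxy)
  rw [Real.norm_eq_abs, Real.norm_eq_abs, abs_of_nonneg (sub_nonneg.2 hxy)] at h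
  refine h.trans ?_
  rw [pow_succ, ← mul_assoc]
  have h0 : 0 ≤ y - c := by linarith [hy.1]
  have : y - x ≤ y - c := by linarith [hx.1]
  gcongr

/-- A small derivative makes `g` Cauchy at `c+`. The constant `a` is its limit, and letting `x ↘ c`
in the mean value bound gives the order. The existence of the limit is part of the conclusion, which
matters because no limit of the first derivative is assumed. -/
theorem exists_isLittleO_of_deriv_right {g g' : ℝ → ℝ} {c : ℝ} {k : ℕ}
    (hg : ∀ᶠ x in 𝓝[>] c, HasDerivAt g (g' x) x)
    (hb : g' =o[𝓝[>] c] fun x => (x - c) ^ k) :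
    ∃ a, (fun x => g x - a) =o[𝓝[>] c] fun x => (x - c) ^ (k + 1) := by
  have hloc : ∀ ε > 0, ∃ δ > 0, (∀ x ∈ Set.Ioo c (c + δ), HasDerivAt g (g' x) x) ∧
      ∀ x ∈ Set.Ioo c (c + δ), |g' x| ≤ ε * (x - c) ^ k := by
    intro ε hε
    obtain ⟨u, hu, hsub⟩ := mem_nhdsGT_iff_exists_Ioo_subset.1 (hg.and (hb.def hε))
    refine ⟨u - c, sub_pos.2 hu, fun x hx => ?_, fun x hx => ?_⟩ <;>
      rw [add_sub_cancel] at hx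
    · exact (hsub hx).1
    · have := (hsub hx).2
      rwa [Real.norm_eq_abs, Real.norm_of_nonneg (pow_nonneg (by linarith [hx.1]) _)] at this
  have hcau : Cauchy (map g (𝓝[>] c)) := by
    rw [Metric.cauchy_iff]
    refine ⟨inferInstance, fun ε hε => ?_⟩
    obtain ⟨δ, hδ, hd, hbd⟩ := hloc (ε / 2) (by positivity)
    -- The radius is capped at 1 so that `(y - c) ^ (k + 1) ≤ 1`.
    set δ' := min δ 1
    have hδ' : 0 < δ' := lt_min hδ one_pos
    refine ⟨g '' Set.Ioo c (c + δ'), image_mem_map (Ioo_mem_nhdsGT (by linarith)), ?_⟩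
    have key : ∀ x ∈ Set.Ioo c (c + δ'), ∀ y ∈ Set.Ioo c (c + δ'), x ≤ y → |g y - g x| < ε := by
      intro x hx y hy hxy
      have hsub : Set.Ioo c (c + δ') ⊆ Set.Ioo c (c + δ) :=
        Set.Ioo_subset_Ioo_right (by linarith [min_le_left δ 1])
      have h1 := abs_sub_le_of_isLittleO_deriv (by positivity) hd hbd (hsub hx) (hsub hy) hxy
      have h2 : (y - c) ^ (k + 1) ≤ 1 :=
        pow_le_one₀ (by linarith [hy.1]) (by linarith [hy.2, min_le_right δ 1])
      nlinarith
    rintro _ ⟨x, hx, rfl⟩ _ ⟨y, hy, rfl⟩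
    rcases le_total x y with h | h
    · rw [dist_comm, Real.dist_eq]; exact key x hx y hy h
    · rw [Real.dist_eq]; exact key y hy x hx h
  obtain ⟨a, ha⟩ := CompleteSpace.complete hcau
  refine ⟨a, IsLittleO.of_bound fun ε hε => ?_⟩
  obtain ⟨δ, hδ, hd, hbd⟩ := hloc ε hε
  filter_upwards [Ioo_mem_nhdsGT (show c < c + δ by linarith)] with y hy
  rw [Real.norm_eq_abs, Real.norm_of_nonneg (pow_nonneg (by linarith [hy.1]) _)]
  have ht : Tendsto (fun x => |g y - g x|) (𝓝[>] c) (𝓝 |g y - a|) :=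
    (tendsto_const_nhds.sub ha).abs
  refine le_of_tendsto ht ?_
  filter_upwards [Ioo_mem_nhdsGT hy.1] with x hx
  exact abs_sub_le_of_isLittleO_deriv hε.le hd hbd ⟨hx.1, hx.2.trans hy.2⟩ hy hx.2.le

theorem tendsto_reflect_nhdsGT (c : ℝ) :
    Tendsto (fun x : ℝ => 2 * c - x) (𝓝[>] c) (𝓝[<] c) := by
  refine tendsto_nhdsWithin_iff.2 ⟨?_, ?_⟩
  · have : Tendsto (fun x : ℝ => 2 * c - x) (𝓝 c) (𝓝 (2 * c - c)) :=
      (continuous_const.sub continuous_id).tendsto c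
    rw [show 2 * c - c = c by ring] at this
    exact this.mono_left nhdsWithin_le_nhds
  · filter_upwards [self_mem_nhdsWithin] with x hx
    simp only [Set.mem_Ioi, Set.mem_Iio] at *
    linarith

theorem tendsto_reflect_nhdsLT (c : ℝ) :
    Tendsto (fun x : ℝ => 2 * c - x) (𝓝[<] c) (𝓝[>] c) := by
  refine tendsto_nhdsWithin_iff.2 ⟨?_, ?_⟩
  · have : Tendsto (fun x : ℝ => 2 * c - x) (𝓝 c) (𝓝 (2 * c - c)) :=
      (continuous_const.sub continuous_id).tendsto c
    rw [show 2 * c - c = c by ring] at this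
    exact this.mono_left nhdsWithin_le_nhds
  · filter_upwards [self_mem_nhdsWithin] with x hx
    simp only [Set.mem_Ioi, Set.mem_Iio] at *
    linarith

/-- The left side is reduced to the right one by the reflection `x ↦ 2c - x`. -/
theorem exists_isLittleO_of_deriv {g g' : ℝ → ℝ} {c : ℝ} {k : ℕ} (j : Side)
    (hg : ∀ᶠ x in j.toC c, HasDerivAt g (g' x) x)
    (hb : g' =o[j.toC c] fun x => (x - c) ^ k) :
    ∃ a, (fun x => g x - a) =o[j.toC c] fun x => (x - c) ^ (k + 1) := by
  cases j with
  | pos => exact exists_isLittleO_of_deriv_right hg hb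
  | neg =>
    have hr := tendsto_reflect_nhdsGT c
    have h1 : ∀ᶠ x in 𝓝[>] c, HasDerivAt (fun x => g (2 * c - x)) (-(g' (2 * c - x))) x := by
      filter_upwards [hr.eventually hg] with x hx
      have := hx.comp x ((hasDerivAt_id x).const_sub (2 * c))
      simpa [Function.comp_def] using this
    have h2 : (fun x => -(g' (2 * c - x))) =o[𝓝[>] c] fun x => (x - c) ^ k := by
      refine IsLittleO.neg_left ((hb.comp_tendsto hr).trans_isBigO (IsBigO.of_bound 1 ?_))
      refine Eventually.of_forall fun x => ?_
      simp only [Function.comp, norm_pow, one_mul]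
      rw [← norm_neg]; ring_nf; rfl
    obtain ⟨a, ha⟩ := exists_isLittleO_of_deriv_right h1 h2
    refine ⟨a, ?_⟩
    have := ha.comp_tendsto (tendsto_reflect_nhdsLT c)
    refine (this.congr_left fun x => ?_).trans_isBigO (IsBigO.of_bound 1 ?_)
    · simp
    · refine Eventually.of_forall fun x => ?_
      simp only [Function.comp, norm_pow, one_mul]
      rw [← norm_neg]; ring_nf; rfl

/-! ### One-sided neighbourhoods and the Taylor expansion at the cut-off. -/

instance (c : ℝ) (j : Side) : (j.toC c).NeBot := by
  cases j <;> (unfold Side.toC; infer_instance)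

theorem Side.toC_le (c : ℝ) (j : Side) : j.toC c ≤ 𝓝 c := by
  cases j <;> exact nhdsWithin_le_nhds

theorem Side.isOpen_nbhd (c δ : ℝ) (j : Side) : IsOpen (j.nbhd c δ) := by
  cases j <;> exact isOpen_Ioo

theorem Side.nbhd_mem_toC (c : ℝ) {δ : ℝ} (hδ : 0 < δ) (j : Side) : j.nbhd c δ ∈ j.toC c := by
  cases j
  · exact Ioo_mem_nhdsGT (by linarith)
  · exact Ioo_mem_nhdsLT (by linarith)

theorem Side.tendsto_sub (c : ℝ) (j : Side) : Tendsto (fun x => x - c) (j.toC c) (𝓝 0) := by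
  have : Tendsto (fun x => x - c) (𝓝 c) (𝓝 (c - c)) := (continuous_sub_right c).tendsto c
  rw [sub_self] at this
  exact this.mono_left (j.toC_le c)

theorem tendsto_of_sub_isLittleO {g : ℝ → ℝ} {a c : ℝ} {j : Side} {k : ℕ}
    (h : (fun x => g x - a) =o[j.toC c] fun x => (x - c) ^ (k + 1)) :
    Tendsto g (j.toC c) (𝓝 a) := by
  have h0 : Tendsto (fun x => (x - c) ^ (k + 1)) (j.toC c) (𝓝 0) := by
    simpa using (j.tendsto_sub c).pow (k + 1)
  have := (h.trans_tendsto h0).add_const a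
  simpa using this

/-- Third order one-sided Taylor expansion, from the one-sided limits of the function and of its
second and third derivatives. -/
theorem exists_taylor {m : ℝ → ℝ} {c δ m0 m2 m3 : ℝ} (hδ : 0 < δ) (j : Side)
    (hm : ContDiffOn ℝ 3 m (j.nbhd c δ)) (h0 : Tendsto m (j.toC c) (𝓝 m0))
    (h2 : Tendsto (iteratedDeriv 2 m) (j.toC c) (𝓝 m2))
    (h3 : Tendsto (iteratedDeriv 3 m) (j.toC c) (𝓝 m3)) :
    ∃ m1, (fun x => m x - m0 - m1 * (x - c) - (m2 / 2 + m3 / 6 * (x - c)) * (x - c) ^ 2)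
      =o[j.toC c] fun x => (x - c) ^ 3 := by
  have hU := j.isOpen_nbhd c δ
  have hUm := j.nbhd_mem_toC c hδ
  rw [iteratedDeriv_eq_iterate] at h2 h3
  simp only [Function.iterate_succ, Function.iterate_zero, Function.comp, id] at h2 h3
  have d1 : ContDiffOn ℝ 2 (deriv m) (j.nbhd c δ) := hm.deriv_of_isOpen hU (by norm_num)
  have d2 : ContDiffOn ℝ 1 (deriv (deriv m)) (j.nbhd c δ) := d1.deriv_of_isOpen hU (by norm_num)
  have e0 : ∀ᶠ x in j.toC c, HasDerivAt m (deriv m x) x := by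
    filter_upwards [hUm] with x hx
    exact ((hm.contDiffAt (hU.mem_nhds hx)).differentiableAt (by norm_num)).hasDerivAt
  have e1 : ∀ᶠ x in j.toC c, HasDerivAt (deriv m) (deriv (deriv m) x) x := by
    filter_upwards [hUm] with x hx
    exact ((d1.contDiffAt (hU.mem_nhds hx)).differentiableAt (by norm_num)).hasDerivAt
  have e2 : ∀ᶠ x in j.toC c, HasDerivAt (deriv (deriv m)) (deriv (deriv (deriv m)) x) x := by
    filter_upwards [hUm] with x hx
    exact ((d2.contDiffAt (hU.mem_nhds hx)).differentiableAt (by norm_num)).hasDerivAt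
  have hid : ∀ x, HasDerivAt (fun x => x - c) 1 x := fun x => (hasDerivAt_id x).sub_const c
  have b3 : (fun x => deriv (deriv (deriv m)) x - m3) =o[j.toC c] fun x => (x - c) ^ 0 := by
    simp only [pow_zero]
    rw [isLittleO_one_iff]
    simpa using h3.sub_const m3
  -- Integrate upwards from the third derivative. The constants obtained at the second and zeroth
  -- stages are identified with the given limits by uniqueness. The one at the first stage, `a1`, is
  -- not prescribed and becomes the slope `m1`.
  obtain ⟨a2, ha2⟩ := exists_isLittleO_of_deriv j (g := fun x => deriv (deriv m) x - m3 * (x - c))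
    (by filter_upwards [e2] with x hx
        exact (hx.fun_sub ((hid x).const_mul m3)).congr_deriv (by ring)) b3
  have t2 := tendsto_of_sub_isLittleO ha2
  have : a2 = m2 := by
    refine tendsto_nhds_unique t2 ?_
    simpa using h2.sub ((j.tendsto_sub c).const_mul m3)
  subst this
  obtain ⟨a1, ha1⟩ := exists_isLittleO_of_deriv j
    (g := fun x => deriv m x - a2 * (x - c) - m3 / 2 * (x - c) ^ 2)
    (by filter_upwards [e1] with x hx
        exact ((hx.fun_sub ((hid x).const_mul a2)).fun_sub
          (((hid x).fun_pow 2).const_mul (m3 / 2))).congr_deriv (by push_cast; ring)) ha2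
  obtain ⟨a0, ha0⟩ := exists_isLittleO_of_deriv j
    (g := fun x => m x - a1 * (x - c) - a2 / 2 * (x - c) ^ 2 - m3 / 6 * (x - c) ^ 3)
    (by filter_upwards [e0] with x hx
        exact (((hx.fun_sub ((hid x).const_mul a1)).fun_sub
          (((hid x).fun_pow 2).const_mul (a2 / 2))).fun_sub
          (((hid x).fun_pow 3).const_mul (m3 / 6))).congr_deriv (by push_cast; ring)) ha1
  have t0 := tendsto_of_sub_isLittleO ha0
  have : a0 = m0 := by
    refine tendsto_nhds_unique t0 ?_
    have hs := j.tendsto_sub c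
    simpa using ((h0.sub (hs.const_mul a1)).sub ((hs.pow 2).const_mul (a2 / 2))).sub
      ((hs.pow 3).const_mul (m3 / 6))
  subst this
  exact ⟨a1, ha0.congr_left fun x => by ring⟩

end Taylor

/-! ### Kernel-weighted integrals near the cut-off -/

section KernelIntegrals

/-- The filter of almost every point close to `c` on one side. -/
noncomputable def Side.near (c : ℝ) (j : Side) : Filter ℝ := j.toC c ⊓ ae volume

/-- A symmetric continuous weight supported in `[-A, A]` and bounded by `B`. -/
structure IsWeight (κ : ℝ → ℝ) (A B : ℝ) : Prop where
  continuous : Continuous κ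
  symm : ∀ u, κ (-u) = κ u
  supp : ∀ u, A < |u| → κ u = 0
  bound : ∀ u, |κ u| ≤ B
  one_le : 1 ≤ A
  nonneg : 0 ≤ B

/-- `∫_0^∞ u^k κ(u) du`. -/
noncomputable def kmom (κ : ℝ → ℝ) (k : ℕ) : ℝ := ∫ u in Set.Ioi (0 : ℝ), u ^ k * κ u

/-- The weight `κ(u) u^k`, `u = (x - c) / h`, of an observation at `x` on side `j`. -/
noncomputable def wt (κ : ℝ → ℝ) (c : ℝ) (j : Side) (h : ℝ) (k : ℕ) (x : ℝ) : ℝ :=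
  (j.half c).indicator (fun t => κ ((t - c) / h) * ((t - c) / h) ^ k) x

/-- `h⁻¹ ∫ κ(u) u^k g(x) dx` over side `j`. -/
noncomputable def locInt (κ : ℝ → ℝ) (c : ℝ) (j : Side) (h : ℝ) (k : ℕ) (g : ℝ → ℝ) : ℝ :=
  h⁻¹ * ∫ x, wt κ c j h k x * g x

theorem Side.measurableSet_half (c : ℝ) (j : Side) : MeasurableSet (j.half c) := by
  cases j
  · exact measurableSet_Ici
  · exact measurableSet_Iio

theorem Side.near_le (c : ℝ) (j : Side) : j.near c ≤ j.toC c := inf_le_left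

theorem Side.exists_of_near {c : ℝ} {j : Side} {p : ℝ → Prop} (hp : ∀ᶠ x in j.near c, p x) :
    ∃ δ > 0, ∀ᵐ x : ℝ, x ∈ j.nbhd c δ → p x := by
  obtain ⟨s, hs, t, ht, hst⟩ := mem_inf_iff.1 hp
  have : ∃ δ > 0, j.nbhd c δ ⊆ s := by
    cases j with
    | pos =>
      obtain ⟨u, hu, hsub⟩ := mem_nhdsGT_iff_exists_Ioo_subset.1 hs
      exact ⟨u - c, sub_pos.2 hu, by simpa [Side.nbhd] using hsub⟩
    | neg =>
      obtain ⟨u, hu, hsub⟩ := mem_nhdsLT_iff_exists_Ioo_subset.1 hs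
      exact ⟨c - u, sub_pos.2 hu, by simpa [Side.nbhd] using hsub⟩
  obtain ⟨δ, hδ, hsub⟩ := this
  refine ⟨δ, hδ, ?_⟩
  filter_upwards [ht] with x hx hxn
  have : x ∈ {x | p x} := by rw [hst]; exact ⟨hsub hxn, hx⟩
  exact this

theorem Side.near_of_ae {c δ : ℝ} (hδ : 0 < δ) {j : Side} {p : ℝ → Prop}
    (hp : ∀ᵐ x : ℝ, x ∈ j.nbhd c δ → p x) : ∀ᶠ x in j.near c, p x := by
  have h1 : ∀ᶠ x in j.near c, x ∈ j.nbhd c δ := (j.near_le c) (j.nbhd_mem_toC c hδ)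
  have h2 : ∀ᶠ x in j.near c, x ∈ j.nbhd c δ → p x := (inf_le_right : j.near c ≤ ae volume) hp
  filter_upwards [h1, h2] with x hx h using h hx

variable {κ : ℝ → ℝ} {A B : ℝ}

theorem IsWeight.wt_of_lt (hκ : IsWeight κ A B) {c h : ℝ} (hh : 0 < h) (j : Side) (k : ℕ) {x : ℝ}
    (hx : A * h < |x - c|) : wt κ c j h k x = 0 := by
  unfold wt
  have : κ ((x - c) / h) = 0 := hκ.supp _ (by rw [abs_div, abs_of_pos hh, lt_div_iff₀ hh]; exact hx)
  by_cases hm : x ∈ j.half c <;> simp [hm, this]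

theorem IsWeight.abs_wt_le (hκ : IsWeight κ A B) {c h : ℝ} (hh : 0 < h) (j : Side) (k : ℕ)
    (x : ℝ) : |wt κ c j h k x| ≤ B * A ^ k := by
  have hA0 : 0 ≤ A := zero_le_one.trans hκ.one_le
  have hB0 := hκ.nonneg
  by_cases hx : A * h < |x - c|
  · rw [hκ.wt_of_lt hh j k hx, abs_zero]; positivity
  · unfold wt
    by_cases hm : x ∈ j.half c
    · rw [Set.indicator_of_mem hm, abs_mul, abs_pow]
      have : |(x - c) / h| ≤ A := by
        rw [abs_div, abs_of_pos hh, div_le_iff₀ hh]; exact not_lt.1 hx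
      have := hκ.bound ((x - c) / h)
      gcongr
    · rw [Set.indicator_of_notMem hm, abs_zero]; positivity

theorem IsWeight.measurable_wt (hκ : IsWeight κ A B) (c h : ℝ) (j : Side) (k : ℕ) :
    Measurable (wt κ c j h k) := by
  refine Measurable.indicator ?_ (j.measurableSet_half c)
  have := hκ.continuous.measurable
  fun_prop

theorem Side.mem_nbhd_of_half {c δ x : ℝ} {j : Side} (hx : x ∈ j.half c) (hne : x ≠ c)
    (hd : |x - c| < δ) : x ∈ j.nbhd c δ := by
  rw [abs_lt] at hd
  cases j with
  | pos => exact ⟨lt_of_le_of_ne hx hne.symm, by linarith⟩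
  | neg => exact ⟨by linarith, hx⟩

theorem IsWeight.ae_norm_wt_mul_le (hκ : IsWeight κ A B) {c h δ E : ℝ} (hh : 0 < h) {j : Side}
    (k : ℕ) (hδ : A * h < δ) {g : ℝ → ℝ} (hE : 0 ≤ E)
    (hg : ∀ᵐ x : ℝ, x ∈ j.nbhd c δ → |x - c| ≤ A * h → |g x| ≤ E) :
    ∀ᵐ x : ℝ, ‖wt κ c j h k x * g x‖
      ≤ (Set.Icc (c - A * h) (c + A * h)).indicator (fun _ => B * A ^ k * E) x := by
  have hA0 : 0 ≤ A := zero_le_one.trans hκ.one_le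
  have hB0 := hκ.nonneg
  -- The point `c` lies in the closed right half line but not in the open one-sided neighbourhood;
  -- as a null set it is discarded.
  filter_upwards [hg, Measure.ae_ne volume c] with x hx hne
  by_cases hxA : A * h < |x - c|
  · rw [hκ.wt_of_lt hh j k hxA, zero_mul, norm_zero]
    exact Set.indicator_nonneg (fun _ _ => by positivity) _
  · have hxA' := not_lt.1 hxA
    have hmem : x ∈ Set.Icc (c - A * h) (c + A * h) := by
      rw [abs_le] at hxA'; constructor <;> linarith
    rw [Set.indicator_of_mem hmem, norm_mul, Real.norm_eq_abs, Real.norm_eq_abs]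
    by_cases hm : x ∈ j.half c
    · have := hx (Side.mem_nbhd_of_half hm hne (hxA'.trans_lt hδ)) hxA'
      have h2 := hκ.abs_wt_le (c := c) hh j k x
      gcongr
    · have : wt κ c j h k x = 0 := Set.indicator_of_notMem hm _
      rw [this, abs_zero, zero_mul]; positivity

theorem integrable_indicator_Icc_const (a b E : ℝ) :
    Integrable ((Set.Icc a b).indicator fun _ : ℝ => E) :=
  (integrable_indicator_iff measurableSet_Icc).2 (integrableOn_const (by simp))

/-- The weight lives on an interval of length `2 A h`, which cancels the normalization `h⁻¹`. -/
theorem IsWeight.abs_locInt_le (hκ : IsWeight κ A B) {c h δ E : ℝ} (hh : 0 < h) {j : Side}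
    (k : ℕ) (hδ : A * h < δ) {g : ℝ → ℝ} (hE : 0 ≤ E)
    (hg : ∀ᵐ x : ℝ, x ∈ j.nbhd c δ → |x - c| ≤ A * h → |g x| ≤ E) :
    |locInt κ c j h k g| ≤ 2 * A * (B * A ^ k) * E := by
  have hA0 : 0 ≤ A := zero_le_one.trans hκ.one_le
  have h1 := norm_integral_le_of_norm_le (integrable_indicator_Icc_const _ _ _)
    (hκ.ae_norm_wt_mul_le hh k hδ hE hg)
  rw [integral_indicator measurableSet_Icc, setIntegral_const, smul_eq_mul, Real.norm_eq_abs,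
    Real.volume_real_Icc_of_le (by nlinarith)] at h1
  unfold locInt
  rw [abs_mul, abs_of_pos (inv_pos.2 hh), inv_mul_le_iff₀ hh]
  linarith

theorem IsWeight.integrable_wt_mul (hκ : IsWeight κ A B) {c h δ E : ℝ} (hh : 0 < h) {j : Side}
    (k : ℕ) (hδ : A * h < δ) {g : ℝ → ℝ} (hgm : AEStronglyMeasurable g volume) (hE : 0 ≤ E)
    (hg : ∀ᵐ x : ℝ, x ∈ j.nbhd c δ → |x - c| ≤ A * h → |g x| ≤ E) :
    Integrable fun x => wt κ c j h k x * g x :=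
  (integrable_indicator_Icc_const _ _ _).mono'
    ((hκ.measurable_wt c h j k).aestronglyMeasurable.mul hgm)
    (hκ.ae_norm_wt_mul_le hh k hδ hE hg)

theorem eventually_mul_lt (A : ℝ) {δ : ℝ} (hδ : 0 < δ) : ∀ᶠ h in 𝓝[>] (0 : ℝ), A * h < δ := by
  have : Tendsto (fun h : ℝ => A * h) (𝓝 0) (𝓝 (A * 0)) := (continuous_const_mul A).tendsto 0
  rw [mul_zero] at this
  exact (this.eventually_lt_const hδ).filter_mono nhdsWithin_le_nhds

/-- On the support of the weight `|x - c| ≤ A h`, so smallness in `x - c` turns into smallness in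
`h`. -/
theorem IsWeight.locInt_isLittleO (hκ : IsWeight κ A B) {c : ℝ} {j : Side} (k : ℕ) {p : ℕ}
    {g : ℝ → ℝ} (hg : g =o[j.near c] fun x => (x - c) ^ p) :
    (fun h => locInt κ c j h k g) =o[𝓝[>] 0] fun h => h ^ p := by
  have hA0 : 0 < A := zero_lt_one.trans_le hκ.one_le
  have hB0 := hκ.nonneg
  refine IsLittleO.of_bound fun ε hε => ?_
  -- The added 1 keeps `M` positive even when `B = 0`.
  set M := 2 * A * (B * A ^ k) * A ^ p + 1
  have hM : 0 < M := by positivity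
  obtain ⟨δ, hδ, hb⟩ := Side.exists_of_near (hg.def (show 0 < ε / M by positivity))
  filter_upwards [eventually_mul_lt A hδ, self_mem_nhdsWithin] with h hh hh0
  have hh0 : 0 < h := hh0
  have := hκ.abs_locInt_le (j := j) (c := c) (g := g) hh0 k hh
    (show 0 ≤ ε / M * (A * h) ^ p by positivity) (by
      filter_upwards [hb] with x hx hxn hxA
      have := hx hxn
      rw [Real.norm_eq_abs, norm_pow, Real.norm_eq_abs] at this
      refine this.trans ?_
      gcongr)
  rw [Real.norm_eq_abs, Real.norm_of_nonneg (by positivity)]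
  refine this.trans ?_
  calc 2 * A * (B * A ^ k) * (ε / M * (A * h) ^ p)
      = ε * h ^ p * ((2 * A * (B * A ^ k) * A ^ p) / M) := by rw [mul_pow]; ring
    _ ≤ ε * h ^ p * 1 := by
        gcongr
        rw [div_le_one hM]; simp [M]
    _ = _ := mul_one _

theorem IsWeight.eventually_integrable (hκ : IsWeight κ A B) {c : ℝ} {j : Side} (k : ℕ)
    {g : ℝ → ℝ} (hgm : AEStronglyMeasurable g volume)
    (hg : g =O[j.near c] fun _ => (1 : ℝ)) :
    ∀ᶠ h in 𝓝[>] (0 : ℝ), Integrable fun x => wt κ c j h k x * g x := by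
  obtain ⟨E, hE, hb⟩ := hg.exists_pos
  obtain ⟨δ, hδ, hb⟩ := Side.exists_of_near hb.bound
  filter_upwards [eventually_mul_lt A hδ, self_mem_nhdsWithin] with h hh hh0
  refine hκ.integrable_wt_mul hh0 k hh hgm hE.le ?_
  filter_upwards [hb] with x hx hxn _
  simpa using hx hxn

theorem integral_Iio_zero_eq (F : ℝ → ℝ) :
    ∫ u in Set.Iio (0 : ℝ), F u = ∫ u in Set.Ioi (0 : ℝ), F (-u) := by
  have := integral_comp_neg_Ioi (0 : ℝ) F
  rw [this, neg_zero, integral_Iic_eq_integral_Iio]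

/-- Substitute `x = c + h u`. On the left, the symmetry of the weight moves the integral to `(0, ∞)`
and leaves only the sign of `u ^ (k + p)`. -/
theorem IsWeight.locInt_pow (hκ : IsWeight κ A B) {c h : ℝ} (hh : 0 < h) (j : Side) (k p : ℕ) :
    locInt κ c j h k (fun x => (x - c) ^ p) = h ^ p * (j.sign ^ (k + p) * kmom κ (k + p)) := by
  have e : ∀ x, wt κ c j h k x * (x - c) ^ p
      = (fun u => (j.half 0).indicator (fun u => κ u * u ^ k) u * (h * u) ^ p) ((x - c) / h) := by
    intro x
    have hm : x ∈ j.half c ↔ (x - c) / h ∈ j.half 0 := by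
      cases j
      · simp [Side.half, le_div_iff₀ hh]
      · simp [Side.half, div_lt_iff₀ hh]
    unfold wt
    dsimp only
    have hx : h * ((x - c) / h) = x - c := by field_simp
    rw [hx]
    by_cases hx : x ∈ j.half c
    · rw [Set.indicator_of_mem hx, Set.indicator_of_mem (hm.1 hx)]
    · rw [Set.indicator_of_notMem hx, Set.indicator_of_notMem (fun h => hx (hm.2 h))]
  unfold locInt
  simp_rw [e]
  rw [integral_sub_right_eq_self (fun x => (fun u => (j.half 0).indicator (fun u => κ u * u ^ k) u
      * (h * u) ^ p) (x / h)) c, Measure.integral_comp_div (fun u => (j.half 0).indicator (fun u => κ u * u ^ k) u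
      * (h * u) ^ p) h, smul_eq_mul, abs_of_pos hh,
    inv_mul_cancel_left₀ hh.ne']
  have e2 : ∀ u, (j.half 0).indicator (fun u => κ u * u ^ k) u * (h * u) ^ p
      = (j.half 0).indicator (fun u => h ^ p * (u ^ (k + p) * κ u)) u := by
    intro u
    by_cases hu : u ∈ j.half 0
    · rw [Set.indicator_of_mem hu, Set.indicator_of_mem hu]; ring
    · rw [Set.indicator_of_notMem hu, Set.indicator_of_notMem hu, zero_mul]
  simp_rw [e2]
  rw [integral_indicator (j.measurableSet_half 0), integral_const_mul]
  congr 1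
  unfold kmom
  cases j with
  | pos =>
    rw [Side.half, integral_Ici_eq_integral_Ioi]
    simp [Side.sign]
  | neg =>
    rw [Side.half, integral_Iio_zero_eq, ← integral_const_mul]
    refine integral_congr_ae (Eventually.of_forall fun u => ?_)
    simp only [hκ.symm, Side.sign]
    rw [neg_pow]; ring

/-- First order expansion of a function of `h` at `0+`. -/
def HasExpansion (s : ℝ → ℝ) (a a' : ℝ) : Prop :=
  (fun h => s h - (a + a' * h)) =o[𝓝[>] 0] fun h => h

theorem isBigO_pow_of_le {c : ℝ} {j : Side} {p q : ℕ} (h : p ≤ q) :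
    (fun x => (x - c) ^ q) =O[j.near c] fun x => (x - c) ^ p := by
  have : ∀ᶠ x in j.near c, |x - c| < 1 := by
    have := (j.tendsto_sub c).abs.eventually_lt_const (show |(0 : ℝ)| < 1 by simp)
    exact (j.near_le c) this
  refine IsBigO.of_bound 1 ?_
  filter_upwards [this] with x hx
  rw [norm_pow, norm_pow, one_mul, Real.norm_eq_abs]
  exact pow_le_pow_of_le_one (abs_nonneg _) hx.le h

/-- The polynomial part is integrated exactly by `locInt_pow`, and the remainder is negligible by
`locInt_isLittleO`. It is applied with `p = 0` to the density and with `p = 2` to the conditional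
mean of a residual times the density. -/
theorem IsWeight.locInt_hasExpansion (hκ : IsWeight κ A B) {c : ℝ} {j : Side} (k p : ℕ)
    {g : ℝ → ℝ} (hgm : AEStronglyMeasurable g volume) {a b : ℝ}
    (hg : (fun x => g x - (a + b * (x - c)) * (x - c) ^ p) =o[j.near c]
      fun x => (x - c) ^ (p + 1)) :
    HasExpansion (fun h => locInt κ c j h k g / h ^ p)
      (j.sign ^ (k + p) * (a * kmom κ (k + p)))
      (j.sign ^ (k + p) * (j.sign * b * kmom κ (k + p + 1))) := by
  set r := fun x => g x - (a + b * (x - c)) * (x - c) ^ p with hr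
  have hrm : AEStronglyMeasurable r volume :=
    hgm.sub (by fun_prop : Measurable fun x : ℝ => (a + b * (x - c)) * (x - c) ^ p).aestronglyMeasurable
  have hO : ∀ q : ℕ, (fun x => (x - c) ^ q) =O[j.near c] fun _ => (1 : ℝ) := fun q => by
    simpa using isBigO_pow_of_le (c := c) (j := j) (Nat.zero_le q)
  have h1 := hκ.locInt_isLittleO k hg
  have ir := hκ.eventually_integrable k hrm (hg.isBigO.trans (hO _))
  have ip := hκ.eventually_integrable (j := j) (c := c) k
    (by fun_prop : Measurable fun x : ℝ => (x - c) ^ p).aestronglyMeasurable (hO _)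
  have ip1 := hκ.eventually_integrable (j := j) (c := c) k
    (by fun_prop : Measurable fun x : ℝ => (x - c) ^ (p + 1)).aestronglyMeasurable (hO _)
  have key : (fun h => locInt κ c j h k g / h ^ p
      - (j.sign ^ (k + p) * (a * kmom κ (k + p))
        + j.sign ^ (k + p) * (j.sign * b * kmom κ (k + p + 1)) * h))
      =ᶠ[𝓝[>] 0] fun h => locInt κ c j h k r / h ^ p := by
    filter_upwards [ir, ip, ip1, self_mem_nhdsWithin] with h i0 i1 i2 hh
    have hh : 0 < h := hh
    have e : locInt κ c j h k g = locInt κ c j h k r + (a * locInt κ c j h k (fun x => (x - c) ^ p)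
        + b * locInt κ c j h k (fun x => (x - c) ^ (p + 1))) := by
      unfold locInt
      have : ∀ x, wt κ c j h k x * g x = wt κ c j h k x * r x
          + (a * (wt κ c j h k x * (x - c) ^ p) + b * (wt κ c j h k x * (x - c) ^ (p + 1))) := by
        intro x; simp only [hr]; ring
      simp_rw [this]
      rw [integral_add i0 ((i1.const_mul a).fun_add (i2.const_mul b)),
        integral_add (i1.const_mul a) (i2.const_mul b), integral_const_mul, integral_const_mul]
      ring
    rw [e, hκ.locInt_pow hh, hκ.locInt_pow hh]
    field_simp
    rw [pow_succ h p, ← add_assoc k p 1, pow_succ j.sign]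
    ring
  refine IsLittleO.congr' ?_ key.symm (EventuallyEq.refl _ _)
  have h2 : (fun h : ℝ => (h ^ p)⁻¹) =O[𝓝[>] 0] fun h : ℝ => (h ^ p)⁻¹ := isBigO_refl _ _
  refine (h1.mul_isBigO h2).congr' ?_ ?_
  · exact Eventually.of_forall fun h => rfl
  · filter_upwards [self_mem_nhdsWithin] with h hh
    have hh : (h : ℝ) ≠ 0 := ne_of_gt hh
    field_simp
    ring

/-- Zeroth order counterpart, for the conditional second moments, where only the one-sided limit is
required. -/
theorem IsWeight.tendsto_locInt (hκ : IsWeight κ A B) {c : ℝ} {j : Side} (k : ℕ)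
    {g : ℝ → ℝ} (hgm : AEStronglyMeasurable g volume) {a : ℝ}
    (hg : Tendsto g (j.near c) (𝓝 a)) :
    Tendsto (fun h => locInt κ c j h k g) (𝓝[>] 0) (𝓝 (j.sign ^ k * (a * kmom κ k))) := by
  set r := fun x => g x - a with hr
  have hrm : AEStronglyMeasurable r volume := hgm.sub aestronglyMeasurable_const
  have hr0 : r =o[j.near c] fun x => (x - c) ^ 0 := by
    simp only [pow_zero]
    rw [isLittleO_one_iff]
    simpa [hr] using hg.sub_const a
  have h1 := hκ.locInt_isLittleO k hr0
  simp only [pow_zero] at h1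
  rw [isLittleO_one_iff] at h1
  have ir := hκ.eventually_integrable k hrm (by simpa using hr0.isBigO)
  have ip := hκ.eventually_integrable (j := j) (c := c) k
    (aestronglyMeasurable_const (b := (1 : ℝ))) (isBigO_refl _ _)
  have h2 := h1.add_const (j.sign ^ k * (a * kmom κ k))
  rw [zero_add] at h2
  refine h2.congr' ?_
  filter_upwards [ir, ip, self_mem_nhdsWithin] with h i0 i1 hh
  have e : locInt κ c j h k g = locInt κ c j h k r
      + a * locInt κ c j h k (fun x => (x - c) ^ 0) := by
    unfold locInt
    have : ∀ x, wt κ c j h k x * g x = wt κ c j h k x * r x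
        + a * (wt κ c j h k x * 1) := by
      intro x; simp only [hr]; ring
    simp_rw [this, pow_zero]
    rw [integral_add i0 (i1.const_mul a), integral_const_mul]
    ring
  rw [e, hκ.locInt_pow hh]
  simp; ring

end KernelIntegrals

/-! ### From conditional moments to integrals against the density -/

section Conditional

set_option linter.unusedSectionVars false

variable {Ω : Type*} [MeasurableSpace Ω] {P : Measure Ω} [IsProbabilityMeasure P]
  {Y D X : Ω → ℝ} {f : ℝ → ℝ}

/-- The conditional expectation of `ψ(x, (Y, D))` given `X = x`. -/
noncomputable def condMean (P : Measure Ω) [IsProbabilityMeasure P] (Y D X : Ω → ℝ)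
    (ψ : ℝ × ℝ × ℝ → ℝ) (x : ℝ) : ℝ :=
  ∫ p, ψ (x, p) ∂(condDistrib (fun ω => (Y ω, D ω)) X P x)

theorem measurable_condMean {ψ : ℝ × ℝ × ℝ → ℝ} (hψ : Measurable ψ) :
    Measurable (condMean P Y D X ψ) :=
  (hψ.stronglyMeasurable.integral_condDistrib).measurable

theorem integral_density_eq (hfm : Measurable f) (hf0 : ∀ x, 0 ≤ f x)
    (hdens : P.map X = volume.withDensity fun x => ENNReal.ofReal (f x)) (g : ℝ → ℝ) :
    ∫ x, g x ∂(P.map X) = ∫ x, g x * f x := by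
  rw [hdens, integral_withDensity_eq_integral_toReal_smul hfm.ennreal_ofReal
    (Eventually.of_forall fun _ => ENNReal.ofReal_lt_top)]
  refine integral_congr_ae (Eventually.of_forall fun x => ?_)
  simp [ENNReal.toReal_ofReal (hf0 x), mul_comm]

theorem integrable_density_iff (hfm : Measurable f) (hf0 : ∀ x, 0 ≤ f x)
    (hdens : P.map X = volume.withDensity fun x => ENNReal.ofReal (f x)) (g : ℝ → ℝ) :
    Integrable g (P.map X) ↔ Integrable fun x => g x * f x := by
  rw [hdens, integrable_withDensity_iff hfm.ennreal_ofReal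
    (Eventually.of_forall fun _ => ENNReal.ofReal_lt_top)]
  simp [ENNReal.toReal_ofReal (hf0 _)]

/-- The joint law of `X` and `(Y, D)` is the law of `X` composed with the conditional distribution;
the law of `X` is then written with its density. -/
theorem integral_mul_cond (hYm : Measurable Y) (hDm : Measurable D) (hXm : Measurable X)
    (hfm : Measurable f) (hf0 : ∀ x, 0 ≤ f x)
    (hdens : P.map X = volume.withDensity fun x => ENNReal.ofReal (f x))
    {ψ : ℝ × ℝ × ℝ → ℝ} (hψ : Measurable ψ) {w : ℝ → ℝ} (hw : Measurable w)
    (hint : Integrable (fun ω => w (X ω) * ψ (X ω, Y ω, D ω)) P) :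
    ∫ ω, w (X ω) * ψ (X ω, Y ω, D ω) ∂P = ∫ x, w x * (condMean P Y D X ψ x * f x) := by
  have hYD : Measurable fun ω => (Y ω, D ω) := hYm.prodMk hDm
  have hmap := compProd_map_condDistrib (mβ := inferInstance) (μ := P) (X := X) hYD.aemeasurable
  have hF : Measurable fun z : ℝ × ℝ × ℝ => w z.1 * ψ z := (hw.comp measurable_fst).mul hψ
  have hpair : Measurable fun ω => (X ω, Y ω, D ω) := hXm.prodMk hYD
  have h1 : ∫ ω, w (X ω) * ψ (X ω, Y ω, D ω) ∂P
      = ∫ z, w z.1 * ψ z ∂(P.map fun ω => (X ω, Y ω, D ω)) :=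
    (integral_map hpair.aemeasurable hF.aestronglyMeasurable).symm
  have hint' : Integrable (fun z : ℝ × ℝ × ℝ => w z.1 * ψ z)
      (P.map fun ω => (X ω, Y ω, D ω)) :=
    (integrable_map_measure hF.aestronglyMeasurable hpair.aemeasurable).2 hint
  rw [← hmap] at h1 hint'
  rw [h1, Measure.integral_compProd hint', integral_density_eq hfm hf0 hdens]
  refine integral_congr_ae (Eventually.of_forall fun x => ?_)
  simp only [integral_const_mul, condMean]
  ring

/-- Conditional moments are controlled only near the cut-off, so conditional integrability is asked
only where the weight is nonzero. Since `ψ ≥ 0`, its conditional mean is also its conditional `L¹`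
norm. -/
theorem integrable_mul_cond (hYm : Measurable Y) (hDm : Measurable D) (hXm : Measurable X)
    (hfm : Measurable f) (hf0 : ∀ x, 0 ≤ f x)
    (hdens : P.map X = volume.withDensity fun x => ENNReal.ofReal (f x))
    {ψ : ℝ × ℝ × ℝ → ℝ} (hψ : Measurable ψ) (hψ0 : ∀ z, 0 ≤ ψ z) {w : ℝ → ℝ} (hw : Measurable w)
    (hc : ∀ᵐ x ∂(P.map X), w x ≠ 0 →
      Integrable (fun p => ψ (x, p)) (condDistrib (fun ω => (Y ω, D ω)) X P x))
    (hint : Integrable fun x => w x * (condMean P Y D X ψ x * f x)) :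
    Integrable (fun ω => w (X ω) * ψ (X ω, Y ω, D ω)) P := by
  have hYD : Measurable fun ω => (Y ω, D ω) := hYm.prodMk hDm
  have hmap := compProd_map_condDistrib (mβ := inferInstance) (μ := P) (X := X) hYD.aemeasurable
  have hF : Measurable fun z : ℝ × ℝ × ℝ => w z.1 * ψ z := (hw.comp measurable_fst).mul hψ
  have hpair : Measurable fun ω => (X ω, Y ω, D ω) := hXm.prodMk hYD
  refine (integrable_map_measure (f := fun ω => (X ω, Y ω, D ω))
    hF.aestronglyMeasurable hpair.aemeasurable).1 ?_
  rw [← hmap, Measure.integrable_compProd_iff hF.aestronglyMeasurable]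
  refine ⟨?_, ?_⟩
  · filter_upwards [hc] with x hx
    by_cases h0 : w x = 0
    · simp [h0]
    · exact (hx h0).const_mul _
  · rw [integrable_density_iff hfm hf0 hdens]
    refine hint.norm.congr (Eventually.of_forall fun x => ?_)
    have : ∫ p, ‖w x * ψ (x, p)‖ ∂(condDistrib (fun ω => (Y ω, D ω)) X P x)
        = |w x| * condMean P Y D X ψ x := by
      unfold condMean
      rw [← integral_const_mul]
      refine integral_congr_ae (Eventually.of_forall fun p => ?_)
      simp [abs_of_nonneg (hψ0 _)]
    dsimp only
    rw [this, norm_mul, norm_mul, Real.norm_eq_abs, Real.norm_of_nonneg (hf0 x),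
      Real.norm_of_nonneg (show 0 ≤ condMean P Y D X ψ x from integral_nonneg fun p => hψ0 _),
      mul_assoc]

/-- Conditional moments are determined only up to null sets of the law of `X`, hence nothing is
known where `f` vanishes. In the integrals below they always come multiplied by `f`, so this is
harmless. -/
theorem ae_density_iff (hfm : Measurable f) (hf0 : ∀ x, 0 ≤ f x)
    (hdens : P.map X = volume.withDensity fun x => ENNReal.ofReal (f x)) {p : ℝ → Prop}
    (hp : ∀ᵐ x ∂(P.map X), p x) : ∀ᵐ x : ℝ, f x ≠ 0 → p x := by
  rw [hdens, ae_withDensity_iff hfm.ennreal_ofReal] at hp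
  filter_upwards [hp] with x hx hfx
  refine hx ?_
  rw [ENNReal.ofReal_ne_zero_iff]
  exact lt_of_le_of_ne (hf0 x) hfx.symm

/-- The deviation of `α Y + β D` from a line in `X - c`. -/
def resid (α β a b c : ℝ) (z : ℝ × ℝ × ℝ) : ℝ := α * z.2.1 + β * z.2.2 - a - b * (z.1 - c)

theorem measurable_resid (α β a b c : ℝ) : Measurable (resid α β a b c) := by
  unfold resid; fun_prop

/-- `IsCondMoments` includes square integrability of the first coordinate only; for the second it
comes from `D ∈ {0, 1}`. -/
theorem ae_condDistrib_snd (hYm : Measurable Y) (hDm : Measurable D) (hXm : Measurable X)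
    (hD : ∀ᵐ ω ∂P, D ω = 0 ∨ D ω = 1) :
    ∀ᵐ x ∂(P.map X), MemLp (Prod.snd : ℝ × ℝ → ℝ) 2
      (condDistrib (fun ω => (Y ω, D ω)) X P x) := by
  have hYD : Measurable fun ω => (Y ω, D ω) := hYm.prodMk hDm
  have hmap := compProd_map_condDistrib (mβ := inferInstance) (μ := P) (X := X) hYD.aemeasurable
  have hms : MeasurableSet {z : ℝ × ℝ × ℝ | |z.2.2| ≤ 1} :=
    measurableSet_le (by fun_prop) measurable_const
  have h1 : ∀ᵐ z ∂(P.map fun ω => (X ω, Y ω, D ω)), |z.2.2| ≤ 1 := by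
    rw [ae_map_iff (hXm.prodMk hYD).aemeasurable hms]
    filter_upwards [hD] with ω hω
    rcases hω with h | h <;> simp [h]
  rw [← hmap] at h1
  filter_upwards [Measure.ae_ae_of_ae_compProd h1] with x hx
  exact MemLp.of_bound measurable_snd.aestronglyMeasurable 1 hx

/-- Conditional first and second moments of `resid`. -/
theorem condMean_resid {U : Set ℝ} {mY mD sY sD sYD : ℝ → ℝ} (hYm : Measurable Y)
    (hDm : Measurable D) (hXm : Measurable X) (hD : ∀ᵐ ω ∂P, D ω = 0 ∨ D ω = 1)
    (hcond : IsCondMoments P Y D X U mY mD sY sD sYD) (α β a b c : ℝ) :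
    ∀ᵐ x ∂(P.map X), x ∈ U →
      Integrable (fun p => resid α β a b c (x, p) ^ 2)
        (condDistrib (fun ω => (Y ω, D ω)) X P x) ∧
      condMean P Y D X (resid α β a b c) x = α * mY x + β * mD x - a - b * (x - c) ∧
      condMean P Y D X (fun z => resid α β a b c z ^ 2) x
        = α ^ 2 * sY x + 2 * α * β * sYD x + β ^ 2 * sD x
          + (α * mY x + β * mD x - a - b * (x - c)) ^ 2 := by
  filter_upwards [hcond, ae_condDistrib_snd hYm hDm hXm hD] with x hx h2 hxU
  obtain ⟨h1, e1, e2, e3, e4, e5⟩ := hx hxU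
  set μ := condDistrib (fun ω => (Y ω, D ω)) X P x
  have hαY : MemLp (fun p : ℝ × ℝ => α * p.1) 2 μ := h1.const_mul α
  have hβD : MemLp (fun p : ℝ × ℝ => β * p.2) 2 μ := h2.const_mul β
  have hZ : MemLp (fun p : ℝ × ℝ => α * p.1 + β * p.2) 2 μ := hαY.add hβD
  have hr : ∀ p : ℝ × ℝ, resid α β a b c (x, p) = (α * p.1 + β * p.2) - (a + b * (x - c)) := by
    intro p; simp only [resid]; ring
  have hR : MemLp (fun p => resid α β a b c (x, p)) 2 μ := by
    simp_rw [hr]; exact hZ.sub (memLp_const _)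
  have hmean : ∫ p, resid α β a b c (x, p) ∂μ = α * mY x + β * mD x - a - b * (x - c) := by
    simp_rw [hr]
    rw [integral_sub (hZ.integrable (by norm_num)) (integrable_const _),
      integral_add (hαY.integrable (by norm_num)) (hβD.integrable (by norm_num)),
      integral_const_mul, integral_const_mul, ← e1, ← e2]
    simp; ring
  have hvar : Var[fun p => resid α β a b c (x, p); μ]
      = α ^ 2 * sY x + 2 * α * β * sYD x + β ^ 2 * sD x := by
    simp_rw [hr]
    rw [variance_sub_const hZ.1, variance_fun_add hαY hβD, variance_const_mul, variance_const_mul,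
      covariance_const_mul_left, covariance_const_mul_right, e3, e4, e5]
    ring
  refine ⟨hR.integrable_sq, hmean, ?_⟩
  have := variance_eq_sub hR
  simp only [Pi.pow_apply] at this
  rw [hvar, hmean] at this
  simp only [condMean]
  linarith

/-- Assumptions on one observation `(Y, D, X)` and one side of the cut-off `c`. -/
structure SideModel (P : Measure Ω) [IsProbabilityMeasure P] (Y D X : Ω → ℝ) (f : ℝ → ℝ)
    (c δ : ℝ) (j : Side) (mY mD sY sD sYD : ℝ → ℝ) (b : BoundaryValues) : Prop where
  measY : Measurable Y
  measD : Measurable D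
  measX : Measurable X
  binary : ∀ᵐ ω ∂P, D ω = 0 ∨ D ω = 1
  measf : Measurable f
  f_nonneg : ∀ x, 0 ≤ f x
  density : P.map X = volume.withDensity fun x => ENNReal.ofReal (f x)
  differentiable : DifferentiableAt ℝ f c
  δ_pos : 0 < δ
  cond : IsCondMoments P Y D X (j.nbhd c δ) mY mD sY sD sYD
  smoothY : ContDiffOn ℝ 3 mY (j.nbhd c δ)
  smoothD : ContDiffOn ℝ 3 mD (j.nbhd c δ)
  limits : b.IsLimit (j.toC c) mY mD sY sD sYD

variable {c δ : ℝ} {j : Side} {mY mD sY sD sYD : ℝ → ℝ} {b : BoundaryValues}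
  {κ : ℝ → ℝ} {A B : ℝ}

/-! ### Expansions of design and residual moments on one side. -/

theorem SideModel.tendsto_f (hM : SideModel P Y D X f c δ j mY mD sY sD sYD b) :
    Tendsto f (j.near c) (𝓝 (f c)) :=
  hM.differentiable.continuousAt.tendsto.mono_left ((j.near_le c).trans (j.toC_le c))

theorem SideModel.f_expansion (hM : SideModel P Y D X f c δ j mY mD sY sD sYD b) :
    (fun x => f x - (f c + deriv f c * (x - c))) =o[j.near c] fun x => x - c := by
  have h := hasDerivAt_iff_isLittleO.1 hM.differentiable.hasDerivAt
  refine (h.mono ((j.near_le c).trans (j.toC_le c))).congr_left fun x => ?_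
  simp only [smul_eq_mul]; ring

/-- Moments of the design. -/
theorem SideModel.design_eq (hM : SideModel P Y D X f c δ j mY mD sY sD sYD b)
    (hκ : IsWeight κ A B) (h : ℝ) (k : ℕ) :
    h⁻¹ * ∫ ω, wt κ c j h k (X ω) ∂P = locInt κ c j h k f := by
  unfold locInt
  rw [← integral_density_eq hM.measf hM.f_nonneg hM.density,
    integral_map hM.measX.aemeasurable (hκ.measurable_wt c h j k).aestronglyMeasurable]

theorem SideModel.design_expansion (hM : SideModel P Y D X f c δ j mY mD sY sD sYD b)
    (hκ : IsWeight κ A B) (k : ℕ) :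
    HasExpansion (fun h => h⁻¹ * ∫ ω, wt κ c j h k (X ω) ∂P)
      (j.sign ^ k * (f c * kmom κ k)) (j.sign ^ k * (j.sign * deriv f c * kmom κ (k + 1))) := by
  have := hκ.locInt_hasExpansion (j := j) (c := c) k 0 hM.measf.aestronglyMeasurable
    (a := f c) (b := deriv f c) (by simpa using hM.f_expansion)
  simpa [hM.design_eq hκ] using this

theorem SideModel.near_of_cond (hM : SideModel P Y D X f c δ j mY mD sY sD sYD b)
    {p : ℝ → Prop} (hp : ∀ᵐ x ∂(P.map X), x ∈ j.nbhd c δ → p x) :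
    ∀ᶠ x in j.near c, f x ≠ 0 → p x := by
  refine Side.near_of_ae hM.δ_pos ?_
  filter_upwards [ae_density_iff hM.measf hM.f_nonneg hM.density hp] with x hx hxn hf
  exact hx hf hxn

/-- One-sided slope making the conditional mean of `resid` of second order. -/
theorem SideModel.exists_slope (hM : SideModel P Y D X f c δ j mY mD sY sD sYD b) (α β : ℝ) :
    ∃ b1, (fun x => α * mY x + β * mD x - (α * b.mY + β * b.mD) - b1 * (x - c)
        - ((α * b.mY2 + β * b.mD2) / 2 + (α * b.mY3 + β * b.mD3) / 6 * (x - c)) * (x - c) ^ 2)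
      =o[j.toC c] fun x => (x - c) ^ 3 := by
  obtain ⟨bY, hY⟩ := exists_taylor hM.δ_pos j hM.smoothY hM.limits.lim_mY hM.limits.lim_mY2
    hM.limits.lim_mY3
  obtain ⟨bD, hD⟩ := exists_taylor hM.δ_pos j hM.smoothD hM.limits.lim_mD hM.limits.lim_mD2
    hM.limits.lim_mD3
  refine ⟨α * bY + β * bD, ((hY.const_mul_left α).add (hD.const_mul_left β)).congr_left
    fun x => ?_⟩
  ring

variable {α β b1 : ℝ}

/-- Product of the expansion `(p + q (x - c)) (x - c)²` of the conditional mean of the residual with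
the first order expansion of `f`. The cubic coefficient `p f' + q f` is the source of the terms in
`f'(c) / f(c)` and in the third derivatives. -/
theorem SideModel.condMean_expansion (hM : SideModel P Y D X f c δ j mY mD sY sD sYD b)
    (hb1 : (fun x => α * mY x + β * mD x - (α * b.mY + β * b.mD) - b1 * (x - c)
        - ((α * b.mY2 + β * b.mD2) / 2 + (α * b.mY3 + β * b.mD3) / 6 * (x - c)) * (x - c) ^ 2)
      =o[j.toC c] fun x => (x - c) ^ 3) :
    (fun x => condMean P Y D X (resid α β (α * b.mY + β * b.mD) b1 c) x * f x
        - ((α * b.mY2 + β * b.mD2) / 2 * f c + ((α * b.mY2 + β * b.mD2) / 2 * deriv f c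
          + (α * b.mY3 + β * b.mD3) / 6 * f c) * (x - c)) * (x - c) ^ 2)
      =o[j.near c] fun x => (x - c) ^ (2 + 1) := by
  set p := (α * b.mY2 + β * b.mD2) / 2
  set q := (α * b.mY3 + β * b.mD3) / 6
  set m0 := α * b.mY + β * b.mD
  set R := fun x => α * mY x + β * mD x - m0 - b1 * (x - c) - (p + q * (x - c)) * (x - c) ^ 2
    with hR
  have hb1' := hb1.mono (j.near_le c)
  have hS := hM.f_expansion
  have key : (fun x => condMean P Y D X (resid α β m0 b1 c) x * f x
        - (p * f c + (p * deriv f c + q * f c) * (x - c)) * (x - c) ^ 2)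
      =ᶠ[j.near c] fun x => R x * f x
        + ((p + q * (x - c)) * (f x - (f c + deriv f c * (x - c))) * (x - c) ^ 2
          + q * deriv f c * (x - c) * (x - c) ^ 3) := by
    have := hM.near_of_cond (condMean_resid hM.measY hM.measD hM.measX hM.binary hM.cond
      α β m0 b1 c)
    filter_upwards [this] with x hx
    -- Where `f x = 0` the conditional mean is unknown, but both sides vanish.
    have e : condMean P Y D X (resid α β m0 b1 c) x * f x
        = (α * mY x + β * mD x - m0 - b1 * (x - c)) * f x := by
      by_cases h0 : f x = 0
      · simp [h0]
      · rw [(hx h0).2.1]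
    rw [e, hR]; ring
  refine IsLittleO.congr' ?_ key.symm (EventuallyEq.refl _ _)
  have hsub : Tendsto (fun x => x - c) (j.near c) (𝓝 0) :=
    (j.tendsto_sub c).mono_left (j.near_le c)
  have o1 : (fun x => R x * f x) =o[j.near c] fun x => (x - c) ^ (2 + 1) := by
    simpa using hb1'.mul_isBigO (hM.tendsto_f.isBigO_one ℝ)
  have hpq : (fun x => p + q * (x - c)) =O[j.near c] fun _ => (1 : ℝ) :=
    (Tendsto.isBigO_one ℝ (tendsto_const_nhds.add (hsub.const_mul q)))
  have o2 : (fun x => (p + q * (x - c)) * (f x - (f c + deriv f c * (x - c))) * (x - c) ^ 2)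
      =o[j.near c] fun x => (x - c) ^ (2 + 1) := by
    refine ((hpq.mul_isLittleO hS).mul_isBigO (isBigO_refl (fun x => (x - c) ^ 2) _)).congr_right
      fun x => by ring
  have o3 : (fun x => q * deriv f c * (x - c) * (x - c) ^ 3) =o[j.near c]
      fun x => (x - c) ^ (2 + 1) := by
    have : (fun x => q * deriv f c * (x - c)) =o[j.near c] fun _ => (1 : ℝ) := by
      rw [isLittleO_one_iff]; simpa using hsub.const_mul (q * deriv f c)
    exact (this.mul_isBigO (isBigO_refl (fun x => (x - c) ^ 3) _)).congr_right fun x => by ring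
  exact o1.add (o2.add o3)

/-- The conditional second moment is the conditional variance plus the squared conditional mean. The
latter tends to zero because the residual is centred at the boundary value. -/
theorem SideModel.tendsto_condMean_sq (hM : SideModel P Y D X f c δ j mY mD sY sD sYD b) :
    Tendsto (fun x => condMean P Y D X (fun z => resid α β (α * b.mY + β * b.mD) b1 c z ^ 2) x
        * f x) (j.near c)
      (𝓝 ((α ^ 2 * b.sY + 2 * α * β * b.sYD + β ^ 2 * b.sD) * f c)) := by
  have hn := j.near_le c
  have hsub : Tendsto (fun x => x - c) (j.near c) (𝓝 0) := (j.tendsto_sub c).mono_left hn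
  have h1 := ((((hM.limits.lim_sY.mono_left hn).const_mul (α ^ 2)).add
    ((hM.limits.lim_sYD.mono_left hn).const_mul (2 * α * β))).add
    ((hM.limits.lim_sD.mono_left hn).const_mul (β ^ 2))).add
    ((((((hM.limits.lim_mY.mono_left hn).const_mul α).add
      ((hM.limits.lim_mD.mono_left hn).const_mul β)).sub_const (α * b.mY + β * b.mD)).sub
      (hsub.const_mul b1)).pow 2)
  have h2 := h1.mul hM.tendsto_f
  rw [show (α * b.mY + β * b.mD - (α * b.mY + β * b.mD) - b1 * 0) ^ 2 = 0 by ring, add_zero] at h2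
  refine h2.congr' ?_
  filter_upwards [hM.near_of_cond (condMean_resid hM.measY hM.measD hM.measX hM.binary hM.cond
      α β (α * b.mY + β * b.mD) b1 c)] with x hx
  by_cases h0 : f x = 0
  · simp [h0]
  · rw [(hx h0).2.2]

/-- Products of weights are again weights, for the squared kernel, so second moments are covered by
the same integrals; this is how the constants `ν_k` enter. -/
theorem wt_mul_wt (κ : ℝ → ℝ) (c : ℝ) (j : Side) (h : ℝ) (k l : ℕ) (x : ℝ) :
    wt κ c j h k x * wt κ c j h l x = wt (fun u => κ u ^ 2) c j h (k + l) x := by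
  unfold wt
  by_cases hx : x ∈ j.half c
  · simp only [Set.indicator_of_mem hx]; ring
  · simp [Set.indicator_of_notMem hx]

theorem IsWeight.sq (hκ : IsWeight κ A B) : IsWeight (fun u => κ u ^ 2) A (B ^ 2) where
  continuous := hκ.continuous.pow 2
  symm u := by rw [hκ.symm]
  supp u hu := by rw [hκ.supp u hu]; simp
  bound u := by
    rw [abs_pow]; exact pow_le_pow_left₀ (abs_nonneg _) (hκ.bound u) 2
  one_le := hκ.one_le
  nonneg := sq_nonneg _

/-- Second moments of the weighted deviations. -/
theorem SideModel.eventually_integrable_sq (hM : SideModel P Y D X f c δ j mY mD sY sD sYD b)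
    (hκ : IsWeight κ A B) (α β b1 : ℝ) (k : ℕ) :
    ∀ᶠ h in 𝓝[>] (0 : ℝ), Integrable (fun ω => wt κ c j h k (X ω)
      * resid α β (α * b.mY + β * b.mD) b1 c (X ω, Y ω, D ω) ^ 2) P := by
  set ψ : ℝ × ℝ × ℝ → ℝ := fun z => resid α β (α * b.mY + β * b.mD) b1 c z ^ 2
  have hψ : Measurable ψ := (measurable_resid _ _ _ _ _).pow_const 2
  have hG : AEStronglyMeasurable (fun x => condMean P Y D X ψ x * f x) volume :=
    ((measurable_condMean hψ).mul hM.measf).aestronglyMeasurable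
  have hA0 : 0 < A := zero_lt_one.trans_le hκ.one_le
  filter_upwards [hκ.eventually_integrable k hG (hM.tendsto_condMean_sq.isBigO_one ℝ),
    eventually_mul_lt A hM.δ_pos, self_mem_nhdsWithin] with h hint hAh hh
  have hh : 0 < h := hh
  refine integrable_mul_cond hM.measY hM.measD hM.measX hM.measf hM.f_nonneg hM.density
    hψ (fun z => sq_nonneg _) (hκ.measurable_wt c h j k) ?_ hint
  have hne : ∀ᵐ x ∂(P.map X), x ≠ c := by
    rw [hM.density]
    exact (withDensity_absolutelyContinuous _ _).ae_le (Measure.ae_ne volume c)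
  filter_upwards [hne, condMean_resid hM.measY hM.measD hM.measX hM.binary hM.cond
      α β (α * b.mY + β * b.mD) b1 c] with x hxc hx hw
  have h1 : x ∈ j.half c := by
    by_contra hn
    exact hw (Set.indicator_of_notMem hn _)
  have h2 : |x - c| < δ := by
    by_contra hn
    exact hw (hκ.wt_of_lt hh j k (hAh.trans_le (not_lt.1 hn)))
  exact (hx (Side.mem_nbhd_of_half h1 hxc h2)).1

theorem SideModel.tendsto_sq (hM : SideModel P Y D X f c δ j mY mD sY sD sYD b)
    (hκ : IsWeight κ A B) (α β b1 : ℝ) (k : ℕ) :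
    Tendsto (fun h => h⁻¹ * ∫ ω, wt κ c j h k (X ω)
      * resid α β (α * b.mY + β * b.mD) b1 c (X ω, Y ω, D ω) ^ 2 ∂P) (𝓝[>] 0)
      (𝓝 (j.sign ^ k * ((α ^ 2 * b.sY + 2 * α * β * b.sYD + β ^ 2 * b.sD) * f c * kmom κ k))) := by
  set ψ : ℝ × ℝ × ℝ → ℝ := fun z => resid α β (α * b.mY + β * b.mD) b1 c z ^ 2
  have hψ : Measurable ψ := (measurable_resid _ _ _ _ _).pow_const 2
  have hG : AEStronglyMeasurable (fun x => condMean P Y D X ψ x * f x) volume :=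
    ((measurable_condMean hψ).mul hM.measf).aestronglyMeasurable
  refine (hκ.tendsto_locInt k hG hM.tendsto_condMean_sq).congr' ?_
  filter_upwards [hM.eventually_integrable_sq hκ α β b1 k] with h hint
  unfold locInt
  rw [← integral_mul_cond hM.measY hM.measD hM.measX hM.measf hM.f_nonneg hM.density
    hψ (hκ.measurable_wt c h j k) hint]

theorem SideModel.eventually_memLp (hM : SideModel P Y D X f c δ j mY mD sY sD sYD b)
    (hκ : IsWeight κ A B) (α β b1 : ℝ) (k : ℕ) :
    ∀ᶠ h in 𝓝[>] (0 : ℝ), MemLp (fun ω => wt κ c j h k (X ω)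
      * resid α β (α * b.mY + β * b.mD) b1 c (X ω, Y ω, D ω)) 2 P := by
  filter_upwards [hM.eventually_integrable_sq hκ.sq α β b1 (k + k)] with h hint
  have hm : Measurable fun ω => wt κ c j h k (X ω)
      * resid α β (α * b.mY + β * b.mD) b1 c (X ω, Y ω, D ω) :=
    ((hκ.measurable_wt c h j k).comp hM.measX).mul
      ((measurable_resid _ _ _ _ _).comp (hM.measX.prodMk (hM.measY.prodMk hM.measD)))
  refine (memLp_two_iff_integrable_sq hm.aestronglyMeasurable).2 (hint.congr ?_)
  refine Eventually.of_forall fun ω => ?_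
  dsimp only
  rw [← wt_mul_wt]; ring

/-- First moments of the weighted deviations. -/
theorem SideModel.mean_expansion (hM : SideModel P Y D X f c δ j mY mD sY sD sYD b)
    (hκ : IsWeight κ A B)
    (hb1 : (fun x => α * mY x + β * mD x - (α * b.mY + β * b.mD) - b1 * (x - c)
        - ((α * b.mY2 + β * b.mD2) / 2 + (α * b.mY3 + β * b.mD3) / 6 * (x - c)) * (x - c) ^ 2)
      =o[j.toC c] fun x => (x - c) ^ 3) (k : ℕ) :
    HasExpansion (fun h => h⁻¹ * (∫ ω, wt κ c j h k (X ω)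
        * resid α β (α * b.mY + β * b.mD) b1 c (X ω, Y ω, D ω) ∂P) / h ^ 2)
      (j.sign ^ k * ((α * b.mY2 + β * b.mD2) / 2 * f c * kmom κ (k + 2)))
      (j.sign ^ k * (j.sign * ((α * b.mY2 + β * b.mD2) / 2 * deriv f c
        + (α * b.mY3 + β * b.mD3) / 6 * f c) * kmom κ (k + 3))) := by
  have hψ := measurable_resid α β (α * b.mY + β * b.mD) b1 c
  have hG : AEStronglyMeasurable
      (fun x => condMean P Y D X (resid α β (α * b.mY + β * b.mD) b1 c) x * f x) volume :=
    ((measurable_condMean hψ).mul hM.measf).aestronglyMeasurable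
  have h := hκ.locInt_hasExpansion k 2 hG (hM.condMean_expansion hb1)
  have hs : j.sign ^ (k + 2) = j.sign ^ k := by
    cases j <;> simp [Side.sign, pow_add]
  rw [hs] at h
  refine IsLittleO.congr' h ?_ (EventuallyEq.refl _ _)
  filter_upwards [hM.eventually_memLp hκ α β b1 k] with h hint
  unfold locInt
  rw [← integral_mul_cond hM.measY hM.measD hM.measX hM.measf hM.f_nonneg hM.density
    hψ (hκ.measurable_wt c h j k) (hint.integrable (by norm_num))]

end Conditional

/-! ### The estimator as a function of weighted sums -/

section Statistic

instance : DecidableEq Side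
  | .pos, .pos => isTrue rfl
  | .neg, .neg => isTrue rfl
  | .pos, .neg => isFalse (by simp)
  | .neg, .pos => isFalse (by simp)

instance : Fintype Side := ⟨{.pos, .neg}, fun j => by cases j <;> simp⟩

theorem Side.sum_eq (F : Side → ℝ) : ∑ j, F j = F .pos + F .neg := by
  have : (Finset.univ : Finset Side) = {.pos, .neg} := rfl
  rw [this, Finset.sum_pair (by simp)]

/-- Design determinant on side `j`; coordinates `0, 1, 2` are the moments of the design,
`3, 4` those of the centred treatment status. -/
def stDet (w : Side × Fin 5 → ℝ) (j : Side) : ℝ := w (j, 0) * w (j, 2) - w (j, 1) ^ 2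

/-- The estimated jump of the treatment status, as a function of the weighted sums. -/
noncomputable def stJump (t : ℝ) (w : Side × Fin 5 → ℝ) : ℝ :=
  t + ∑ j : Side, j.sign * ((w (j, 2) * w (j, 3) - w (j, 1) * w (j, 4)) / stDet w j)

/-- Values of the weighted sums for which the sample is non-degenerate. -/
def stGood (η t : ℝ) : Set (Side × Fin 5 → ℝ) :=
  {w | (∀ j, η ≤ |stDet w j|) ∧ η ≤ |stJump t w|}

/-- Numerators of the local linear weights. -/
def stNum (p : Side × Fin 2) (w : Side × Fin 5 → ℝ) : ℝ :=
  if p.2 = 0 then w (p.1, 2) else -w (p.1, 1)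

/-- Coefficients of the weighted residual sums in the estimation error. -/
noncomputable def stCoef (t : ℝ) (p : Side × Fin 2) (w : Side × Fin 5 → ℝ) : ℝ :=
  p.1.sign * stNum p w / (stDet w p.1 * stJump t w)

theorem Side.abs_sign (j : Side) : |j.sign| = 1 := by cases j <;> simp [Side.sign]

theorem Side.sign_sq (j : Side) : j.sign ^ 2 = 1 := by cases j <;> simp [Side.sign]

/-! ### Regularity and growth of the coefficient functions. -/

theorem contDiff_stDet (j : Side) : ContDiff ℝ 1 fun w => stDet w j := by
  unfold stDet; fun_prop

theorem contDiffAt_stJump (t : ℝ) {w : Side × Fin 5 → ℝ} (hw : ∀ j, stDet w j ≠ 0) :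
    ContDiffAt ℝ 1 (stJump t) w := by
  unfold stJump
  refine contDiffAt_const.add (ContDiffAt.sum fun j _ => contDiffAt_const.mul ?_)
  exact ContDiffAt.div (by fun_prop) (contDiff_stDet j).contDiffAt (hw j)

theorem contDiffAt_stCoef (t : ℝ) (p : Side × Fin 2) {w : Side × Fin 5 → ℝ}
    (hw : ∀ j, stDet w j ≠ 0) (hJ : stJump t w ≠ 0) : ContDiffAt ℝ 1 (stCoef t p) w := by
  unfold stCoef
  have hnum : ContDiffAt ℝ 1 (stNum p) w := by
    unfold stNum; split_ifs <;> fun_prop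
  exact (contDiffAt_const.mul hnum).div
    ((contDiff_stDet p.1).contDiffAt.mul (contDiffAt_stJump t hw)) (mul_ne_zero (hw _) hJ)

/-- The inequalities are strict at `w`, so they persist nearby. This is why `η` must lie strictly
below the limits of the determinants and of the jump. -/
theorem stGood_mem_nhds {η t : ℝ} (hη : 0 < η) {w : Side × Fin 5 → ℝ}
    (hw : ∀ j, η < |stDet w j|) (hJ : η < |stJump t w|) : stGood η t ∈ 𝓝 w := by
  have hne : ∀ j, stDet w j ≠ 0 := fun j h => by
    have := hw j; rw [h, abs_zero] at this; exact absurd this (not_lt.2 hη.le)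
  have h1 : ∀ j, ∀ᶠ v in 𝓝 w, η < |stDet v j| := fun j =>
    ((contDiff_stDet j).continuous.abs.continuousAt).eventually_const_lt (hw j)
  have h2 : ∀ᶠ v in 𝓝 w, η < |stJump t v| :=
    ((contDiffAt_stJump t hne).continuousAt.abs).eventually_const_lt hJ
  filter_upwards [eventually_all.2 h1, h2] with v h3 h4
  exact ⟨fun j => (h3 j).le, h4.le⟩

/-- The numerator is a coordinate of `w` up to sign, and on the good set the denominator is at least
`η²`. -/
theorem abs_stCoef_le {η t : ℝ} (hη : 0 < η) (p : Side × Fin 2) {w : Side × Fin 5 → ℝ}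
    (hw : w ∈ stGood η t) : |stCoef t p w| ≤ 1 / η ^ 2 * (1 + ‖w‖) := by
  unfold stCoef
  have hnum : |stNum p w| ≤ 1 + ‖w‖ := by
    have hc : ∀ i, |w i| ≤ 1 + ‖w‖ := fun i => by
      have := norm_le_pi_norm w i
      rw [Real.norm_eq_abs] at this; linarith
    unfold stNum; split_ifs
    · exact hc _
    · rw [abs_neg]; exact hc _
  rw [abs_div, abs_mul, abs_mul, Side.abs_sign, one_mul, one_div_mul_eq_div]
  have h1 := hw.1 p.1
  have h2 := hw.2
  have : η ^ 2 ≤ |stDet w p.1| * |stJump t w| := by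
    rw [sq]; exact mul_le_mul h1 h2 hη.le (abs_nonneg _)
  exact div_le_div₀ (by positivity) hnum (by positivity) this

theorem pi_norm_le_sum {ι : Type*} [Fintype ι] (w : ι → ℝ) : ‖w‖ ≤ ∑ i, |w i| := by
  refine (pi_norm_le_iff_of_nonneg (Finset.sum_nonneg fun i _ => abs_nonneg _)).2 fun i => ?_
  rw [Real.norm_eq_abs]
  exact Finset.single_le_sum (f := fun i => |w i|) (fun i _ => abs_nonneg _) (Finset.mem_univ i)

/-- A function which is `C¹` at `v` and of linear growth on a neighbourhood `S` of `v`, cut off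
outside `S`, is Lipschitz with respect to base points near `v`. -/
theorem exists_lipschitz_indicator {E : Type*} [NormedAddCommGroup E] [NormedSpace ℝ E]
    {γ : E → ℝ} {S : Set E} {v : E} (hγ : ContDiffAt ℝ 1 γ v) (hS : S ∈ 𝓝 v) {C₀ : ℝ}
    (hC₀ : 0 ≤ C₀) (hb : ∀ w ∈ S, |γ w| ≤ C₀ * (1 + ‖w‖)) :
    ∃ C, 0 ≤ C ∧ ∀ᶠ w₀ in 𝓝 v, ∀ w, |S.indicator γ w - γ w₀| ≤ C * ‖w - w₀‖ := by
  obtain ⟨L, T, hT, hLip⟩ := hγ.exists_lipschitzOnWith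
  obtain ⟨r, hr, hball⟩ := Metric.mem_nhds_iff.1 (inter_mem hT hS)
  set ρ := r / 2
  have hρ : 0 < ρ := by positivity
  set m := ‖v‖ + ρ
  -- Within distance `ρ` of `w₀` both points lie in the ball where `γ` is `L`-Lipschitz. Farther
  -- away the linear growth bound is itself at most a multiple of `‖w - w₀‖`, constants being
  -- absorbed by `‖w - w₀‖ ≥ ρ`.
  refine ⟨max L (C₀ * (1 + (2 + 2 * m) / ρ)), le_max_of_le_left L.2, ?_⟩
  filter_upwards [Metric.ball_mem_nhds v hρ] with w₀ hw₀ w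
  have hw₀' : w₀ ∈ T ∩ S := hball (Metric.ball_subset_ball (by simp only [ρ]; linarith) hw₀)
  rcases lt_or_ge ‖w - w₀‖ ρ with hlt | hge
  · have hw : w ∈ T ∩ S := by
      apply hball
      rw [Metric.mem_ball] at hw₀ ⊢
      calc dist w v ≤ dist w w₀ + dist w₀ v := dist_triangle _ _ _
        _ < ρ + ρ := by rw [dist_eq_norm]; gcongr
        _ = r := by simp [ρ]
    rw [Set.indicator_of_mem hw.2]
    have := hLip.dist_le_mul w hw.1 w₀ hw₀'.1
    rw [Real.dist_eq, dist_eq_norm] at this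
    refine this.trans ?_
    gcongr
    exact le_max_left _ _
  · have h1 : |S.indicator γ w| ≤ C₀ * (1 + ‖w‖) := by
      by_cases hw : w ∈ S
      · rw [Set.indicator_of_mem hw]; exact hb w hw
      · rw [Set.indicator_of_notMem hw, abs_zero]; positivity
    have h2 := hb w₀ hw₀'.2
    have h3 : ‖w₀‖ ≤ m := by
      have := norm_le_norm_add_norm_sub' w₀ v
      rw [Metric.mem_ball, dist_eq_norm] at hw₀
      simp only [m]; linarith
    have h4 : ‖w‖ ≤ ‖w - w₀‖ + m := by
      have := norm_le_norm_add_norm_sub' w w₀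
      linarith
    have h5 : 2 + 2 * m ≤ (2 + 2 * m) / ρ * ‖w - w₀‖ := by
      rw [div_mul_eq_mul_div, le_div_iff₀ hρ]
      have : 0 ≤ 2 + 2 * m := by positivity
      gcongr
    calc |S.indicator γ w - γ w₀| ≤ |S.indicator γ w| + |γ w₀| := abs_sub _ _
      _ ≤ C₀ * (1 + ‖w‖) + C₀ * (1 + ‖w₀‖) := add_le_add h1 h2
      _ = C₀ * (2 + ‖w‖ + ‖w₀‖) := by ring
      _ ≤ C₀ * ((1 + (2 + 2 * m) / ρ) * ‖w - w₀‖) := by gcongr; linarith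
      _ = C₀ * (1 + (2 + 2 * m) / ρ) * ‖w - w₀‖ := by ring
      _ ≤ _ := by gcongr; exact le_max_right _ _

/-- One constant serves all base points near `v`, so the base point can be the moving vector of
means while `v` is its limit. The bound holds for every `w`, including degenerate values. -/
theorem exists_lipschitz_stCoef {η t : ℝ} (hη : 0 < η) {v : Side × Fin 5 → ℝ}
    (hv : ∀ j, η < |stDet v j|) (hJ : η < |stJump t v|) :
    ∃ C, 0 ≤ C ∧ ∀ᶠ w₀ in 𝓝 v, ∀ p w,
      |(stGood η t).indicator (stCoef t p) w - stCoef t p w₀| ≤ C * ∑ i, |w i - w₀ i| := by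
  have hne : ∀ j, stDet v j ≠ 0 := fun j h => by
    have := hv j; rw [h, abs_zero] at this; exact absurd this (not_lt.2 hη.le)
  have hJne : stJump t v ≠ 0 := fun h => by
    rw [h, abs_zero] at hJ; exact absurd hJ (not_lt.2 hη.le)
  choose C hC hev using fun p => exists_lipschitz_indicator (contDiffAt_stCoef t p hne hJne)
    (stGood_mem_nhds hη hv hJ) (show (0 : ℝ) ≤ 1 / η ^ 2 by positivity)
    (fun w hw => abs_stCoef_le hη p hw)
  refine ⟨∑ p, C p, Finset.sum_nonneg fun p _ => hC p, ?_⟩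
  filter_upwards [eventually_all.2 hev] with w₀ h p w
  refine (h p w).trans ?_
  have h1 : C p ≤ ∑ p, C p := Finset.single_le_sum (fun p _ => hC p) (Finset.mem_univ p)
  have h2 := pi_norm_le_sum (w - w₀)
  simp only [Pi.sub_apply] at h2
  exact mul_le_mul h1 h2 (norm_nonneg _) (Finset.sum_nonneg fun p _ => hC p)

theorem exists_dist_of_notMem_nhds {ι : Type*} [Fintype ι] {S : Set (ι → ℝ)} {v : ι → ℝ}
    (hS : S ∈ 𝓝 v) :
    ∃ ρ > 0, ∀ᶠ w₀ in 𝓝 v, ∀ w, w ∉ S → ∃ i, ρ ≤ |w i - w₀ i| := by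
  obtain ⟨r, hr, hball⟩ := Metric.mem_nhds_iff.1 hS
  refine ⟨r / 2, by positivity, ?_⟩
  filter_upwards [Metric.ball_mem_nhds v (half_pos hr)] with w₀ hw₀ w hw
  by_contra! hcon
  refine hw (hball ?_)
  have : ‖w - w₀‖ < r / 2 := by
    rw [pi_norm_lt_iff (by positivity)]
    exact fun i => by simpa using hcon i
  rw [Metric.mem_ball] at hw₀ ⊢
  calc dist w v ≤ dist w w₀ + dist w₀ v := dist_triangle _ _ _
    _ < r / 2 + r / 2 := by rw [dist_eq_norm]; gcongr
    _ = r := by ring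

/-- Contribution of one observation to a weighted sum. -/
noncomputable def cell (K : ℝ → ℝ) (c : ℝ) (j : Side) (h : ℝ) (n k : ℕ)
    (g : ℝ × ℝ × ℝ → ℝ) (z : ℝ × ℝ × ℝ) : ℝ :=
  (n * h)⁻¹ * (wt K c j h k z.1 * g z)

theorem localMoment_eq_rowSum {Ω : Type*} (K : ℝ → ℝ) (c : ℝ) (j : Side) (h : ℝ) (n k : ℕ)
    (g : ℝ × ℝ × ℝ → ℝ) (ξ : ℕ → Ω → ℝ × ℝ × ℝ) (ω : Ω) :
    localMoment K c j h n k (fun i => (ξ i ω).1) (fun i => g (ξ i ω))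
      = rowSum ξ n (cell K c j h n k g) ω := by
  simp only [localMoment, rowSum, cell, Finset.mul_sum]
  rfl

theorem localMoment_affine (K : ℝ → ℝ) (c : ℝ) (j : Side) {h : ℝ} (hh : h ≠ 0) (n k : ℕ)
    {x z e : ℕ → ℝ} {a b : ℝ} (hz : ∀ i, e i = z i - a - b * (x i - c)) :
    localMoment K c j h n k x z = a * localMoment K c j h n k x 1
      + b * h * localMoment K c j h n (k + 1) x 1 + localMoment K c j h n k x e := by
  simp only [localMoment, Finset.mul_sum]
  rw [← Finset.sum_add_distrib, ← Finset.sum_add_distrib]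
  refine Finset.sum_congr rfl fun i _ => ?_
  rw [hz]
  by_cases hx : x i ∈ j.half c
  · simp only [Set.indicator_of_mem hx, Pi.one_apply]
    have hu : x i - c = h * ((x i - c) / h) := by field_simp
    set u := (x i - c) / h
    rw [hu]
    ring
  · simp [Set.indicator_of_notMem hx]

/-- Local linear regression reproduces affine functions. -/
theorem localLinear_affine (K : ℝ → ℝ) (c : ℝ) (j : Side) {h : ℝ} (hh : h ≠ 0) (n : ℕ)
    {x z e : ℕ → ℝ} {a b : ℝ} (hz : ∀ i, e i = z i - a - b * (x i - c))
    (hdet : localDet K c j h n x ≠ 0) :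
    localLinear K c j h n x z = a + localLinear K c j h n x e := by
  unfold localLinear
  rw [localMoment_affine K c j hh n 0 hz, localMoment_affine K c j hh n 1 hz, div_eq_iff hdet,
    add_mul, div_mul_cancel₀ _ hdet]
  unfold localDet
  ring

/-- Linearity in the response: the numerator of the error is the jump estimate for the single
variable `Y - τ D`. -/
theorem localLinear_combination (K : ℝ → ℝ) (c : ℝ) (j : Side) (h : ℝ) (n : ℕ)
    (x y d : ℕ → ℝ) (τ : ℝ) :
    localLinear K c j h n x y - τ * localLinear K c j h n x d
      = localLinear K c j h n x fun i => y i - τ * d i := by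
  have hm : ∀ k, localMoment K c j h n k x (fun i => y i - τ * d i)
      = localMoment K c j h n k x y - τ * localMoment K c j h n k x d := by
    intro k
    simp only [localMoment, Finset.mul_sum]
    rw [← Finset.sum_sub_distrib]
    exact Finset.sum_congr rfl fun i _ => by ring
  unfold localLinear
  rw [hm, hm]
  ring

end Statistic

/-! ### First order expansions -/

section Expansion

variable {s t : ℝ → ℝ} {a a' b b' : ℝ}

theorem tendsto_id_nhdsGT_zero : Tendsto (fun h : ℝ => h) (𝓝[>] 0) (𝓝 0) :=
  tendsto_id.mono_left nhdsWithin_le_nhds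

theorem HasExpansion.tendsto (hs : HasExpansion s a a') : Tendsto s (𝓝[>] 0) (𝓝 a) := by
  have h1 := hs.trans_tendsto tendsto_id_nhdsGT_zero
  have h2 := h1.add ((tendsto_id_nhdsGT_zero.const_mul a').const_add a)
  simpa using h2

theorem HasExpansion.sub (hs : HasExpansion s a a') (ht : HasExpansion t b b') :
    HasExpansion (fun h => s h - t h) (a - b) (a' - b') :=
  (IsLittleO.sub hs ht).congr_left fun h => by ring

theorem HasExpansion.mul (hs : HasExpansion s a a') (ht : HasExpansion t b b') :
    HasExpansion (fun h => s h * t h) (a * b) (a * b' + a' * b) := by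
  have h1 := hs.mul_isBigO (ht.tendsto.isBigO_one ℝ)
  have hl : Tendsto (fun h : ℝ => a + a' * h) (𝓝[>] 0) (𝓝 (a + a' * 0)) :=
    (tendsto_id_nhdsGT_zero.const_mul a').const_add a
  have h2 := (hl.isBigO_one ℝ).mul_isLittleO ht
  have h3 : (fun h : ℝ => (a' * b' * h) * h) =o[𝓝[>] 0] fun h => 1 * h := by
    refine IsLittleO.mul_isBigO ?_ (isBigO_refl _ _)
    rw [isLittleO_one_iff]
    simpa using tendsto_id_nhdsGT_zero.const_mul (a' * b')
  simp only [mul_one, one_mul] at h1 h2 h3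
  exact ((h1.add h2).add h3).congr_left fun h => by ring

/-- Let `l` be the candidate linear function. By the product rule `l t` has the same expansion as
`s`, so `s - l t = o(h)`, and division by `t`, bounded away from zero, keeps this order. -/
theorem HasExpansion.div (hs : HasExpansion s a a') (ht : HasExpansion t b b') (hb : b ≠ 0) :
    HasExpansion (fun h => s h / t h) (a / b) ((a' * b - a * b') / b ^ 2) := by
  have hl : HasExpansion (fun h => a / b + (a' * b - a * b') / b ^ 2 * h) (a / b)
      ((a' * b - a * b') / b ^ 2) := by
    unfold HasExpansion; simp
  have h1 := IsLittleO.sub hs (hl.mul ht)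
  have h2 : (fun h => (t h)⁻¹) =O[𝓝[>] 0] fun _ => (1 : ℝ) :=
    (ht.tendsto.inv₀ hb).isBigO_one ℝ
  have h3 := h1.mul_isBigO h2
  refine h3.congr' ?_ (Eventually.of_forall fun h => by simp)
  filter_upwards [ht.tendsto.eventually_ne hb] with h hh
  field_simp
  ring

/-- Expansion of the population local linear fit of `p u² + q u³`-type deviations. -/
theorem localLinear_expansion {K : ℝ → ℝ} (hK : kdet K ≠ 0) {f0 f1 p q σ : ℝ} (hf : f0 ≠ 0)
    (hσ : σ ^ 2 = 1) {s : Fin 3 → ℝ → ℝ} {r : Fin 2 → ℝ → ℝ}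
    (hs : ∀ k : Fin 3, HasExpansion (s k) (σ ^ (k : ℕ) * (f0 * kmom K k))
      (σ ^ (k : ℕ) * (σ * f1 * kmom K (k + 1))))
    (hr : ∀ k : Fin 2, HasExpansion (r k) (σ ^ (k : ℕ) * (p * f0 * kmom K (k + 2)))
      (σ ^ (k : ℕ) * (σ * (p * f1 + q * f0) * kmom K (k + 3)))) :
    HasExpansion (fun h => (s 2 h * r 0 h - s 1 h * r 1 h) / (s 0 h * s 2 h - s 1 h * s 1 h))
      (C1 K * (2 * p))
      (σ * (xi1 K * (p * (f1 / f0) + q) - xi2 K * (p * (f1 / f0)))) := by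
  have hdet : (σ ^ ((0 : Fin 3) : ℕ) * (f0 * kmom K ((0 : Fin 3) : ℕ)))
        * (σ ^ ((2 : Fin 3) : ℕ) * (f0 * kmom K ((2 : Fin 3) : ℕ)))
      - (σ ^ ((1 : Fin 3) : ℕ) * (f0 * kmom K ((1 : Fin 3) : ℕ)))
        * (σ ^ ((1 : Fin 3) : ℕ) * (f0 * kmom K ((1 : Fin 3) : ℕ))) = f0 ^ 2 * kdet K := by
    have : ∀ k, kmu K k = kmom K k := fun _ => rfl
    simp only [kdet, this, Fin.val_zero, Fin.val_one, Fin.val_two]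
    linear_combination (f0 ^ 2 * kmom K 0 * kmom K 2 - f0 ^ 2 * kmom K 1 ^ 2) * hσ
  have hne : f0 ^ 2 * kdet K ≠ 0 := mul_ne_zero (pow_ne_zero 2 hf) hK
  have h := (((hs 2).mul (hr 0)).sub ((hs 1).mul (hr 1))).div
    (((hs 0).mul (hs 2)).sub ((hs 1).mul (hs 1))) (by rw [hdet]; exact hne)
  rw [hdet] at h
  have hm : ∀ k, kmu K k = kmom K k := fun _ => rfl
  clear hdet
  have hcase : σ = 1 ∨ σ = -1 := mul_self_eq_one_iff.1 (by rw [← sq]; exact hσ)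
  convert h using 1
  · simp only [C1, hm, Fin.val_zero, Fin.val_one, Fin.val_two]
    generalize kdet K = Δ at hK hne
    rcases hcase with rfl | rfl <;> field_simp
  · simp only [xi1, xi2, hm, Fin.val_zero, Fin.val_one, Fin.val_two]
    generalize kdet K = Δ at hK hne
    rcases hcase with rfl | rfl <;> field_simp <;> ring

end Expansion

/-! ### Assembly of bias and variance -/

section Assembly

/-- Bookkeeping of the error terms of a mean squared error. -/
theorem exists_mse_remainders {hp hm q β e v V B r₁ m : ℕ → ℝ} {τ C : ℝ} (hτ : τ ≠ 0)
    (hp0 : ∀ n, 0 < hp n) (hm0 : ∀ n, 0 < hm n) (hpt : Tendsto hp atTop (𝓝 0))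
    (hmt : Tendsto hm atTop (𝓝 0)) (hq0 : ∀ᶠ n in atTop, 0 < q n) (hqt : Tendsto q atTop (𝓝 0))
    (hB : Tendsto B atTop (𝓝 0))
    (hr₁ : r₁ =o[atTop] fun n => hp n ^ 3 + hm n ^ 3)
    (hβ : ∀ᶠ n in atTop, τ * β n = B n + r₁ n)
    (he : ∀ᶠ n in atTop, |e n| ≤ C * ((hp n + hm n) ^ 4 + q n))
    (hv : (fun n => v n - V n) =o[atTop] q)
    (hmse : ∀ᶠ n in atTop, m n = (β n + e n) ^ 2 + v n) :
    ∃ r s : ℕ → ℝ, r =o[atTop] (fun n => hp n ^ 3 + hm n ^ 3) ∧ s =o[atTop] q ∧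
      ∀ᶠ n in atTop, m n = 1 / τ ^ 2 * (B n + r n) ^ 2 + V n + s n := by
  set H := fun n => hp n + hm n with hH
  have hH0 : ∀ n, 0 < H n := fun n => add_pos (hp0 n) (hm0 n)
  have hHt : Tendsto H atTop (𝓝 0) := by simpa using hpt.add hmt
  -- The error of the mean is divided in proportion to `H⁴` and `q`. The share `e1 = O(H⁴)` can stay
  -- inside the square, while `e2 = O(q)` need not be `o(h₊³ + h₋³)` and must leave it.
  set e1 := fun n => e n * (H n ^ 4 / (H n ^ 4 + q n)) with he1
  set e2 := fun n => e n * (q n / (H n ^ 4 + q n)) with he2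
  have hsum : ∀ᶠ n in atTop, e n = e1 n + e2 n := by
    filter_upwards [hq0] with n hn
    have : H n ^ 4 + q n ≠ 0 := (add_pos (pow_pos (hH0 n) 4) hn).ne'
    simp only [he1, he2]; field_simp
  have hO : ∀ {x : ℕ → ℝ}, (∀ᶠ n in atTop, 0 < x n) →
      (∀ᶠ n in atTop, x n ≤ H n ^ 4 + q n) →
      (fun n => e n * (x n / (H n ^ 4 + q n))) =O[atTop] x := by
    intro x hx _
    refine IsBigO.of_bound C ?_
    filter_upwards [hq0, hx, he] with n hn hxn hen
    have hpos : 0 < H n ^ 4 + q n := add_pos (pow_pos (hH0 n) 4) hn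
    rw [norm_mul, Real.norm_eq_abs, Real.norm_of_nonneg (by positivity),
      Real.norm_of_nonneg hxn.le]
    calc |e n| * (x n / (H n ^ 4 + q n)) ≤ C * (H n ^ 4 + q n) * (x n / (H n ^ 4 + q n)) := by
          gcongr
      _ = C * x n := by field_simp
  have hO1 : e1 =O[atTop] fun n => H n ^ 4 := hO (Eventually.of_forall fun n => pow_pos (hH0 n) 4)
    (by filter_upwards [hq0] with n hn; linarith)
  have hO2 : e2 =O[atTop] q := hO hq0
    (Eventually.of_forall fun n => by linarith [pow_pos (hH0 n) 4])
  have hH4 : (fun n => H n ^ 4) =o[atTop] fun n => hp n ^ 3 + hm n ^ 3 := by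
    have h1 : (fun n => H n ^ 3) =O[atTop] fun n => hp n ^ 3 + hm n ^ 3 := by
      refine IsBigO.of_bound 4 (Eventually.of_forall fun n => ?_)
      have a0 := hp0 n
      have b0 := hm0 n
      rw [Real.norm_of_nonneg (pow_nonneg (hH0 n).le 3), Real.norm_of_nonneg (by positivity)]
      simp only [hH]
      nlinarith [mul_nonneg (add_pos a0 b0).le (sq_nonneg (hp n - hm n))]
    have h2 : H =o[atTop] fun _ => (1 : ℝ) := by rw [isLittleO_one_iff]; exact hHt
    exact (h2.mul_isBigO h1).congr (fun n => by ring) fun n => by ring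
  have hG : Tendsto (fun n => hp n ^ 3 + hm n ^ 3) atTop (𝓝 0) := by
    simpa using (hpt.pow 3).add (hmt.pow 3)
  set r := fun n => r₁ n + τ * e1 n with hr
  have hro : r =o[atTop] fun n => hp n ^ 3 + hm n ^ 3 :=
    hr₁.add ((hO1.trans_isLittleO hH4).const_mul_left τ)
  have hr0 : Tendsto r atTop (𝓝 0) := hro.trans_tendsto hG
  refine ⟨r, fun n => m n - (1 / τ ^ 2 * (B n + r n) ^ 2 + V n), hro, ?_,
    Eventually.of_forall fun n => by ring⟩
  -- With `β + e1 = (B + r) / τ`, expanding the square leaves `(2 / τ (B + r) + e2) e2`: a factor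
  -- tending to zero times `O(q)`.
  have hBr : (fun n => 2 / τ * (B n + r n) + e2 n) =o[atTop] fun _ => (1 : ℝ) := by
    rw [isLittleO_one_iff]
    simpa using ((hB.add hr0).const_mul (2 / τ)).add (hO2.trans_tendsto hqt)
  have hs := ((hBr.mul_isBigO hO2).congr_right fun n => one_mul _).add hv
  refine hs.congr' ?_ (EventuallyEq.refl _ _)
  filter_upwards [hsum, hβ, hmse] with n h1 h2 h3
  have h4 : β n = (B n + r₁ n) / τ := by rw [eq_div_iff hτ, mul_comm]; exact h2
  rw [h3, h4, h1]
  simp only [hr]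
  field_simp
  ring

end Assembly

/-! ### The fuzzy regression discontinuity setting -/

section Model

set_option linter.unusedSectionVars false

/-- An observation, with the assignment variable first. -/
def obs {Ω : Type*} (Y D X : ℕ → Ω → ℝ) (i : ℕ) (ω : Ω) : ℝ × ℝ × ℝ := (X i ω, Y i ω, D i ω)

/-- Deviation of `Y - τ D` from its linear approximation at `c`, on side `j`. -/
noncomputable def residZ (b : Side → BoundaryValues) (sl : Side → ℝ) (c : ℝ) (j : Side) :
    ℝ × ℝ × ℝ → ℝ :=
  resid 1 (-tau b) (1 * (b j).mY + -tau b * (b j).mD) (sl j) c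

/-- Deviation of `D` from its linear approximation at `c`, on side `j`. -/
def residD (b : Side → BoundaryValues) (sl : Side → ℝ) (c : ℝ) (j : Side) :
    ℝ × ℝ × ℝ → ℝ :=
  resid 0 1 (0 * (b j).mY + 1 * (b j).mD) (sl j) c

/-- Power of `u` in the coordinates of the vector of weighted sums. -/
def wIdx : Fin 5 → ℕ := ![0, 1, 2, 0, 1]

/-- Variable averaged in the coordinates of the vector of weighted sums. -/
def wVar (b : Side → BoundaryValues) (sd : Side → ℝ) (c : ℝ) (i : Side × Fin 5) :
    ℝ × ℝ × ℝ → ℝ :=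
  if (i.2 : ℕ) < 3 then fun _ => 1 else residD b sd c i.1

/-- Summands of the weighted sums of the design and of the treatment status. -/
noncomputable def wFun (K : ℝ → ℝ) (h : Side → ℕ → ℝ) (c : ℝ) (b : Side → BoundaryValues)
    (sd : Side → ℝ) (n : ℕ) (i : Side × Fin 5) : ℝ × ℝ × ℝ → ℝ :=
  cell K c i.1 (h i.1 n) n (wIdx i.2) (wVar b sd c i)

/-- Summands of the weighted sums of the residuals. -/
noncomputable def rFun (K : ℝ → ℝ) (h : Side → ℕ → ℝ) (c : ℝ) (b : Side → BoundaryValues)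
    (sl : Side → ℝ) (n : ℕ) (p : Side × Fin 2) : ℝ × ℝ × ℝ → ℝ :=
  cell K c p.1 (h p.1 n) n p.2 (residZ b sl c p.1)

/-- The one-sided linear approximation at `c` of the conditional mean of `α Y + β D`, with slope
`b1`, has an error of second order with the stated coefficients. -/
def IsSlope (c : ℝ) (j : Side) (mY mD : ℝ → ℝ) (b : BoundaryValues) (α β b1 : ℝ) : Prop :=
  (fun x => α * mY x + β * mD x - (α * b.mY + β * b.mD) - b1 * (x - c)
      - ((α * b.mY2 + β * b.mD2) / 2 + (α * b.mY3 + β * b.mD3) / 6 * (x - c)) * (x - c) ^ 2)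
    =o[j.toC c] fun x => (x - c) ^ 3

/-- The assumptions on the sample, the kernel, the bandwidths and the population. -/
structure Setting {Ω : Type*} [MeasurableSpace Ω] (P : Measure Ω) [IsProbabilityMeasure P]
    (Y D X : ℕ → Ω → ℝ) (K : ℝ → ℝ) (h : Side → ℕ → ℝ) (c : ℝ) (f : ℝ → ℝ) (δ : ℝ)
    (mY mD sY sD sYD : ℝ → ℝ) (b : Side → BoundaryValues) (η A B : ℝ) (sl sd : Side → ℝ) :
    Prop where
  iid : IsIID (obs Y D X) P
  side : ∀ j, SideModel P (Y 0) (D 0) (X 0) f c δ j mY mD sY sD sYD (b j)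
  weight : IsWeight K A B
  kdet_ne : kdet K ≠ 0
  f_pos : 0 < f c
  h_pos : ∀ j n, 0 < h j n
  h_zero : ∀ j, Tendsto (h j) atTop (𝓝 0)
  h_inf : ∀ j, Tendsto (fun n : ℕ => (n : ℝ) * h j n) atTop atTop
  tauD_ne : tauD b ≠ 0
  η_pos : 0 < η
  η_lt_tauD : η < |tauD b|
  η_lt_det : η < f c ^ 2 * |kdet K|
  slopeZ : ∀ j, IsSlope c j mY mD (b j) 1 (-tau b) (sl j)
  slopeD : ∀ j, IsSlope c j mY mD (b j) 0 1 (sd j)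

variable {Ω : Type*} [MeasurableSpace Ω] {P : Measure Ω} [IsProbabilityMeasure P]
  {Y D X : ℕ → Ω → ℝ} {K : ℝ → ℝ} {h : Side → ℕ → ℝ} {c : ℝ} {f : ℝ → ℝ} {δ : ℝ}
  {mY mD sY sD sYD : ℝ → ℝ} {b : Side → BoundaryValues} {η A B : ℝ} {sl sd : Side → ℝ}

/-- The rate `1 / (n h₊) + 1 / (n h₋)`. -/
noncomputable def rate (h : Side → ℕ → ℝ) (n : ℕ) : ℝ :=
  1 / ((n : ℝ) * h .pos n) + 1 / ((n : ℝ) * h .neg n)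

theorem Setting.tendsto_h (S : Setting P Y D X K h c f δ mY mD sY sD sYD b η A B sl sd)
    (j : Side) : Tendsto (h j) atTop (𝓝[>] 0) :=
  tendsto_nhdsWithin_iff.2 ⟨S.h_zero j, Eventually.of_forall fun n => S.h_pos j n⟩

theorem Setting.rate_nonneg (S : Setting P Y D X K h c f δ mY mD sY sD sYD b η A B sl sd)
    (n : ℕ) : 0 ≤ rate h n := by
  have h1 := S.h_pos .pos n
  have h2 := S.h_pos .neg n
  unfold rate; positivity

theorem Setting.inv_le_rate (S : Setting P Y D X K h c f δ mY mD sY sD sYD b η A B sl sd)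
    (n : ℕ) (j : Side) : ((n : ℝ) * h j n)⁻¹ ≤ rate h n := by
  have h1 := S.h_pos .pos n
  have h2 := S.h_pos .neg n
  have h3 : 0 ≤ 1 / ((n : ℝ) * h .pos n) := by positivity
  have h4 : 0 ≤ 1 / ((n : ℝ) * h .neg n) := by positivity
  rw [← one_div]
  unfold rate
  cases j <;> linarith

theorem Setting.tendsto_rate (S : Setting P Y D X K h c f δ mY mD sY sD sYD b η A B sl sd) :
    Tendsto (rate h) atTop (𝓝 0) := by
  have h1 := (S.h_inf .pos).inv_tendsto_atTop
  have h2 := (S.h_inf .neg).inv_tendsto_atTop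
  have h3 := h1.add h2
  rw [add_zero] at h3
  refine h3.congr fun n => ?_
  simp [rate]

/-! ### Means, second moments and bounds of the summands. -/

theorem measurable_cell (hκ : IsWeight K A B) (j : Side) (t : ℝ) (n k : ℕ)
    {g : ℝ × ℝ × ℝ → ℝ} (hg : Measurable g) : Measurable (cell K c j t n k g) :=
  (((hκ.measurable_wt c t j k).comp measurable_fst).mul hg).const_mul _

theorem measurable_residZ (j : Side) : Measurable (residZ b sl c j) := measurable_resid _ _ _ _ _

theorem measurable_residD (j : Side) : Measurable (residD b sd c j) := measurable_resid _ _ _ _ _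

theorem measurable_wVar (i : Side × Fin 5) : Measurable (wVar b sd c i) := by
  unfold wVar; split_ifs
  · exact measurable_const
  · exact measurable_residD _

theorem Setting.measurable_wFun (S : Setting P Y D X K h c f δ mY mD sY sD sYD b η A B sl sd)
    (n : ℕ) (i : Side × Fin 5) : Measurable (wFun K h c b sd n i) :=
  measurable_cell S.weight _ _ _ _ (measurable_wVar i)

theorem Setting.measurable_rFun (S : Setting P Y D X K h c f δ mY mD sY sD sYD b η A B sl sd)
    (n : ℕ) (p : Side × Fin 2) : Measurable (rFun K h c b sl n p) :=
  measurable_cell S.weight _ _ _ _ (measurable_residZ _)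

theorem cell_mean (j : Side) (t : ℝ) {n : ℕ} (hn : n ≠ 0) (k : ℕ) (g : ℝ × ℝ × ℝ → ℝ) :
    n * ∫ ω, cell K c j t n k g (obs Y D X 0 ω) ∂P
      = t⁻¹ * ∫ ω, wt K c j t k (X 0 ω) * g (X 0 ω, Y 0 ω, D 0 ω) ∂P := by
  simp only [cell, obs]
  rw [integral_const_mul, mul_inv, ← mul_assoc, ← mul_assoc,
    mul_inv_cancel₀ (Nat.cast_ne_zero.2 hn), one_mul]

theorem cell_sq (j : Side) {t : ℝ} (ht : t ≠ 0) {n : ℕ} (hn : n ≠ 0) (k : ℕ)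
    (g : ℝ × ℝ × ℝ → ℝ) :
    n * ∫ ω, cell K c j t n k g (obs Y D X 0 ω) ^ 2 ∂P
      = (n * t)⁻¹ * (t⁻¹ * ∫ ω, wt (fun u => K u ^ 2) c j t (k + k) (X 0 ω)
        * g (X 0 ω, Y 0 ω, D 0 ω) ^ 2 ∂P) := by
  simp only [cell, obs]
  have : ∀ ω, ((n * t)⁻¹ * (wt K c j t k (X 0 ω) * g (X 0 ω, Y 0 ω, D 0 ω))) ^ 2
      = (n * t)⁻¹ ^ 2 * (wt (fun u => K u ^ 2) c j t (k + k) (X 0 ω)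
        * g (X 0 ω, Y 0 ω, D 0 ω) ^ 2) := by
    intro ω; rw [← wt_mul_wt]; ring
  simp_rw [this]
  rw [integral_const_mul]
  have hn' : (n : ℝ) ≠ 0 := Nat.cast_ne_zero.2 hn
  field_simp

theorem exists_uniform_const {ι : Type*} [Fintype ι] {p : ι → ℝ → ℕ → Prop}
    (mono : ∀ i C C' n, C ≤ C' → p i C n → p i C' n) (hp : ∀ i, ∃ C, ∀ᶠ n in atTop, p i C n) :
    ∃ C, 0 < C ∧ ∀ᶠ n in atTop, ∀ i, p i C n := by
  choose C hC using hp
  have hnn : 0 ≤ ∑ i, |C i| := Finset.sum_nonneg fun i _ => abs_nonneg _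
  refine ⟨1 + ∑ i, |C i|, by linarith, ?_⟩
  filter_upwards [eventually_all.2 hC] with n hn i
  refine mono i _ _ n ?_ (hn i)
  have := Finset.single_le_sum (f := fun i => |C i|) (fun i _ => abs_nonneg _) (Finset.mem_univ i)
  linarith [le_abs_self (C i)]

theorem Setting.exists_cell_sq_le (S : Setting P Y D X K h c f δ mY mD sY sD sYD b η A B sl sd)
    (j : Side) (k : ℕ) {g : ℝ × ℝ × ℝ → ℝ} {L : ℝ}
    (hg : Tendsto (fun t => t⁻¹ * ∫ ω, wt (fun u => K u ^ 2) c j t (k + k) (X 0 ω)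
        * g (X 0 ω, Y 0 ω, D 0 ω) ^ 2 ∂P) (𝓝[>] 0) (𝓝 L)) :
    ∃ C, ∀ᶠ n : ℕ in atTop,
      n * ∫ ω, cell K c j (h j n) n k g (obs Y D X 0 ω) ^ 2 ∂P ≤ C * rate h n := by
  refine ⟨|L| + 1, ?_⟩
  have h1 : L < |L| + 1 := by linarith [le_abs_self L]
  filter_upwards [(hg.comp (S.tendsto_h j)).eventually_lt_const h1, eventually_ne_atTop 0]
    with n hn hn0
  rw [cell_sq j (S.h_pos j n).ne' hn0]
  simp only [Function.comp] at hn
  have h2 := S.inv_le_rate n j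
  have h3 : 0 ≤ ((n : ℝ) * h j n)⁻¹ := by have := S.h_pos j n; positivity
  have h4 : 0 ≤ |L| + 1 := by positivity
  calc ((n : ℝ) * h j n)⁻¹ * _ ≤ ((n : ℝ) * h j n)⁻¹ * (|L| + 1) := by gcongr
    _ ≤ rate h n * (|L| + 1) := by gcongr
    _ = _ := mul_comm _ _

/-- Limit of the means of the weighted sums. -/
noncomputable def wLim (K : ℝ → ℝ) (f0 : ℝ) (i : Side × Fin 5) : ℝ :=
  if (i.2 : ℕ) < 3 then i.1.sign ^ wIdx i.2 * (f0 * kmom K (wIdx i.2)) else 0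

/-- Means of the weighted sums. -/
noncomputable def wMean (P : Measure Ω) (Y D X : ℕ → Ω → ℝ) (K : ℝ → ℝ) (h : Side → ℕ → ℝ)
    (c : ℝ) (b : Side → BoundaryValues) (sd : Side → ℝ) (n : ℕ) (i : Side × Fin 5) : ℝ :=
  n * ∫ ω, wFun K h c b sd n i (obs Y D X 0 ω) ∂P

/-- Means of the weighted residual sums. -/
noncomputable def rMean (P : Measure Ω) (Y D X : ℕ → Ω → ℝ) (K : ℝ → ℝ) (h : Side → ℕ → ℝ)
    (c : ℝ) (b : Side → BoundaryValues) (sl : Side → ℝ) (n : ℕ) (p : Side × Fin 2) : ℝ :=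
  n * ∫ ω, rFun K h c b sl n p (obs Y D X 0 ω) ∂P

theorem wMean_lt_three {n : ℕ} (hn : n ≠ 0) {i : Side × Fin 5} (hi : (i.2 : ℕ) < 3) :
    wMean P Y D X K h c b sd n i
      = (h i.1 n)⁻¹ * ∫ ω, wt K c i.1 (h i.1 n) (wIdx i.2) (X 0 ω) ∂P := by
  unfold wMean wFun
  rw [cell_mean i.1 _ hn]
  simp [wVar, hi]

theorem wMean_ge_three {n : ℕ} (hn : n ≠ 0) {i : Side × Fin 5} (hi : ¬ (i.2 : ℕ) < 3) :
    wMean P Y D X K h c b sd n i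
      = (h i.1 n)⁻¹ * ∫ ω, wt K c i.1 (h i.1 n) (wIdx i.2) (X 0 ω)
        * residD b sd c i.1 (X 0 ω, Y 0 ω, D 0 ω) ∂P := by
  unfold wMean wFun
  rw [cell_mean i.1 _ hn]
  simp [wVar, hi]

/-- With the linear part of `m_D` removed the mean is `O(t²)`; the weaker `o(t)` suffices for the
denominator. -/
theorem Setting.meanD_isLittleO (S : Setting P Y D X K h c f δ mY mD sY sD sYD b η A B sl sd)
    (j : Side) (k : ℕ) :
    (fun t => t⁻¹ * ∫ ω, wt K c j t k (X 0 ω) * residD b sd c j (X 0 ω, Y 0 ω, D 0 ω) ∂P)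
      =o[𝓝[>] 0] fun t => t := by
  have h1 := ((S.side j).mean_expansion S.weight (S.slopeD j) k).tendsto.isBigO_one ℝ
  have h2 : (fun t : ℝ => t ^ 2) =o[𝓝[>] 0] fun t => t := by
    have : (fun t : ℝ => t) =o[𝓝[>] 0] fun _ => (1 : ℝ) := by
      rw [isLittleO_one_iff]; exact tendsto_id_nhdsGT_zero
    exact (this.mul_isBigO (isBigO_refl (fun t : ℝ => t) _)).congr (fun t => by ring)
      fun t => by ring
  have h3 := h1.mul_isLittleO h2
  simp only [one_mul] at h3
  refine h3.congr' ?_ (EventuallyEq.refl _ _)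
  filter_upwards [self_mem_nhdsWithin] with t ht
  have ht : t ≠ 0 := ne_of_gt ht
  unfold residD
  field_simp

theorem Setting.tendsto_wMean (S : Setting P Y D X K h c f δ mY mD sY sD sYD b η A B sl sd) :
    Tendsto (wMean P Y D X K h c b sd) atTop (𝓝 (wLim K (f c))) := by
  rw [tendsto_pi_nhds]
  intro i
  by_cases hi : (i.2 : ℕ) < 3
  · have h1 := ((S.side i.1).design_expansion S.weight (wIdx i.2)).tendsto.comp (S.tendsto_h i.1)
    rw [wLim, if_pos hi]
    refine h1.congr' ?_
    filter_upwards [eventually_ne_atTop 0] with n hn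
    rw [wMean_lt_three hn hi]; rfl
  · have h1 := ((S.meanD_isLittleO i.1 (wIdx i.2)).trans_tendsto tendsto_id_nhdsGT_zero).comp
      (S.tendsto_h i.1)
    rw [wLim, if_neg hi]
    refine h1.congr' ?_
    filter_upwards [eventually_ne_atTop 0] with n hn
    rw [wMean_ge_three hn hi]; rfl

theorem stDet_wLim (K : ℝ → ℝ) (f0 : ℝ) (j : Side) :
    stDet (wLim K f0) j = f0 ^ 2 * kdet K := by
  have h0 : wLim K f0 (j, 0) = f0 * kmom K 0 := by simp [wLim, wIdx]
  have h1 : wLim K f0 (j, 1) = j.sign * (f0 * kmom K 1) := by simp [wLim, wIdx]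
  have h2 : wLim K f0 (j, 2) = j.sign ^ 2 * (f0 * kmom K 2) := by simp [wLim, wIdx]
  have hm : ∀ k, kmu K k = kmom K k := fun _ => rfl
  rw [stDet, h0, h1, h2, mul_pow, Side.sign_sq, kdet, hm, hm, hm]; ring

theorem stJump_wLim (K : ℝ → ℝ) (f0 t : ℝ) : stJump t (wLim K f0) = t := by
  have h3 : ∀ j, wLim K f0 (j, 3) = 0 := fun j => by simp [wLim]
  have h4 : ∀ j, wLim K f0 (j, 4) = 0 := fun j => by simp [wLim]
  simp [stJump, h3, h4]

theorem Setting.lt_stDet (S : Setting P Y D X K h c f δ mY mD sY sD sYD b η A B sl sd)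
    (j : Side) : η < |stDet (wLim K (f c)) j| := by
  rw [stDet_wLim, abs_mul, abs_of_nonneg (sq_nonneg _)]; exact S.η_lt_det

theorem Setting.lt_stJump (S : Setting P Y D X K h c f δ mY mD sY sD sYD b η A B sl sd) :
    η < |stJump (tauD b) (wLim K (f c))| := by
  rw [stJump_wLim]; exact S.η_lt_tauD

theorem abs_residD_le {z : ℝ × ℝ × ℝ} (hz : |z.2.2| ≤ 1) (j : Side) {ρ : ℝ}
    (hρ : |z.1 - c| ≤ ρ) :
    |residD b sd c j z| ≤ 1 + |(b j).mD| + |sd j| * ρ := by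
  have h1 : residD b sd c j z = z.2.2 - (b j).mD - sd j * (z.1 - c) := by
    simp only [residD, resid]; ring
  rw [h1]
  calc |z.2.2 - (b j).mD - sd j * (z.1 - c)|
      ≤ |z.2.2 - (b j).mD| + |sd j * (z.1 - c)| := abs_sub _ _
    _ ≤ (|z.2.2| + |(b j).mD|) + |sd j| * |z.1 - c| := by
        rw [abs_mul]; gcongr; exact abs_sub _ _
    _ ≤ _ := by gcongr

/-- Only the assignment variable and the binary treatment enter these summands. Once `h < 1`, the
support of the weight gives `|X - c| ≤ A`, which bounds the linear part of the residual. -/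
theorem Setting.exists_abs_wFun_le (S : Setting P Y D X K h c f δ mY mD sY sD sYD b η A B sl sd)
    (i : Side × Fin 5) :
    ∃ C, ∀ᶠ n : ℕ in atTop, ∀ᵐ ω ∂P, |wFun K h c b sd n i (obs Y D X 0 ω)| ≤ C * rate h n := by
  set G := 1 + |(b i.1).mD| + |sd i.1| * A with hG
  have hA0 : 0 ≤ A := zero_le_one.trans S.weight.one_le
  have hB0 := S.weight.nonneg
  have hG0 : 0 ≤ G := by positivity
  refine ⟨B * A ^ wIdx i.2 * G, ?_⟩
  filter_upwards [(S.h_zero i.1).eventually_lt_const one_pos] with n hn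
  filter_upwards [(S.side i.1).binary] with ω hω
  have hpos := S.h_pos i.1 n
  have hD1 : |D 0 ω| ≤ 1 := by rcases hω with e | e <;> simp [e]
  have hw : |wt K c i.1 (h i.1 n) (wIdx i.2) (X 0 ω) * wVar b sd c i (obs Y D X 0 ω)|
      ≤ B * A ^ wIdx i.2 * G := by
    by_cases hx : A * h i.1 n < |X 0 ω - c|
    · rw [S.weight.wt_of_lt hpos i.1 _ hx, zero_mul, abs_zero]; positivity
    · have hx' : |X 0 ω - c| ≤ A := (not_lt.1 hx).trans (by nlinarith)
      rw [abs_mul]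
      have h1 := S.weight.abs_wt_le (c := c) hpos i.1 (wIdx i.2) (X 0 ω)
      have h2 : |wVar b sd c i (obs Y D X 0 ω)| ≤ G := by
        unfold wVar; split_ifs
        · simp only [abs_one, hG]
          have : 0 ≤ |(b i.1).mD| + |sd i.1| * A := by positivity
          linarith
        · exact abs_residD_le hD1 i.1 hx'
      gcongr
  unfold wFun cell
  rw [abs_mul, abs_of_nonneg (by positivity : (0 : ℝ) ≤ ((n : ℝ) * h i.1 n)⁻¹)]
  have h2 := S.inv_le_rate n i.1
  calc ((n : ℝ) * h i.1 n)⁻¹ * _ ≤ rate h n * (B * A ^ wIdx i.2 * G) :=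
        mul_le_mul h2 hw (abs_nonneg _) (S.rate_nonneg n)
    _ = _ := mul_comm _ _

theorem Setting.exists_wFun_sq_le (S : Setting P Y D X K h c f δ mY mD sY sD sYD b η A B sl sd)
    (i : Side × Fin 5) :
    ∃ C, ∀ᶠ n : ℕ in atTop,
      n * ∫ ω, wFun K h c b sd n i (obs Y D X 0 ω) ^ 2 ∂P ≤ C * rate h n := by
  unfold wFun
  by_cases hi : (i.2 : ℕ) < 3
  · have h1 := ((S.side i.1).design_expansion S.weight.sq (wIdx i.2 + wIdx i.2)).tendsto
    refine S.exists_cell_sq_le i.1 (wIdx i.2) (g := wVar b sd c i) (h1.congr fun t => ?_)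
    simp [wVar, hi]
  · have h1 := (S.side i.1).tendsto_sq S.weight.sq 0 1 (sd i.1) (wIdx i.2 + wIdx i.2)
    refine S.exists_cell_sq_le i.1 (wIdx i.2) (g := wVar b sd c i) (h1.congr fun t => ?_)
    simp [wVar, hi, residD]

theorem Setting.wFun_bounds (S : Setting P Y D X K h c f δ mY mD sY sD sYD b η A B sl sd) :
    ∃ C, 0 < C ∧ ∀ᶠ n : ℕ in atTop, ∀ i,
      (∀ᵐ ω ∂P, |wFun K h c b sd n i (obs Y D X 0 ω)| ≤ C * rate h n) ∧
      n * ∫ ω, wFun K h c b sd n i (obs Y D X 0 ω) ^ 2 ∂P ≤ C * rate h n := by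
  refine exists_uniform_const (fun i C C' n hC hp => ?_) fun i => ?_
  · have : C * rate h n ≤ C' * rate h n := mul_le_mul_of_nonneg_right hC (S.rate_nonneg n)
    exact ⟨hp.1.mono fun ω hω => hω.trans this, hp.2.trans this⟩
  · obtain ⟨C1, h1⟩ := S.exists_abs_wFun_le i
    obtain ⟨C2, h2⟩ := S.exists_wFun_sq_le i
    refine ⟨max C1 C2, ?_⟩
    filter_upwards [h1, h2] with n h1 h2
    have hr := S.rate_nonneg n
    exact ⟨h1.mono fun ω hω => hω.trans (by gcongr; exact le_max_left _ _),
      h2.trans (by gcongr; exact le_max_right _ _)⟩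

/-- These summands contain `Y`, so only second moments are controlled, with no uniform bound. The
mean is of second order because the linear part of the conditional mean has been subtracted. -/
theorem Setting.rFun_bounds (S : Setting P Y D X K h c f δ mY mD sY sD sYD b η A B sl sd) :
    ∃ C, 0 < C ∧ ∀ᶠ n : ℕ in atTop, ∀ p,
      MemLp (fun ω => rFun K h c b sl n p (obs Y D X 0 ω)) 2 P ∧
      n * ∫ ω, rFun K h c b sl n p (obs Y D X 0 ω) ^ 2 ∂P ≤ C * rate h n ∧
      |rMean P Y D X K h c b sl n p| ≤ C * (h .pos n + h .neg n) ^ 2 := by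
  refine exists_uniform_const (fun p C C' n hC hp => ?_) fun p => ?_
  · have h1 : C * rate h n ≤ C' * rate h n := mul_le_mul_of_nonneg_right hC (S.rate_nonneg n)
    have h2 : C * (h .pos n + h .neg n) ^ 2 ≤ C' * (h .pos n + h .neg n) ^ 2 := by gcongr
    exact ⟨hp.1, hp.2.1.trans h1, hp.2.2.trans h2⟩
  · obtain ⟨C1, h1⟩ := S.exists_cell_sq_le p.1 p.2 (g := residZ b sl c p.1)
      ((S.side p.1).tendsto_sq S.weight.sq 1 (-tau b) (sl p.1) (p.2 + p.2))
    have h2 := (S.tendsto_h p.1).eventually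
      ((S.side p.1).eventually_memLp S.weight 1 (-tau b) (sl p.1) p.2)
    have h3 := ((S.side p.1).mean_expansion S.weight (S.slopeZ p.1) p.2).tendsto
    have h3' := (h3.abs.comp (S.tendsto_h p.1)).eventually_lt_const (lt_add_one _)
    set L := |p.1.sign ^ (p.2 : ℕ) * ((1 * (b p.1).mY2 + -tau b * (b p.1).mD2) / 2 * f c
      * kmom K (p.2 + 2))| + 1
    have hL : 0 ≤ L := by positivity
    refine ⟨max C1 L, ?_⟩
    filter_upwards [h1, h2, h3', eventually_ne_atTop 0] with n h1 h2 h3 hn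
    have hr := S.rate_nonneg n
    have hh := S.h_pos p.1 n
    refine ⟨h2.const_mul _, h1.trans (by gcongr; exact le_max_left _ _), ?_⟩
    unfold rMean rFun
    rw [cell_mean p.1 _ hn]
    simp only [Function.comp] at h3
    rw [abs_div, abs_of_pos (pow_pos hh 2), div_lt_iff₀ (pow_pos hh 2)] at h3
    refine h3.le.trans ?_
    have h4 : h p.1 n ≤ h .pos n + h .neg n := by
      have := S.h_pos .pos n
      have := S.h_pos .neg n
      cases p.1 <;> linarith
    have h5 : L ≤ max C1 L := le_max_right _ _
    exact mul_le_mul h5 (pow_le_pow_left₀ hh.le h4 2) (by positivity) (hL.trans h5)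

end Model

/-! ### The estimator as a function of weighted sums -/

section Link

set_option linter.unusedSectionVars false

variable {Ω : Type*} {Y D X : ℕ → Ω → ℝ} {K : ℝ → ℝ} {h : Side → ℕ → ℝ} {c : ℝ}
  {b : Side → BoundaryValues} {η : ℝ} {sl sd : Side → ℝ}

/-- The vector of weighted sums of the design and of the treatment status. -/
noncomputable def wSum (Y D X : ℕ → Ω → ℝ) (K : ℝ → ℝ) (h : Side → ℕ → ℝ) (c : ℝ)
    (b : Side → BoundaryValues) (sd : Side → ℝ) (n : ℕ) (ω : Ω) (i : Side × Fin 5) : ℝ :=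
  rowSum (obs Y D X) n (wFun K h c b sd n i) ω

/-- The weighted sums of the residuals. -/
noncomputable def rSum (Y D X : ℕ → Ω → ℝ) (K : ℝ → ℝ) (h : Side → ℕ → ℝ) (c : ℝ)
    (b : Side → BoundaryValues) (sl : Side → ℝ) (n : ℕ) (p : Side × Fin 2) (ω : Ω) : ℝ :=
  rowSum (obs Y D X) n (rFun K h c b sl n p) ω

/-- The estimation error on non-degenerate samples, extended by zero. -/
noncomputable def errSum (Y D X : ℕ → Ω → ℝ) (K : ℝ → ℝ) (h : Side → ℕ → ℝ) (c : ℝ)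
    (b : Side → BoundaryValues) (η : ℝ) (sl sd : Side → ℝ) (n : ℕ) (ω : Ω) : ℝ :=
  ∑ p, rSum Y D X K h c b sl n p ω
    * (stGood η (tauD b)).indicator (stCoef (tauD b) p) (wSum Y D X K h c b sd n ω)

theorem localMoment_one (j : Side) (t : ℝ) (n k : ℕ) (ω : Ω) :
    localMoment K c j t n k (fun i => X i ω) 1
      = rowSum (obs Y D X) n (cell K c j t n k fun _ => 1) ω :=
  localMoment_eq_rowSum K c j t n k (fun _ => 1) (obs Y D X) ω

theorem wSum_of_lt (n : ℕ) (ω : Ω) {i : Side × Fin 5} (hi : (i.2 : ℕ) < 3) :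
    wSum Y D X K h c b sd n ω i
      = localMoment K c i.1 (h i.1 n) n (wIdx i.2) (fun i => X i ω) 1 := by
  rw [localMoment_one (Y := Y) (D := D)]
  simp [wSum, wFun, wVar, hi]

theorem wSum_of_not_lt (n : ℕ) (ω : Ω) {i : Side × Fin 5} (hi : ¬ (i.2 : ℕ) < 3) :
    wSum Y D X K h c b sd n ω i
      = localMoment K c i.1 (h i.1 n) n (wIdx i.2) (fun i => X i ω)
        (fun k => residD b sd c i.1 (obs Y D X k ω)) := by
  refine Eq.trans ?_ (localMoment_eq_rowSum K c i.1 (h i.1 n) n (wIdx i.2) (residD b sd c i.1)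
    (obs Y D X) ω).symm
  simp [wSum, wFun, wVar, hi]

theorem localDet_eq_stDet (n : ℕ) (ω : Ω) (j : Side) :
    localDet K c j (h j n) n (fun i => X i ω) = stDet (wSum Y D X K h c b sd n ω) j := by
  rw [stDet, wSum_of_lt n ω (i := (j, 0)) (by simp), wSum_of_lt n ω (i := (j, 1)) (by simp),
    wSum_of_lt n ω (i := (j, 2)) (by simp)]
  rfl

theorem localLinear_treatment (hpos : ∀ j n, 0 < h j n) (n : ℕ) (ω : Ω) (j : Side)
    (hdet : stDet (wSum Y D X K h c b sd n ω) j ≠ 0) :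
    localLinear K c j (h j n) n (fun i => X i ω) (fun i => D i ω)
      = (b j).mD + (wSum Y D X K h c b sd n ω (j, 2) * wSum Y D X K h c b sd n ω (j, 3)
        - wSum Y D X K h c b sd n ω (j, 1) * wSum Y D X K h c b sd n ω (j, 4))
        / stDet (wSum Y D X K h c b sd n ω) j := by
  rw [localLinear_affine K c j (hpos j n).ne' n (a := (b j).mD) (b := sd j)
    (e := fun i => residD b sd c j (obs Y D X i ω))
    (fun i => by simp only [residD, resid, obs]; ring)
    (by rwa [localDet_eq_stDet (Y := Y) (D := D) (b := b) (sd := sd)])]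
  rw [wSum_of_lt n ω (i := (j, 1)) (by simp), wSum_of_lt n ω (i := (j, 2)) (by simp),
    wSum_of_not_lt n ω (i := (j, 3)) (by simp), wSum_of_not_lt n ω (i := (j, 4)) (by simp),
    ← localDet_eq_stDet]
  rfl

theorem localLinear_outcome (hpos : ∀ j n, 0 < h j n) (n : ℕ) (ω : Ω) (j : Side)
    (hdet : stDet (wSum Y D X K h c b sd n ω) j ≠ 0) :
    localLinear K c j (h j n) n (fun i => X i ω) (fun i => Y i ω - tau b * D i ω)
      = (b j).mY - tau b * (b j).mD
        + (wSum Y D X K h c b sd n ω (j, 2) * rSum Y D X K h c b sl n (j, 0) ω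
        - wSum Y D X K h c b sd n ω (j, 1) * rSum Y D X K h c b sl n (j, 1) ω)
        / stDet (wSum Y D X K h c b sd n ω) j := by
  rw [localLinear_affine K c j (hpos j n).ne' n (a := (b j).mY - tau b * (b j).mD) (b := sl j)
    (e := fun i => residZ b sl c j (obs Y D X i ω))
    (fun i => by simp only [residZ, resid, obs]; ring)
    (by rwa [localDet_eq_stDet (Y := Y) (D := D) (b := b) (sd := sd)])]
  rw [wSum_of_lt n ω (i := (j, 1)) (by simp), wSum_of_lt n ω (i := (j, 2)) (by simp),
    ← localDet_eq_stDet]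
  unfold localLinear rSum rFun
  rw [← localMoment_eq_rowSum, ← localMoment_eq_rowSum]
  rfl

theorem jumpHat_eq_stJump (hpos : ∀ j n, 0 < h j n) (n : ℕ) (ω : Ω)
    (hdet : ∀ j, stDet (wSum Y D X K h c b sd n ω) j ≠ 0) :
    jumpHat K c (fun j => h j n) n (fun i => X i ω) (fun i => D i ω)
      = stJump (tauD b) (wSum Y D X K h c b sd n ω) := by
  unfold jumpHat stJump
  rw [localLinear_treatment hpos n ω _ (hdet .pos), localLinear_treatment hpos n ω _ (hdet .neg),
    Side.sum_eq, tauD]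
  simp only [Side.sign]
  ring

theorem regularEvent_eq (hpos : ∀ j n, 0 < h j n) (hη : 0 < η) (n : ℕ) :
    regularEvent D X K c (fun j => h j n) n η
      = {ω | wSum Y D X K h c b sd n ω ∈ stGood η (tauD b)} := by
  ext ω
  simp only [regularEvent, stGood, Set.mem_ofPred_eq,
    localDet_eq_stDet (Y := Y) (D := D) (b := b) (sd := sd)]
  -- The formula for the estimated jump requires nonzero determinants, which the first half of the
  -- event supplies.
  refine and_congr_right fun hd => ?_
  rw [jumpHat_eq_stJump hpos n ω fun j hj => ?_]
  have := hd j
  rw [hj, abs_zero] at this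
  exact absurd this (not_le.2 hη)

theorem tauHat_sub_eq (hpos : ∀ j n, 0 < h j n) (hη : 0 < η) (hτ : tauD b ≠ 0) (n : ℕ) (ω : Ω)
    (hω : wSum Y D X K h c b sd n ω ∈ stGood η (tauD b)) :
    tauHat K c (fun j => h j n) n (fun i => X i ω) (fun i => Y i ω) (fun i => D i ω) - tau b
      = errSum Y D X K h c b η sl sd n ω := by
  have hdet : ∀ j, stDet (wSum Y D X K h c b sd n ω) j ≠ 0 := fun j hj => by
    have := hω.1 j
    rw [hj, abs_zero] at this
    exact absurd this (not_le.2 hη)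
  have hJ : stJump (tauD b) (wSum Y D X K h c b sd n ω) ≠ 0 := fun hj => by
    have := hω.2
    rw [hj, abs_zero] at this
    exact absurd this (not_le.2 hη)
  -- The definition of `τ` makes the boundary values cancel in the numerator, so the error contains
  -- residual sums only.
  have hbal : (b .pos).mY - (b .neg).mY = tau b * tauD b := by
    rw [tau, div_mul_cancel₀ _ hτ]
  have hJD := jumpHat_eq_stJump (Y := Y) hpos n ω hdet
  have hnum : jumpHat K c (fun j => h j n) n (fun i => X i ω) (fun i => Y i ω)
      - tau b * jumpHat K c (fun j => h j n) n (fun i => X i ω) (fun i => D i ω)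
      = ∑ j : Side, j.sign *
        ((wSum Y D X K h c b sd n ω (j, 2) * rSum Y D X K h c b sl n (j, 0) ω
        - wSum Y D X K h c b sd n ω (j, 1) * rSum Y D X K h c b sl n (j, 1) ω)
        / stDet (wSum Y D X K h c b sd n ω) j) := by
    have e : jumpHat K c (fun j => h j n) n (fun i => X i ω) (fun i => Y i ω)
        - tau b * jumpHat K c (fun j => h j n) n (fun i => X i ω) (fun i => D i ω)
        = localLinear K c .pos (h .pos n) n (fun i => X i ω) (fun i => Y i ω - tau b * D i ω)
          - localLinear K c .neg (h .neg n) n (fun i => X i ω)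
            (fun i => Y i ω - tau b * D i ω) := by
      rw [← localLinear_combination, ← localLinear_combination]
      unfold jumpHat; ring
    rw [e, localLinear_outcome (sl := sl) hpos n ω _ (hdet .pos),
      localLinear_outcome (sl := sl) hpos n ω _ (hdet .neg), Side.sum_eq]
    simp only [Side.sign]
    rw [tauD] at hbal
    linear_combination hbal
  have hJ' : jumpHat K c (fun j => h j n) n (fun i => X i ω) (fun i => D i ω) ≠ 0 := by
    rwa [hJD]
  have e2 : tauHat K c (fun j => h j n) n (fun i => X i ω) (fun i => Y i ω) (fun i => D i ω)
      - tau b = (jumpHat K c (fun j => h j n) n (fun i => X i ω) (fun i => Y i ω)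
      - tau b * jumpHat K c (fun j => h j n) n (fun i => X i ω) (fun i => D i ω))
      / jumpHat K c (fun j => h j n) n (fun i => X i ω) (fun i => D i ω) := by
    unfold tauHat
    rw [sub_div, mul_div_assoc, div_self hJ', mul_one]
  rw [e2, hnum, hJD, errSum, Fintype.sum_prod_type, Finset.sum_div]
  refine Finset.sum_congr rfl fun j _ => ?_
  rw [Fin.sum_univ_two, Set.indicator_of_mem hω, Set.indicator_of_mem hω]
  have := hdet j
  simp only [stCoef, stNum]
  simp only [if_true, one_ne_zero, if_false]
  field_simp
  ring

theorem errSum_of_notMem (n : ℕ) (ω : Ω)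
    (hω : wSum Y D X K h c b sd n ω ∉ stGood η (tauD b)) :
    errSum Y D X K h c b η sl sd n ω = 0 := by
  simp [errSum, Set.indicator_of_notMem hω]

theorem indicator_sqError (hpos : ∀ j n, 0 < h j n) (hη : 0 < η) (hτ : tauD b ≠ 0) (n : ℕ) :
    (regularEvent D X K c (fun j => h j n) n η).indicator
        (sqError Y D X K c (fun j => h j n) n (tau b))
      = fun ω => errSum Y D X K h c b η sl sd n ω ^ 2 := by
  funext ω
  rw [regularEvent_eq (Y := Y) (b := b) (sd := sd) hpos hη n]
  by_cases hω : wSum Y D X K h c b sd n ω ∈ stGood η (tauD b)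
  · rw [Set.indicator_of_mem (by exact hω), sqError, tauHat_sub_eq hpos hη hτ n ω hω]
  · rw [Set.indicator_of_notMem (by exact hω), errSum_of_notMem n ω hω]
    simp

end Link

/-! ### Probability of degenerate samples -/

section Degenerate

set_option linter.unusedSectionVars false

/-! ### Centring and the exponential bound. -/

theorem rowSum_sub_const {Ω S : Type*} (ξ : ℕ → Ω → S) (n : ℕ) (a : S → ℝ) (m : ℝ) (ω : Ω) :
    rowSum ξ n (fun z => a z - m) ω = rowSum ξ n a ω - n * m := by
  simp [rowSum, Finset.sum_sub_distrib]

theorem integral_sub_self {Ω : Type*} [MeasurableSpace Ω] {P : Measure Ω} [IsProbabilityMeasure P]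
    {Z : Ω → ℝ} (hZ : MemLp Z 2 P) : ∫ ω, (Z ω - ∫ ω, Z ω ∂P) ∂P = 0 := by
  rw [integral_sub (hZ.integrable (by norm_num)) (integrable_const _)]
  simp

theorem integral_sq_sub_self_le {Ω : Type*} [MeasurableSpace Ω] {P : Measure Ω}
    [IsProbabilityMeasure P] {Z : Ω → ℝ} (hZ : MemLp Z 2 P) :
    ∫ ω, (Z ω - ∫ ω, Z ω ∂P) ^ 2 ∂P ≤ ∫ ω, Z ω ^ 2 ∂P := by
  rw [← variance_eq_integral hZ.1.aemeasurable]
  exact variance_le_expectation_sq hZ.1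

theorem abs_sub_integral_le {Ω : Type*} [MeasurableSpace Ω] {P : Measure Ω}
    [IsProbabilityMeasure P] {Z : Ω → ℝ} {β : ℝ} (hβ : ∀ᵐ ω ∂P, |Z ω| ≤ β) :
    ∀ᵐ ω ∂P, |Z ω - ∫ ω, Z ω ∂P| ≤ 2 * β := by
  have h1 : |∫ ω, Z ω ∂P| ≤ β := by
    have := norm_integral_le_of_norm_le_const (μ := P) (f := Z) (C := β)
      (by simpa only [Real.norm_eq_abs] using hβ)
    simpa using this
  filter_upwards [hβ] with ω hω
  calc _ ≤ |Z ω| + |∫ ω, Z ω ∂P| := abs_sub _ _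
    _ ≤ _ := by linarith

variable {Ω : Type*} [MeasurableSpace Ω] {P : Measure Ω} [IsProbabilityMeasure P]
  {Y D X : ℕ → Ω → ℝ} {K : ℝ → ℝ} {h : Side → ℕ → ℝ} {c : ℝ} {f : ℝ → ℝ} {δ : ℝ}
  {mY mD sY sD sYD : ℝ → ℝ} {b : Side → BoundaryValues} {η A B : ℝ} {sl sd : Side → ℝ}

/-- Centred summands of the weighted sums. -/
noncomputable def wCen (P : Measure Ω) (Y D X : ℕ → Ω → ℝ) (K : ℝ → ℝ) (h : Side → ℕ → ℝ)
    (c : ℝ) (b : Side → BoundaryValues) (sd : Side → ℝ) (n : ℕ) (i : Side × Fin 5)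
    (z : ℝ × ℝ × ℝ) : ℝ :=
  wFun K h c b sd n i z - ∫ ω, wFun K h c b sd n i (obs Y D X 0 ω) ∂P

theorem Setting.measurable_wCen (S : Setting P Y D X K h c f δ mY mD sY sD sYD b η A B sl sd)
    (n : ℕ) (i : Side × Fin 5) : Measurable (wCen P Y D X K h c b sd n i) :=
  (S.measurable_wFun n i).sub_const _

theorem rowSum_wCen (n : ℕ) (i : Side × Fin 5) (ω : Ω) :
    rowSum (obs Y D X) n (wCen P Y D X K h c b sd n i) ω
      = wSum Y D X K h c b sd n ω i - wMean P Y D X K h c b sd n i :=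
  rowSum_sub_const _ _ _ _ _

theorem Setting.wCen_bounds (S : Setting P Y D X K h c f δ mY mD sY sD sYD b η A B sl sd) :
    ∃ C, 0 < C ∧ ∀ᶠ n : ℕ in atTop, ∀ i,
      (∀ᵐ ω ∂P, |wCen P Y D X K h c b sd n i (obs Y D X 0 ω)| ≤ C * rate h n) ∧
      ∫ ω, wCen P Y D X K h c b sd n i (obs Y D X 0 ω) ∂P = 0 ∧
      n * ∫ ω, wCen P Y D X K h c b sd n i (obs Y D X 0 ω) ^ 2 ∂P ≤ C * rate h n := by
  obtain ⟨C, hC, hev⟩ := S.wFun_bounds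
  refine ⟨2 * C, by positivity, ?_⟩
  filter_upwards [hev] with n hn i
  have hL := memLp_of_abs_le S.iid (S.measurable_wFun n i) (hn i).1
  have hr := S.rate_nonneg n
  refine ⟨?_, integral_sub_self hL, ?_⟩
  · rw [mul_assoc]
    exact abs_sub_integral_le (hn i).1
  · calc _ ≤ (n : ℝ) * ∫ ω, wFun K h c b sd n i (obs Y D X 0 ω) ^ 2 ∂P := by
          exact mul_le_mul_of_nonneg_left (integral_sq_sub_self_le hL) (Nat.cast_nonneg n)
      _ ≤ C * rate h n := (hn i).2
      _ ≤ _ := by nlinarith [mul_nonneg hC.le hr]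

theorem Setting.rate_le (S : Setting P Y D X K h c f δ mY mD sY sD sYD b η A B sl sd)
    {n : ℕ} (hn : n ≠ 0) : rate h n ≤ 2 / (n * min (h .pos n) (h .neg n)) := by
  have h1 := S.h_pos .pos n
  have h2 := S.h_pos .neg n
  have hn' : (0 : ℝ) < n := Nat.cast_pos.2 (Nat.pos_of_ne_zero hn)
  have h3 : 0 < min (h .pos n) (h .neg n) := lt_min h1 h2
  have h4 : 1 / ((n : ℝ) * h .pos n) ≤ 1 / (n * min (h .pos n) (h .neg n)) := by
    gcongr; exact min_le_left _ _
  have h5 : 1 / ((n : ℝ) * h .neg n) ≤ 1 / (n * min (h .pos n) (h .neg n)) := by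
    gcongr; exact min_le_right _ _
  unfold rate
  calc _ ≤ 1 / (n * min (h .pos n) (h .neg n)) + 1 / (n * min (h .pos n) (h .neg n)) := by
        linarith
    _ = _ := by ring

/-- The finitely many exceptional indices are absorbed in the constant, using `p n ≤ 1`. -/
theorem exists_exp_bound_of_eventually {p t : ℕ → ℝ} {C κ : ℝ} (hp : ∀ n, p n ≤ 1) (hC : 0 ≤ C)
    (hev : ∀ᶠ n in atTop, p n ≤ C * Real.exp (-κ * t n)) :
    ∃ C', ∀ n, p n ≤ C' * Real.exp (-κ * t n) := by
  obtain ⟨N, hN⟩ := eventually_atTop.1 hev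
  have hs : 0 ≤ ∑ k ∈ Finset.range N, Real.exp (κ * t k) :=
    Finset.sum_nonneg fun k _ => (Real.exp_pos _).le
  refine ⟨C + ∑ k ∈ Finset.range N, Real.exp (κ * t k), fun n => ?_⟩
  by_cases hn : N ≤ n
  · refine (hN n hn).trans ?_
    gcongr
    linarith
  · have h1 : Real.exp (κ * t n) ≤ ∑ k ∈ Finset.range N, Real.exp (κ * t k) :=
      Finset.single_le_sum (f := fun k => Real.exp (κ * t k)) (fun k _ => (Real.exp_pos _).le)
        (Finset.mem_range.2 (not_le.1 hn))
    calc p n ≤ 1 := hp n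
      _ = Real.exp (κ * t n) * Real.exp (-κ * t n) := by rw [← Real.exp_add]; simp
      _ ≤ _ := by gcongr; linarith

theorem Setting.eventually_measure_ge_le
    (S : Setting P Y D X K h c f δ mY mD sY sD sYD b η A B sl sd) {ρ : ℝ} (hρ : 0 < ρ) :
    ∃ κ, 0 < κ ∧ ∀ᶠ n : ℕ in atTop, ∀ i,
      P.real {ω | ρ ≤ |wSum Y D X K h c b sd n ω i - wMean P Y D X K h c b sd n i|}
        ≤ 2 * Real.exp (-κ * (n * min (h .pos n) (h .neg n))) := by
  obtain ⟨C, hC, hev⟩ := S.wCen_bounds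
  -- The Chernoff bound is applied with constant `2 C`, as `rate` is at most `2 / (n min h)`. The
  -- two entries of the minimum meet its two conditions on `l`.
  set l := min (1 / (2 * C)) (ρ / (2 * (2 * C)))
  have hl : 0 < l := lt_min (by positivity) (by positivity)
  have hl1 : l * (2 * C) ≤ 1 := by
    calc l * (2 * C) ≤ 1 / (2 * C) * (2 * C) := by gcongr; exact min_le_left _ _
      _ = 1 := by field_simp
  have hl2 : 2 * l * (2 * C) ≤ ρ := by
    calc 2 * l * (2 * C) ≤ 2 * (ρ / (2 * (2 * C))) * (2 * C) := by
          gcongr; exact min_le_right _ _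
      _ = ρ := by field_simp
  refine ⟨l * ρ / 2, by positivity, ?_⟩
  filter_upwards [hev, eventually_ne_atTop 0] with n hn hn0 i
  have h3 : 0 < min (h .pos n) (h .neg n) := lt_min (S.h_pos .pos n) (S.h_pos .neg n)
  have hn' : (0 : ℝ) < n := Nat.cast_pos.2 (Nat.pos_of_ne_zero hn0)
  have ht : 0 < n * min (h .pos n) (h .neg n) := mul_pos hn' h3
  have hCr : C * rate h n ≤ 2 * C / (n * min (h .pos n) (h .neg n)) := by
    calc C * rate h n ≤ C * (2 / (n * min (h .pos n) (h .neg n))) := by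
          gcongr; exact S.rate_le hn0
      _ = _ := by ring
  obtain ⟨hb, h0, hv⟩ := hn i
  have hm := S.measurable_wCen n i
  have hup := measureReal_rowSum_ge_le S.iid hm (n := n) ht (by positivity : 0 < 2 * C)
    (hb.mono fun ω hω => hω.trans hCr) h0 (hv.trans hCr) hl.le hl1 hl2
  have hlo := measureReal_rowSum_ge_le S.iid hm.neg (n := n) ht (by positivity : 0 < 2 * C)
    (hb.mono fun ω hω => by simpa using hω.trans hCr)
    (by simp only [Pi.neg_apply, integral_neg, h0, neg_zero])
    (by simpa using hv.trans hCr) hl.le hl1 hl2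
  have hsub : {ω | ρ ≤ |wSum Y D X K h c b sd n ω i - wMean P Y D X K h c b sd n i|}
      ⊆ {ω | ρ ≤ rowSum (obs Y D X) n (wCen P Y D X K h c b sd n i) ω}
        ∪ {ω | ρ ≤ rowSum (obs Y D X) n (-wCen P Y D X K h c b sd n i) ω} := by
    intro ω hω
    have hneg : rowSum (obs Y D X) n (-wCen P Y D X K h c b sd n i) ω
        = -rowSum (obs Y D X) n (wCen P Y D X K h c b sd n i) ω := by simp [rowSum]
    rw [Set.mem_ofPred_eq] at hω
    rcases le_abs.1 hω with e | e
    · exact Or.inl (by rw [Set.mem_ofPred_eq, rowSum_wCen]; exact e)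
    · exact Or.inr (by rw [Set.mem_ofPred_eq, hneg, rowSum_wCen]; exact e)
  calc _ ≤ _ := measureReal_mono hsub
    _ ≤ _ := measureReal_union_le _ _
    _ ≤ _ := add_le_add hup hlo
    _ = _ := by ring

/-- The good set is a neighbourhood of the limit of the means, so leaving it moves some coordinate a
fixed distance from its mean. A union bound over the coordinates concludes. -/
theorem Setting.degenerate_le
    (S : Setting P Y D X K h c f δ mY mD sY sD sYD b η A B sl sd) :
    ∃ C κ : ℝ, 0 < κ ∧ ∀ n : ℕ,
      P.real (regularEvent D X K c (fun j => h j n) n η)ᶜ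
        ≤ C * Real.exp (-κ * (n * min (h .pos n) (h .neg n))) := by
  obtain ⟨ρ, hρ, hρev⟩ := exists_dist_of_notMem_nhds
    (stGood_mem_nhds S.η_pos S.lt_stDet S.lt_stJump)
  obtain ⟨κ, hκ, hev⟩ := S.eventually_measure_ge_le hρ
  have key : ∀ᶠ n : ℕ in atTop, P.real (regularEvent D X K c (fun j => h j n) n η)ᶜ
      ≤ (2 * Fintype.card (Side × Fin 5))
        * Real.exp (-κ * (n * min (h .pos n) (h .neg n))) := by
    filter_upwards [hev, S.tendsto_wMean.eventually hρev] with n hn hd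
    rw [regularEvent_eq (Y := Y) (b := b) (sd := sd) S.h_pos S.η_pos n]
    have hsub : {ω | wSum Y D X K h c b sd n ω ∈ stGood η (tauD b)}ᶜ
        ⊆ ⋃ i, {ω | ρ ≤ |wSum Y D X K h c b sd n ω i - wMean P Y D X K h c b sd n i|} := by
      intro ω hω
      obtain ⟨i, hi⟩ := hd _ hω
      exact Set.mem_iUnion.2 ⟨i, hi⟩
    calc _ ≤ _ := measureReal_mono hsub
      _ ≤ _ := measureReal_iUnion_fintype_le _
      _ ≤ ∑ i : Side × Fin 5, 2 * Real.exp (-κ * (n * min (h .pos n) (h .neg n))) :=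
          Finset.sum_le_sum fun i _ => hn i
      _ = _ := by rw [Finset.sum_const, nsmul_eq_mul, Finset.card_univ]; ring
  obtain ⟨C, hC⟩ := exists_exp_bound_of_eventually (fun n => measureReal_le_one) (by positivity) key
  exact ⟨C, κ, hκ, hC⟩

end Degenerate

/-! ### Mean and variance of the estimation error -/

section Moments

set_option linter.unusedSectionVars false

/-! ### Measurability of the statistic, and moments of the linearization error. -/

theorem measurable_stDet (j : Side) : Measurable fun w => stDet w j := by
  unfold stDet; fun_prop

theorem measurable_stJump (t : ℝ) : Measurable (stJump t) := by
  unfold stJump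
  refine measurable_const.add (Finset.measurable_sum _ fun j _ => measurable_const.mul ?_)
  exact Measurable.div (by fun_prop) (measurable_stDet j)

theorem measurable_stCoef (t : ℝ) (p : Side × Fin 2) : Measurable (stCoef t p) := by
  unfold stCoef
  refine Measurable.div (measurable_const.mul ?_)
    ((measurable_stDet p.1).mul (measurable_stJump t))
  unfold stNum; split_ifs <;> fun_prop

theorem measurableSet_stGood (η t : ℝ) : MeasurableSet (stGood η t) := by
  have h1 : MeasurableSet {w : Side × Fin 5 → ℝ | ∀ j, η ≤ |stDet w j|} := by
    rw [Set.ofPred_forall]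
    exact MeasurableSet.iInter fun j => measurableSet_le measurable_const (measurable_stDet j).abs
  exact h1.inter (measurableSet_le measurable_const (measurable_stJump t).abs)

variable {Ω : Type*} [MeasurableSpace Ω] {P : Measure Ω} [IsProbabilityMeasure P]
  {Y D X : ℕ → Ω → ℝ} {K : ℝ → ℝ} {h : Side → ℕ → ℝ} {c : ℝ} {f : ℝ → ℝ} {δ : ℝ}
  {mY mD sY sD sYD : ℝ → ℝ} {b : Side → BoundaryValues} {η A B : ℝ} {sl sd : Side → ℝ}

theorem Setting.measurable_wSum (S : Setting P Y D X K h c f δ mY mD sY sD sYD b η A B sl sd)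
    (n : ℕ) : Measurable (wSum Y D X K h c b sd n) :=
  measurable_pi_iff.2 fun i => measurable_rowSum S.iid n (S.measurable_wFun n i)

/-- Linearization of the estimation error. -/
noncomputable def linSum (P : Measure Ω) (Y D X : ℕ → Ω → ℝ) (K : ℝ → ℝ) (h : Side → ℕ → ℝ)
    (c : ℝ) (b : Side → BoundaryValues) (sl sd : Side → ℝ) (n : ℕ) (ω : Ω) : ℝ :=
  ∑ p, stCoef (tauD b) p (wMean P Y D X K h c b sd n) * rSum Y D X K h c b sl n p ω

/-- Random part of the coefficients of the weighted residual sums. -/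
noncomputable def coefDev (P : Measure Ω) (Y D X : ℕ → Ω → ℝ) (K : ℝ → ℝ) (h : Side → ℕ → ℝ)
    (c : ℝ) (b : Side → BoundaryValues) (η : ℝ) (sd : Side → ℝ) (n : ℕ) (p : Side × Fin 2)
    (ω : Ω) : ℝ :=
  (stGood η (tauD b)).indicator (stCoef (tauD b) p) (wSum Y D X K h c b sd n ω)
    - stCoef (tauD b) p (wMean P Y D X K h c b sd n)

theorem errSum_eq (n : ℕ) (ω : Ω) :
    errSum Y D X K h c b η sl sd n ω = linSum P Y D X K h c b sl sd n ω
      + ∑ p, rSum Y D X K h c b sl n p ω * coefDev P Y D X K h c b η sd n p ω := by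
  rw [errSum, linSum, ← Finset.sum_add_distrib]
  refine Finset.sum_congr rfl fun p _ => ?_
  rw [coefDev]; ring

/-- The Lipschitz bound dominates the coefficient deviations by the centred sums `W_i - E W_i`, and
`remainder_moments` applies with `M` of order `H²`, `Q` of order `rate` and `Q'` of order `rate²`.
-/
theorem Setting.exists_remainder_le
    (S : Setting P Y D X K h c f δ mY mD sY sD sYD b η A B sl sd) :
    ∃ C, 0 ≤ C ∧ ∀ᶠ n : ℕ in atTop,
      (∀ p, MemLp (rSum Y D X K h c b sl n p) 2 P) ∧
      MemLp (fun ω => ∑ p, rSum Y D X K h c b sl n p ω * coefDev P Y D X K h c b η sd n p ω) 2 P ∧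
      |∫ ω, ∑ p, rSum Y D X K h c b sl n p ω * coefDev P Y D X K h c b η sd n p ω ∂P|
        ≤ C * ((h .pos n + h .neg n) ^ 4 + rate h n) ∧
      ∫ ω, (∑ p, rSum Y D X K h c b sl n p ω * coefDev P Y D X K h c b η sd n p ω) ^ 2 ∂P
        ≤ C * rate h n * ((h .pos n + h .neg n) ^ 4 + rate h n) := by
  obtain ⟨Lc, hLc, hlip⟩ := exists_lipschitz_stCoef S.η_pos S.lt_stDet S.lt_stJump
  obtain ⟨C₁, hC₁, hr⟩ := S.rFun_bounds
  obtain ⟨C₂, hC₂, hw⟩ := S.wCen_bounds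
  set C := max C₁ C₂
  have hC : 0 < C := lt_max_of_lt_left hC₁
  set N : ℝ := ((Fintype.card ((Side × Fin 2) × (Side × Fin 5)) : ℕ) : ℝ)
  have hN : 0 ≤ N := Nat.cast_nonneg _
  refine ⟨Lc * N * (C ^ 2 + C) + Lc ^ 2 * N ^ 2 * (2 * (C ^ 3 + 3 * C ^ 2)), by positivity, ?_⟩
  filter_upwards [hr, hw, S.tendsto_wMean.eventually hlip,
    S.tendsto_rate.eventually_lt_const one_pos] with n hr hw hlip hr1
  have hr0 := S.rate_nonneg n
  set ρ := rate h n
  set H := h .pos n + h .neg n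
  have hC₁C : C₁ * ρ ≤ C * ρ := mul_le_mul_of_nonneg_right (le_max_left _ _) hr0
  have hC₂C : C₂ * ρ ≤ C * ρ := mul_le_mul_of_nonneg_right (le_max_right _ _) hr0
  have hR : ∀ p, MemLp (rSum Y D X K h c b sl n p) 2 P := fun p =>
    memLp_rowSum S.iid n (S.measurable_rFun n p) (hr p).1
  have hRint : ∀ p, ∫ ω, rSum Y D X K h c b sl n p ω ∂P = rMean P Y D X K h c b sl n p :=
    fun p => integral_rowSum S.iid n (S.measurable_rFun n p) (hr p).1
  have hRcen : ∀ p ω, rSum Y D X K h c b sl n p ω - ∫ ω, rSum Y D X K h c b sl n p ω ∂P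
      = rowSum (obs Y D X) n (fun z => rFun K h c b sl n p z
        - ∫ ω, rFun K h c b sl n p (obs Y D X 0 ω) ∂P) ω := fun p ω => by
    rw [hRint, rowSum_sub_const]; rfl
  have hmix : ∀ p i, Integrable (fun ω => (rSum Y D X K h c b sl n p ω
        - ∫ ω, rSum Y D X K h c b sl n p ω ∂P) ^ 2
        * rowSum (obs Y D X) n (wCen P Y D X K h c b sd n i) ω ^ 2) P ∧
      ∫ ω, (rSum Y D X K h c b sl n p ω
        - ∫ ω, rSum Y D X K h c b sl n p ω ∂P) ^ 2
        * rowSum (obs Y D X) n (wCen P Y D X K h c b sd n i) ω ^ 2 ∂P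
        -- The fourth moment bound yields a cubic and a quadratic term in `ρ`; the cubic one is
        -- absorbed since `ρ < 1` eventually.
        ≤ (C ^ 3 + 3 * C ^ 2) * ρ ^ 2 := by
    intro p i
    simp only [hRcen]
    have h1 := integral_sq_mul_sq_rowSum_le S.iid
      (a := fun z => rFun K h c b sl n p z - ∫ ω, rFun K h c b sl n p (obs Y D X 0 ω) ∂P)
      ((S.measurable_rFun n p).sub_const _) (S.measurable_wCen n i)
      ((hr p).1.sub (memLp_const _)) (hw i).1 (integral_sub_self (hr p).1) (hw i).2.1 n
    refine ⟨h1.1, h1.2.trans ?_⟩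
    set α := ∫ ω, (rFun K h c b sl n p (obs Y D X 0 ω)
      - ∫ ω, rFun K h c b sl n p (obs Y D X 0 ω) ∂P) ^ 2 ∂P
    set γ := ∫ ω, wCen P Y D X K h c b sd n i (obs Y D X 0 ω) ^ 2 ∂P
    have hα0 : 0 ≤ α := integral_nonneg fun _ => sq_nonneg _
    have hγ0 : 0 ≤ γ := integral_nonneg fun _ => sq_nonneg _
    have hα : n * α ≤ C * ρ :=
      ((mul_le_mul_of_nonneg_left (integral_sq_sub_self_le (hr p).1) (Nat.cast_nonneg n)).trans
        (hr p).2.1).trans hC₁C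
    have hγ : n * γ ≤ C * ρ := (hw i).2.2.trans hC₂C
    have hβ : (C₂ * ρ) ^ 2 ≤ (C * ρ) ^ 2 := by gcongr
    calc (n : ℝ) * ((C₂ * ρ) ^ 2 * α) + 3 * n ^ 2 * (α * γ)
        = (C₂ * ρ) ^ 2 * (n * α) + 3 * ((n * α) * (n * γ)) := by ring
      _ ≤ (C * ρ) ^ 2 * (C * ρ) + 3 * ((C * ρ) * (C * ρ)) := by gcongr
      _ = C ^ 3 * (ρ ^ 2 * ρ) + 3 * C ^ 2 * ρ ^ 2 := by ring
      _ ≤ C ^ 3 * (ρ ^ 2 * 1) + 3 * C ^ 2 * ρ ^ 2 := by gcongr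
      _ = _ := by ring
  have hVint : ∀ i, ∫ ω, rowSum (obs Y D X) n (wCen P Y D X K h c b sd n i) ω ^ 2 ∂P
      ≤ C * ρ := fun i => by
    rw [integral_sq_rowSum_eq S.iid (S.measurable_wCen n i)
      (memLp_of_abs_le S.iid (S.measurable_wCen n i) (hw i).1) (hw i).2.1 n]
    exact (hw i).2.2.trans hC₂C
  have main := remainder_moments (P := P) (R := rSum Y D X K h c b sl n)
    (V := fun i => rowSum (obs Y D X) n (wCen P Y D X K h c b sd n i))
    (D := coefDev P Y D X K h c b η sd n) (C := Lc) (M := C * H ^ 2) (Q := C * ρ)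
    (Q' := (C ^ 3 + 3 * C ^ 2) * ρ ^ 2) hR
    (fun i => memLp_rowSum S.iid n (S.measurable_wCen n i)
      (memLp_of_abs_le S.iid (S.measurable_wCen n i) (hw i).1))
    (fun p => (((((measurable_stCoef _ p).indicator (measurableSet_stGood _ _)).comp
      (S.measurable_wSum n)).sub_const _)).aestronglyMeasurable) hLc
    (fun p ω => by
      simp only [rowSum_wCen]
      exact hlip p _)
    (fun p => by
      rw [hRint]
      exact (hr p).2.2.trans (mul_le_mul_of_nonneg_right (le_max_left _ _) (sq_nonneg _)))
    (fun p => ((variance_rowSum_le S.iid n (S.measurable_rFun n p) (hr p).1).trans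
      (hr p).2.1).trans hC₁C)
    hVint (fun p i => (hmix p i).1) (fun p i => (hmix p i).2)
  obtain ⟨m1, m2, m3⟩ := main
  have hH4 : 0 ≤ H ^ 4 := by positivity
  refine ⟨hR, m1, m2.trans ?_, m3.trans ?_⟩
  · have e1 : (C * H ^ 2) ^ 2 + C * ρ ≤ (C ^ 2 + C) * (H ^ 4 + ρ) := by
      have := mul_nonneg hC.le hH4
      have := mul_nonneg (sq_nonneg C) hr0
      nlinarith
    have e2 : 0 ≤ Lc ^ 2 * N ^ 2 * (2 * (C ^ 3 + 3 * C ^ 2)) * (H ^ 4 + ρ) := by positivity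
    calc Lc * N * ((C * H ^ 2) ^ 2 + C * ρ)
        ≤ Lc * N * ((C ^ 2 + C) * (H ^ 4 + ρ)) := by gcongr
      _ ≤ _ := by linarith
  · have e2 : 0 ≤ Lc * N * (C ^ 2 + C) * (ρ * (H ^ 4 + ρ)) := by positivity
    have e3 : 0 ≤ Lc ^ 2 * N ^ 2 * (6 * C ^ 2 * (H ^ 4 * ρ)) := by positivity
    calc Lc ^ 2 * N ^ 2 * (2 * ((C ^ 3 + 3 * C ^ 2) * ρ ^ 2) + 2 * (C * H ^ 2) ^ 2 * (C * ρ))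
        = Lc ^ 2 * N ^ 2 * (2 * (C ^ 3 + 3 * C ^ 2)) * (ρ * (H ^ 4 + ρ))
          - Lc ^ 2 * N ^ 2 * (6 * C ^ 2 * (H ^ 4 * ρ)) := by ring
      _ ≤ _ := by linarith

/-- The mean of the remainder is kept as an error term, whereas its second moment is `o(rate)` and
so, with `abs_variance_add_sub_le`, changes the variance only by `o(rate)`. -/
theorem Setting.errSum_moments
    (S : Setting P Y D X K h c f δ mY mD sY sD sYD b η A B sl sd) {V : ℕ → ℝ}
    (hV : V =O[atTop] rate h)
    (hlin : (fun n => Var[linSum P Y D X K h c b sl sd n; P] - V n) =o[atTop] rate h) :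
    (∀ᶠ n in atTop, MemLp (errSum Y D X K h c b η sl sd n) 2 P) ∧
    (∃ C, ∀ᶠ n in atTop, |∫ ω, errSum Y D X K h c b η sl sd n ω ∂P
        - ∑ p, stCoef (tauD b) p (wMean P Y D X K h c b sd n) * rMean P Y D X K h c b sl n p|
        ≤ C * ((h .pos n + h .neg n) ^ 4 + rate h n)) ∧
    (fun n => Var[errSum Y D X K h c b η sl sd n; P] - V n) =o[atTop] rate h := by
  obtain ⟨C, hC, hrem⟩ := S.exists_remainder_le
  obtain ⟨C₁, hC₁, hr⟩ := S.rFun_bounds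
  have hlinM : ∀ n, (∀ p, MemLp (rSum Y D X K h c b sl n p) 2 P) →
      MemLp (linSum P Y D X K h c b sl sd n) 2 P := fun n hn =>
    memLp_finsetSum _ fun p _ => (hn p).const_mul _
  have herr : ∀ n, errSum Y D X K h c b η sl sd n = fun ω => linSum P Y D X K h c b sl sd n ω
      + ∑ p, rSum Y D X K h c b sl n p ω * coefDev P Y D X K h c b η sd n p ω :=
    fun n => funext fun ω => errSum_eq n ω
  refine ⟨?_, ⟨C, ?_⟩, ?_⟩
  · filter_upwards [hrem] with n hn
    rw [herr]
    exact (hlinM n hn.1).add hn.2.1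
  · filter_upwards [hrem, hr] with n hn hr
    have e : ∫ ω, linSum P Y D X K h c b sl sd n ω ∂P
        = ∑ p, stCoef (tauD b) p (wMean P Y D X K h c b sd n)
          * rMean P Y D X K h c b sl n p := by
      unfold linSum
      rw [integral_finsetSum _ fun p _ => ((hn.1 p).integrable (by norm_num)).const_mul _]
      refine Finset.sum_congr rfl fun p _ => ?_
      rw [integral_const_mul]
      congr 1
      exact integral_rowSum S.iid n (S.measurable_rFun n p) (hr p).1
    rw [herr, integral_add ((hlinM n hn.1).integrable (by norm_num))
      (hn.2.1.integrable (by norm_num)), e, add_sub_cancel_left]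
    exact hn.2.2.1
  -- The second moment of the remainder is `O(rate · t²)`. With this weight the variance changes by
  -- at most `t Var L + (1/t + 1) C rate t²`, and both terms are `o(rate)`.
  · set t : ℕ → ℝ := fun n => √((h .pos n + h .neg n) ^ 4 + rate h n)
    have hH : Tendsto (fun n => (h .pos n + h .neg n) ^ 4 + rate h n) atTop (𝓝 0) := by
      have := (((S.h_zero .pos).add (S.h_zero .neg)).pow 4).add S.tendsto_rate
      simpa using this
    have ht0 : Tendsto t atTop (𝓝 0) := by
      have := (Real.continuous_sqrt.tendsto 0).comp hH
      rwa [Real.sqrt_zero] at this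
    have hHpos : ∀ n, 0 < (h .pos n + h .neg n) ^ 4 + rate h n := fun n => by
      have h1 := S.h_pos .pos n
      have h2 := S.h_pos .neg n
      have h3 := S.rate_nonneg n
      positivity
    have htp : ∀ n, 0 < t n := fun n => Real.sqrt_pos.2 (hHpos n)
    have hsq : ∀ n, (h .pos n + h .neg n) ^ 4 + rate h n = t n ^ 2 := fun n =>
      (Real.sq_sqrt (hHpos n).le).symm
    have hL : (fun n => Var[linSum P Y D X K h c b sl sd n; P]) =O[atTop] rate h :=
      (hlin.isBigO.add hV).congr_left fun n => by ring
    have hone : t =o[atTop] fun _ => (1 : ℝ) := (isLittleO_one_iff ℝ).2 ht0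
    have hsmall : (fun n => t n * Var[linSum P Y D X K h c b sl sd n; P]
        + C * rate h n * (t n + t n ^ 2)) =o[atTop] rate h := by
      have h1 := hone.mul_isBigO hL
      have h2 : (fun n => t n + t n ^ 2) =o[atTop] fun _ => (1 : ℝ) := by
        rw [isLittleO_one_iff]
        simpa using ht0.add (ht0.pow 2)
      have h3 := ((isBigO_refl (rate h) atTop).const_mul_left C).mul_isLittleO h2
      simp only [one_mul, mul_one] at h1 h3
      exact h1.add h3
    have hdiff : (fun n => Var[errSum Y D X K h c b η sl sd n; P]
        - Var[linSum P Y D X K h c b sl sd n; P]) =o[atTop] rate h := by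
      refine IsBigO.trans_isLittleO ?_ hsmall
      refine IsBigO.of_bound 1 ?_
      filter_upwards [hrem] with n hn
      rw [one_mul, Real.norm_eq_abs, Real.norm_eq_abs, herr]
      refine le_trans ?_ (le_abs_self _)
      refine (abs_variance_add_sub_le (hlinM n hn.1) hn.2.1 (htp n)).trans ?_
      have h4 := hn.2.2.2
      rw [hsq] at h4
      have h5 := htp n
      have h6 : (1 / t n + 1) * (C * rate h n * t n ^ 2) = C * rate h n * (t n + t n ^ 2) := by
        field_simp
      have h7 : 0 ≤ 1 / t n + 1 := by positivity
      have h8 := mul_le_mul_of_nonneg_left h4 h7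
      linarith
    exact (hdiff.add hlin).congr_left fun n => by ring

end Moments

/-! ### Expansion of the bias -/

section Bias

set_option linter.unusedSectionVars false

variable {Ω : Type*} [MeasurableSpace Ω] {P : Measure Ω} [IsProbabilityMeasure P]
  {Y D X : ℕ → Ω → ℝ} {K : ℝ → ℝ} {h : Side → ℕ → ℝ} {c : ℝ} {f : ℝ → ℝ} {δ : ℝ}
  {mY mD sY sD sYD : ℝ → ℝ} {b : Side → BoundaryValues} {η A B : ℝ} {sl sd : Side → ℝ}

/-- Linearization of the estimation error at the means of the weighted sums. -/
noncomputable def linBias (P : Measure Ω) (Y D X : ℕ → Ω → ℝ) (K : ℝ → ℝ) (h : Side → ℕ → ℝ)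
    (c : ℝ) (b : Side → BoundaryValues) (sl sd : Side → ℝ) (n : ℕ) : ℝ :=
  ∑ p, stCoef (tauD b) p (wMean P Y D X K h c b sd n) * rMean P Y D X K h c b sl n p

/-- Bias of the population local linear fit on side `j`. -/
noncomputable def sideBias (P : Measure Ω) (Y D X : ℕ → Ω → ℝ) (K : ℝ → ℝ) (h : Side → ℕ → ℝ)
    (c : ℝ) (b : Side → BoundaryValues) (sl sd : Side → ℝ) (n : ℕ) (j : Side) : ℝ :=
  (wMean P Y D X K h c b sd n (j, 2) * rMean P Y D X K h c b sl n (j, 0)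
    - wMean P Y D X K h c b sd n (j, 1) * rMean P Y D X K h c b sl n (j, 1))
    / stDet (wMean P Y D X K h c b sd n) j

theorem Setting.eventually_stDet_ne
    (S : Setting P Y D X K h c f δ mY mD sY sD sYD b η A B sl sd) :
    ∀ᶠ n in atTop, ∀ j, stDet (wMean P Y D X K h c b sd n) j ≠ 0 := by
  refine eventually_all.2 fun j => ?_
  have h1 := ((contDiff_stDet j).continuous.tendsto _).comp S.tendsto_wMean
  refine h1.eventually_ne fun h0 => ?_
  have := S.lt_stDet j
  rw [h0, abs_zero] at this
  exact absurd this (not_lt.2 S.η_pos.le)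

theorem Setting.tendsto_stJump (S : Setting P Y D X K h c f δ mY mD sY sD sYD b η A B sl sd) :
    Tendsto (fun n => stJump (tauD b) (wMean P Y D X K h c b sd n)) atTop (𝓝 (tauD b)) := by
  have hne : ∀ j, stDet (wLim K (f c)) j ≠ 0 := fun j h0 => by
    have := S.lt_stDet j
    rw [h0, abs_zero] at this
    exact absurd this (not_lt.2 S.η_pos.le)
  have h1 := ((contDiffAt_stJump (tauD b) hne).continuousAt.tendsto).comp S.tendsto_wMean
  rwa [stJump_wLim] at h1

/-- All coefficients share the denominator given by the population jump. Pulling it out isolates the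
factor `τ_D / J`, which is close to 1. -/
theorem Setting.linBias_eq (S : Setting P Y D X K h c f δ mY mD sY sD sYD b η A B sl sd) :
    ∀ᶠ n in atTop, tauD b * linBias P Y D X K h c b sl sd n
      = tauD b / stJump (tauD b) (wMean P Y D X K h c b sd n)
        * ∑ j : Side, j.sign * sideBias P Y D X K h c b sl sd n j := by
  filter_upwards [S.eventually_stDet_ne, S.tendsto_stJump.eventually_ne S.tauD_ne] with n hd hJ
  rw [linBias, Fintype.sum_prod_type, Finset.mul_sum, Finset.mul_sum]
  refine Finset.sum_congr rfl fun j _ => ?_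
  have := hd j
  rw [Fin.sum_univ_two]
  simp only [stCoef, stNum, sideBias, if_true, one_ne_zero, if_false]
  field_simp
  ring

theorem Setting.sideBias_expansion
    (S : Setting P Y D X K h c f δ mY mD sY sD sYD b η A B sl sd) (j : Side) :
    (fun n => sideBias P Y D X K h c b sl sd n j
      - (phi K b j * h j n ^ 2 + psi K (f c) (deriv f c) b j * h j n ^ 3))
      =o[atTop] fun n => h j n ^ 3 := by
  have h1 := localLinear_expansion S.kdet_ne (f0 := f c) (f1 := deriv f c)
    (p := (1 * (b j).mY2 + -tau b * (b j).mD2) / 2)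
    (q := (1 * (b j).mY3 + -tau b * (b j).mD3) / 6) (σ := j.sign) S.f_pos.ne' j.sign_sq
    (s := fun k t => t⁻¹ * ∫ ω, wt K c j t k (X 0 ω) ∂P)
    (r := fun k t => t⁻¹ * (∫ ω, wt K c j t k (X 0 ω)
      * residZ b sl c j (X 0 ω, Y 0 ω, D 0 ω) ∂P) / t ^ 2)
    (fun k => (S.side j).design_expansion S.weight k)
    (fun k => (S.side j).mean_expansion S.weight (S.slopeZ j) k)
  have h2 := (h1.comp_tendsto (S.tendsto_h j)).mul_isBigO
    (isBigO_refl (fun n => h j n ^ 2) atTop)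
  have e1 : C1 K * (2 * ((1 * (b j).mY2 + -tau b * (b j).mD2) / 2)) = phi K b j := by
    unfold phi; ring
  have e2 : j.sign * (xi1 K * ((1 * (b j).mY2 + -tau b * (b j).mD2) / 2 * (deriv f c / f c)
      + (1 * (b j).mY3 + -tau b * (b j).mD3) / 6)
      - xi2 K * ((1 * (b j).mY2 + -tau b * (b j).mD2) / 2 * (deriv f c / f c)))
      = psi K (f c) (deriv f c) b j := by
    unfold psi zeta; ring
  rw [e1, e2] at h2
  refine h2.congr' ?_ (Eventually.of_forall fun n => by simp only [Function.comp]; ring)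
  filter_upwards [eventually_ne_atTop 0, S.eventually_stDet_ne] with n hn hd
  have hh := (S.h_pos j n).ne'
  -- The first three of the five coordinates are the design moments; the cast matches them with the
  -- `Fin 3` family of `localLinear_expansion`.
  have hw : ∀ k : Fin 3, wMean P Y D X K h c b sd n (j, k.castLE (by omega))
      = (h j n)⁻¹ * ∫ ω, wt K c j (h j n) k (X 0 ω) ∂P := fun k => by
    rw [wMean_lt_three hn (by exact k.2)]
    fin_cases k <;> rfl
  have hr : ∀ k : Fin 2, rMean P Y D X K h c b sl n (j, k)
      = ((h j n)⁻¹ * (∫ ω, wt K c j (h j n) k (X 0 ω)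
      * residZ b sl c j (X 0 ω, Y 0 ω, D 0 ω) ∂P) / h j n ^ 2) * h j n ^ 2 := fun k => by
    rw [div_mul_cancel₀ _ (pow_ne_zero 2 hh)]
    exact cell_mean j _ hn _ _
  have hdj := hd j
  simp only [Function.comp]
  rw [← hw 0, ← hw 1, ← hw 2, sideBias, hr 0, hr 1]
  have hst : stDet (wMean P Y D X K h c b sd n) j
      = wMean P Y D X K h c b sd n (j, (0 : Fin 3).castLE (by omega))
        * wMean P Y D X K h c b sd n (j, (2 : Fin 3).castLE (by omega))
        - wMean P Y D X K h c b sd n (j, (1 : Fin 3).castLE (by omega))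
        * wMean P Y D X K h c b sd n (j, (1 : Fin 3).castLE (by omega)) := by
    rw [stDet, sq]; rfl
  rw [← hst]
  have c1 : (1 : Fin 3).castLE (by omega) = (1 : Fin 5) := rfl
  have c2 : (2 : Fin 3).castLE (by omega) = (2 : Fin 5) := rfl
  rw [c1, c2]
  ring

/-- At the means, the deviation of the jump from `τ_D` is linear in the mean `D`-residual sums,
which are `o(h)`, with bounded coefficients. -/
theorem Setting.stJump_sub_isLittleO
    (S : Setting P Y D X K h c f δ mY mD sY sD sYD b η A B sl sd) :
    (fun n => stJump (tauD b) (wMean P Y D X K h c b sd n) - tauD b)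
      =o[atTop] fun n => h .pos n + h .neg n := by
  have hH : ∀ j, (fun n => h j n) =O[atTop] fun n => h .pos n + h .neg n := fun j => by
    refine IsBigO.of_bound 1 (Eventually.of_forall fun n => ?_)
    have h1 := S.h_pos .pos n
    have h2 := S.h_pos .neg n
    rw [Real.norm_of_nonneg (S.h_pos j n).le, Real.norm_of_nonneg (by positivity), one_mul]
    cases j <;> linarith
  have hd : ∀ j (i : Fin 5), ¬ (i : ℕ) < 3 → (fun n => wMean P Y D X K h c b sd n (j, i))
      =o[atTop] fun n => h .pos n + h .neg n := fun j i hi => by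
    refine (((S.meanD_isLittleO j (wIdx i)).comp_tendsto (S.tendsto_h j)).trans_isBigO
      (hH j)).congr' ?_ (EventuallyEq.refl _ _)
    filter_upwards [eventually_ne_atTop 0] with n hn
    rw [wMean_ge_three hn (by exact hi)]; rfl
  have hw : ∀ i, (fun n => wMean P Y D X K h c b sd n i) =O[atTop] fun _ => (1 : ℝ) := fun i =>
    (tendsto_pi_nhds.1 S.tendsto_wMean i).isBigO_one ℝ
  have hdet : ∀ j, (fun n => (stDet (wMean P Y D X K h c b sd n) j)⁻¹)
      =O[atTop] fun _ => (1 : ℝ) := fun j => by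
    have h1 := ((contDiff_stDet j).continuous.tendsto _).comp S.tendsto_wMean
    refine (h1.inv₀ fun h0 => ?_).isBigO_one ℝ
    have := S.lt_stDet j
    rw [h0, abs_zero] at this
    exact absurd this (not_lt.2 S.η_pos.le)
  have key : ∀ j : Side, (fun n => j.sign * ((wMean P Y D X K h c b sd n (j, 2)
      * wMean P Y D X K h c b sd n (j, 3) - wMean P Y D X K h c b sd n (j, 1)
      * wMean P Y D X K h c b sd n (j, 4)) / stDet (wMean P Y D X K h c b sd n) j))
      =o[atTop] fun n => h .pos n + h .neg n := fun j => by
    have h1 := (hw (j, 2)).mul_isLittleO (hd j 3 (by simp))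
    have h2 := (hw (j, 1)).mul_isLittleO (hd j 4 (by simp))
    have h3 := ((h1.sub h2).mul_isBigO (hdet j)).const_mul_left j.sign
    exact h3.congr (fun n => by rw [div_eq_mul_inv]) fun n => by ring
  refine ((key .pos).add (key .neg)).congr_left fun n => ?_
  rw [stJump, Side.sum_eq]; ring

/-- Replacing the factor `τ_D / J = 1 + o(H)` by 1 costs `o(H)` times a bias of order `H²`, that is
`o(h₊³ + h₋³)`. The rest is the signed sum of the one-sided expansions. -/
theorem Setting.linBias_expansion
    (S : Setting P Y D X K h c f δ mY mD sY sD sYD b η A B sl sd) :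
    (fun n => tauD b * linBias P Y D X K h c b sl sd n
      - ((phi K b .pos * h .pos n ^ 2 - phi K b .neg * h .neg n ^ 2)
        + (psi K (f c) (deriv f c) b .pos * h .pos n ^ 3
          - psi K (f c) (deriv f c) b .neg * h .neg n ^ 3)))
      =o[atTop] fun n => h .pos n ^ 3 + h .neg n ^ 3 := by
  have hcube : ∀ j, (fun n => h j n ^ 3) =O[atTop] fun n => h .pos n ^ 3 + h .neg n ^ 3 :=
    fun j => by
      refine IsBigO.of_bound 1 (Eventually.of_forall fun n => ?_)
      have h1 := pow_pos (S.h_pos .pos n) 3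
      have h2 := pow_pos (S.h_pos .neg n) 3
      rw [Real.norm_of_nonneg (pow_pos (S.h_pos j n) 3).le, Real.norm_of_nonneg (by positivity),
        one_mul]
      cases j <;> linarith
  have hside : (fun n => (∑ j : Side, j.sign * sideBias P Y D X K h c b sl sd n j)
      - ((phi K b .pos * h .pos n ^ 2 - phi K b .neg * h .neg n ^ 2)
        + (psi K (f c) (deriv f c) b .pos * h .pos n ^ 3
          - psi K (f c) (deriv f c) b .neg * h .neg n ^ 3)))
      =o[atTop] fun n => h .pos n ^ 3 + h .neg n ^ 3 := by
    refine (((S.sideBias_expansion .pos).trans_isBigO (hcube .pos)).sub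
      ((S.sideBias_expansion .neg).trans_isBigO (hcube .neg))).congr_left fun n => ?_
    rw [Side.sum_eq]; simp only [Side.sign]; ring
  have hsq : ∀ j, (fun n => h j n ^ 2) =O[atTop] fun n => (h .pos n + h .neg n) ^ 2 :=
    fun j => by
      refine IsBigO.of_bound 1 (Eventually.of_forall fun n => ?_)
      have h1 := S.h_pos .pos n
      have h2 := S.h_pos .neg n
      rw [Real.norm_of_nonneg (sq_nonneg _), Real.norm_of_nonneg (sq_nonneg _), one_mul]
      cases j <;> gcongr <;> linarith
  have hside2 : ∀ j, (fun n => sideBias P Y D X K h c b sl sd n j)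
      =O[atTop] fun n => (h .pos n + h .neg n) ^ 2 := fun j => by
    have h0 : (fun n => h j n ^ 3) =O[atTop] fun n => h j n ^ 2 := by
      have := ((S.h_zero j).isBigO_one ℝ).mul (isBigO_refl (fun n => h j n ^ 2) atTop)
      exact this.congr (fun n => by ring) fun n => by ring
    have h1 := ((S.sideBias_expansion j).isBigO.trans h0).add
      (((isBigO_refl (fun n => h j n ^ 2) atTop).const_mul_left (phi K b j)).add
        (h0.const_mul_left (psi K (f c) (deriv f c) b j)))
    exact (h1.congr_left fun n => by ring).trans (hsq j)
  have hsum : (fun n => ∑ j : Side, j.sign * sideBias P Y D X K h c b sl sd n j)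
      =O[atTop] fun n => (h .pos n + h .neg n) ^ 2 :=
    IsBigO.fun_sum fun j _ => (hside2 j).const_mul_left _
  have hJ : (fun n => tauD b / stJump (tauD b) (wMean P Y D X K h c b sd n) - 1)
      =o[atTop] fun n => h .pos n + h .neg n := by
    have h1 := (S.tendsto_stJump.inv₀ S.tauD_ne).isBigO_one ℝ
    have h2 := (h1.mul_isLittleO S.stJump_sub_isLittleO).neg_left
    refine h2.congr' ?_ (Eventually.of_forall fun n => by ring)
    filter_upwards [S.tendsto_stJump.eventually_ne S.tauD_ne] with n hn
    field_simp
    ring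
  have hprod := hJ.mul_isBigO hsum
  have hpow : (fun n => (h .pos n + h .neg n) * (h .pos n + h .neg n) ^ 2)
      =O[atTop] fun n => h .pos n ^ 3 + h .neg n ^ 3 := by
    refine IsBigO.of_bound 4 (Eventually.of_forall fun n => ?_)
    have h1 := S.h_pos .pos n
    have h2 := S.h_pos .neg n
    rw [Real.norm_of_nonneg (by positivity), Real.norm_of_nonneg (by positivity)]
    nlinarith [mul_nonneg (add_pos h1 h2).le (sq_nonneg (h .pos n - h .neg n))]
  refine ((hprod.trans_isBigO hpow).add hside).congr' ?_ (EventuallyEq.refl _ _)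
  filter_upwards [S.linBias_eq] with n hn
  rw [hn]; ring

end Bias

/-! ### Variance of the linearized estimation error -/

section Variance

set_option linter.unusedSectionVars false

variable {Ω : Type*} [MeasurableSpace Ω] {P : Measure Ω} [IsProbabilityMeasure P]
  {Y D X : ℕ → Ω → ℝ} {K : ℝ → ℝ} {h : Side → ℕ → ℝ} {c : ℝ} {f : ℝ → ℝ} {δ : ℝ}
  {mY mD sY sD sYD : ℝ → ℝ} {b : Side → BoundaryValues} {η A B : ℝ} {sl sd : Side → ℝ}

/-- Summands of the linearized estimation error. -/
noncomputable def linFun (P : Measure Ω) (Y D X : ℕ → Ω → ℝ) (K : ℝ → ℝ) (h : Side → ℕ → ℝ)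
    (c : ℝ) (b : Side → BoundaryValues) (sl sd : Side → ℝ) (n : ℕ) (z : ℝ × ℝ × ℝ) : ℝ :=
  ∑ p, stCoef (tauD b) p (wMean P Y D X K h c b sd n) * rFun K h c b sl n p z

/-- Normalized second moment of the residual on side `j`. -/
noncomputable def sqMom (P : Measure Ω) (Y D X : ℕ → Ω → ℝ) (K : ℝ → ℝ)
    (c : ℝ) (b : Side → BoundaryValues) (sl : Side → ℝ) (j : Side) (k : ℕ) (t : ℝ) : ℝ :=
  t⁻¹ * ∫ ω, wt (fun u => K u ^ 2) c j t k (X 0 ω)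
    * residZ b sl c j (X 0 ω, Y 0 ω, D 0 ω) ^ 2 ∂P

/-- Contribution of side `j` to the normalized second moment of the linearized error. -/
noncomputable def sideVar (P : Measure Ω) (Y D X : ℕ → Ω → ℝ) (K : ℝ → ℝ) (h : Side → ℕ → ℝ)
    (c : ℝ) (b : Side → BoundaryValues) (sl sd : Side → ℝ) (n : ℕ) (j : Side) : ℝ :=
  stCoef (tauD b) (j, 0) (wMean P Y D X K h c b sd n) ^ 2 * sqMom P Y D X K c b sl j 0 (h j n)
    + 2 * stCoef (tauD b) (j, 0) (wMean P Y D X K h c b sd n)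
      * stCoef (tauD b) (j, 1) (wMean P Y D X K h c b sd n) * sqMom P Y D X K c b sl j 1 (h j n)
    + stCoef (tauD b) (j, 1) (wMean P Y D X K h c b sd n) ^ 2 * sqMom P Y D X K c b sl j 2 (h j n)

theorem linSum_eq_rowSum (n : ℕ) :
    linSum P Y D X K h c b sl sd n
      = rowSum (obs Y D X) n (linFun P Y D X K h c b sl sd n) := by
  funext ω
  simp only [linSum, rSum, rowSum, linFun, Finset.mul_sum]
  exact Finset.sum_comm

/-- Each observation lies on only one side, so products of contributions from different sides vanish
pointwise and no covariance between the sides needs computing. -/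
theorem wt_mul_wt_of_ne (κ : ℝ → ℝ) (c : ℝ) (t t' : ℝ) (k l : ℕ) (x : ℝ) :
    wt κ c .pos t k x * wt κ c .neg t' l x = 0 := by
  unfold wt
  by_cases hx : x ∈ Side.half c .pos
  · have : x ∉ Side.half c .neg := fun h => absurd (Set.mem_Ici.1 hx) (not_le.2 (Set.mem_Iio.1 h))
    rw [Set.indicator_of_notMem this, mul_zero]
  · rw [Set.indicator_of_notMem hx, zero_mul]

theorem rFun_mul_rFun_of_ne (n : ℕ) (k l : Fin 2) (z : ℝ × ℝ × ℝ) :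
    rFun K h c b sl n (.pos, k) z * rFun K h c b sl n (.neg, l) z = 0 := by
  have := wt_mul_wt_of_ne K c (h .pos n) (h .neg n) k l z.1
  simp only [rFun, cell]
  linear_combination ((n * h .pos n)⁻¹ * residZ b sl c .pos z * (n * h .neg n)⁻¹
    * residZ b sl c .neg z) * this

theorem Setting.integral_rFun_mul
    (S : Setting P Y D X K h c f δ mY mD sY sD sYD b η A B sl sd) {n : ℕ} (hn : n ≠ 0)
    (j : Side) (k l : Fin 2) :
    n * ∫ ω, rFun K h c b sl n (j, k) (obs Y D X 0 ω) * rFun K h c b sl n (j, l) (obs Y D X 0 ω) ∂P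
      = (n * h j n)⁻¹ * sqMom P Y D X K c b sl j (k + l) (h j n) := by
  have hn' : (n : ℝ) ≠ 0 := Nat.cast_ne_zero.2 hn
  have hh := (S.h_pos j n).ne'
  have e : ∀ ω, rFun K h c b sl n (j, k) (obs Y D X 0 ω)
      * rFun K h c b sl n (j, l) (obs Y D X 0 ω)
      = (n * h j n)⁻¹ ^ 2 * (wt (fun u => K u ^ 2) c j (h j n) (k + l) (X 0 ω)
        * residZ b sl c j (X 0 ω, Y 0 ω, D 0 ω) ^ 2) := fun ω => by
    rw [← wt_mul_wt]
    simp only [rFun, cell, obs]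
    ring
  simp_rw [e]
  rw [integral_const_mul, sqMom]
  field_simp

theorem Setting.integral_sq_linFun
    (S : Setting P Y D X K h c f δ mY mD sY sD sYD b η A B sl sd) {n : ℕ} (hn : n ≠ 0)
    (hr : ∀ p, MemLp (fun ω => rFun K h c b sl n p (obs Y D X 0 ω)) 2 P) :
    n * ∫ ω, linFun P Y D X K h c b sl sd n (obs Y D X 0 ω) ^ 2 ∂P
      = ∑ j : Side, (n * h j n)⁻¹ * sideVar P Y D X K h c b sl sd n j := by
  set γ := fun p => stCoef (tauD b) p (wMean P Y D X K h c b sd n) with hγ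
  set ρ := fun p ω => rFun K h c b sl n p (obs Y D X 0 ω) with hρ
  have e : ∀ ω, linFun P Y D X K h c b sl sd n (obs Y D X 0 ω) ^ 2
      = ∑ j : Side, (γ (j, 0) ^ 2 * (ρ (j, 0) ω * ρ (j, 0) ω)
        + 2 * γ (j, 0) * γ (j, 1) * (ρ (j, 0) ω * ρ (j, 1) ω)
        + γ (j, 1) ^ 2 * (ρ (j, 1) ω * ρ (j, 1) ω)) := fun ω => by
    have hx : ∀ k l : Fin 2, ρ (.pos, k) ω * ρ (.neg, l) ω = 0 := fun k l =>
      rFun_mul_rFun_of_ne n k l _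
    have hlin : linFun P Y D X K h c b sl sd n (obs Y D X 0 ω)
        = γ (.pos, 0) * ρ (.pos, 0) ω + γ (.pos, 1) * ρ (.pos, 1) ω
          + (γ (.neg, 0) * ρ (.neg, 0) ω + γ (.neg, 1) * ρ (.neg, 1) ω) := by
      rw [linFun, Fintype.sum_prod_type, Side.sum_eq, Fin.sum_univ_two, Fin.sum_univ_two]
    rw [hlin, Side.sum_eq]
    linear_combination 2 * γ (.pos, 0) * γ (.neg, 0) * hx 0 0
      + 2 * γ (.pos, 0) * γ (.neg, 1) * hx 0 1 + 2 * γ (.pos, 1) * γ (.neg, 0) * hx 1 0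
      + 2 * γ (.pos, 1) * γ (.neg, 1) * hx 1 1
  have hi : ∀ p q, Integrable (fun ω => ρ p ω * ρ q ω) P := fun p q =>
    (hr p).integrable_mul (hr q)
  simp_rw [e]
  have h2 : ∀ j : Side, Integrable (fun ω => γ (j, 0) ^ 2 * (ρ (j, 0) ω * ρ (j, 0) ω)
      + 2 * γ (j, 0) * γ (j, 1) * (ρ (j, 0) ω * ρ (j, 1) ω)) P := fun j =>
    ((hi _ _).const_mul _).add ((hi _ _).const_mul _)
  have h3 : ∀ j : Side, Integrable (fun ω => γ (j, 0) ^ 2 * (ρ (j, 0) ω * ρ (j, 0) ω)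
      + 2 * γ (j, 0) * γ (j, 1) * (ρ (j, 0) ω * ρ (j, 1) ω)
      + γ (j, 1) ^ 2 * (ρ (j, 1) ω * ρ (j, 1) ω)) P := fun j =>
    (h2 j).add ((hi _ _).const_mul _)
  rw [integral_finsetSum _ fun j _ => h3 j, Finset.mul_sum]
  refine Finset.sum_congr rfl fun j _ => ?_
  rw [integral_add (h2 j) ((hi _ _).const_mul _),
    integral_add ((hi _ _).const_mul _) ((hi _ _).const_mul _), integral_const_mul,
    integral_const_mul, integral_const_mul]
  have h00 := S.integral_rFun_mul hn j 0 0
  have h01 := S.integral_rFun_mul hn j 0 1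
  have h11 := S.integral_rFun_mul hn j 1 1
  simp only [Fin.val_zero, Fin.val_one, add_zero, zero_add, Nat.reduceAdd] at h00 h01 h11
  unfold sideVar
  linear_combination γ (j, 0) ^ 2 * h00 + 2 * γ (j, 0) * γ (j, 1) * h01 + γ (j, 1) ^ 2 * h11

/-- In the limit the coefficients are `± μ₂ / (f Δ τ_D)` and `-μ₁ / (f Δ τ_D)`, and the squared
moments are `sign^k ω f ν_k`. The signs cancel in the quadratic form, which is the numerator of
`vConst`. -/
theorem Setting.tendsto_sideVar
    (S : Setting P Y D X K h c f δ mY mD sY sD sYD b η A B sl sd) (j : Side) :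
    Tendsto (fun n => sideVar P Y D X K h c b sl sd n j) atTop
      (𝓝 (vConst K / (f c * tauD b ^ 2) * omegaConst b j)) := by
  have hne : ∀ j, stDet (wLim K (f c)) j ≠ 0 := fun j h0 => by
    have := S.lt_stDet j
    rw [h0, abs_zero] at this
    exact absurd this (not_lt.2 S.η_pos.le)
  have hJ : stJump (tauD b) (wLim K (f c)) ≠ 0 := by rw [stJump_wLim]; exact S.tauD_ne
  have hγ : ∀ p, Tendsto (fun n => stCoef (tauD b) p (wMean P Y D X K h c b sd n)) atTop
      (𝓝 (stCoef (tauD b) p (wLim K (f c)))) := fun p =>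
    ((contDiffAt_stCoef _ p hne hJ).continuousAt.tendsto).comp S.tendsto_wMean
  have hT := fun k => ((S.side j).tendsto_sq S.weight.sq 1 (-tau b) (sl j) k).comp
    (S.tendsto_h j)
  have h1 := ((((hγ (j, 0)).pow 2).mul (hT 0)).add
    (((((hγ (j, 0)).const_mul 2).mul (hγ (j, 1))).mul (hT 1)))).add
    (((hγ (j, 1)).pow 2).mul (hT 2))
  refine (h1.congr fun n => ?_).trans (le_of_eq ?_)
  · rfl
  · congr 1
    have hw1 : wLim K (f c) (j, 1) = j.sign * (f c * kmom K 1) := by simp [wLim, wIdx]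
    have hw2 : wLim K (f c) (j, 2) = j.sign ^ 2 * (f c * kmom K 2) := by simp [wLim, wIdx]
    have hm : ∀ k, kmu K k = kmom K k := fun _ => rfl
    have hv : ∀ k, knu K k = kmom (fun u => K u ^ 2) k := fun _ => rfl
    have hf := S.f_pos.ne'
    have hk := S.kdet_ne
    have hτ := S.tauD_ne
    simp only [stCoef, stNum, if_true, one_ne_zero, if_false, stJump_wLim, stDet_wLim, hw1, hw2,
      vConst, omegaConst, hm, hv, Side.sign_sq, one_mul, pow_zero, pow_one]
    have hs : j.sign * j.sign = 1 := by rw [← sq, Side.sign_sq]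
    cases j <;> simp only [Side.sign] <;> field_simp <;> ring

theorem Setting.variance_linSum_sub
    (S : Setting P Y D X K h c f δ mY mD sY sD sYD b η A B sl sd) :
    (fun n => Var[linSum P Y D X K h c b sl sd n; P]
      - vConst K / (n * f c * tauD b ^ 2)
        * (omegaConst b .pos / h .pos n + omegaConst b .neg / h .neg n)) =o[atTop] rate h ∧
    (fun n : ℕ => vConst K / (n * f c * tauD b ^ 2)
      * (omegaConst b .pos / h .pos n + omegaConst b .neg / h .neg n)) =O[atTop] rate h := by
  obtain ⟨C, hC, hr⟩ := S.rFun_bounds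
  have hinv : ∀ j, (fun n : ℕ => ((n : ℝ) * h j n)⁻¹) =O[atTop] rate h := fun j => by
    refine IsBigO.of_bound 1 (Eventually.of_forall fun n => ?_)
    have := S.h_pos j n
    rw [Real.norm_of_nonneg (by positivity), Real.norm_of_nonneg (S.rate_nonneg n), one_mul]
    exact S.inv_le_rate n j
  have hV : (fun n : ℕ => vConst K / (n * f c * tauD b ^ 2)
      * (omegaConst b .pos / h .pos n + omegaConst b .neg / h .neg n))
      = fun n : ℕ => ∑ j : Side, ((n : ℝ) * h j n)⁻¹
        * (vConst K / (f c * tauD b ^ 2) * omegaConst b j) := by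
    funext n
    rw [Side.sum_eq]
    simp only [div_eq_mul_inv, mul_inv]
    ring
  constructor
  · have h1 : (fun n : ℕ => ∑ j : Side, ((n : ℝ) * h j n)⁻¹
        * (sideVar P Y D X K h c b sl sd n j
          - vConst K / (f c * tauD b ^ 2) * omegaConst b j)) =o[atTop] rate h := by
      refine IsLittleO.fun_sum fun j _ => ?_
      have h2 : (fun n => sideVar P Y D X K h c b sl sd n j
          - vConst K / (f c * tauD b ^ 2) * omegaConst b j) =o[atTop] fun _ => (1 : ℝ) := by
        rw [isLittleO_one_iff]
        exact tendsto_sub_nhds_zero_iff.2 (S.tendsto_sideVar j)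
      simpa only [mul_one] using (hinv j).mul_isLittleO h2
    have hβ : (fun n => linBias P Y D X K h c b sl sd n) =O[atTop] fun _ => (1 : ℝ) := by
      have hB : Tendsto (fun n => (phi K b .pos * h .pos n ^ 2 - phi K b .neg * h .neg n ^ 2)
          + (psi K (f c) (deriv f c) b .pos * h .pos n ^ 3
          - psi K (f c) (deriv f c) b .neg * h .neg n ^ 3)) atTop (𝓝 0) := by
        have h2 := fun j => ((S.h_zero j).pow 2).const_mul (phi K b j)
        have h3 := fun j => ((S.h_zero j).pow 3).const_mul (psi K (f c) (deriv f c) b j)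
        simpa using ((h2 .pos).sub (h2 .neg)).add ((h3 .pos).sub (h3 .neg))
      have hc : Tendsto (fun n => h .pos n ^ 3 + h .neg n ^ 3) atTop (𝓝 0) := by
        simpa using ((S.h_zero .pos).pow 3).add ((S.h_zero .neg).pow 3)
      have h4 := ((S.linBias_expansion.trans_tendsto hc).add hB).div_const (tauD b)
      refine (h4.congr fun n => ?_).isBigO_one ℝ
      rw [sub_add_cancel, mul_div_cancel_left₀ _ S.tauD_ne]
    -- The squared mean subtracted in the variance contributes `linBias² / n`. It is negligible
    -- because `1 / n = h₊ · (n h₊)⁻¹` with `h₊ → 0`.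
    have h5 : (fun n : ℕ => linBias P Y D X K h c b sl sd n ^ 2 / n) =o[atTop] rate h := by
      have h6 : (h .pos) =o[atTop] fun _ => (1 : ℝ) := (isLittleO_one_iff ℝ).2 (S.h_zero .pos)
      have h7 := ((hβ.mul hβ).mul_isLittleO h6).mul_isBigO (hinv .pos)
      refine h7.congr (fun n => ?_) fun n => by ring
      have := (S.h_pos .pos n).ne'
      rcases eq_or_ne (n : ℝ) 0 with h0 | h0
      · simp [h0]
      · field_simp
    refine (h1.sub h5).congr' ?_ (EventuallyEq.refl _ _)
    filter_upwards [hr, eventually_ne_atTop 0] with n hr hn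
    have hn' : (n : ℝ) ≠ 0 := Nat.cast_ne_zero.2 hn
    have hm : Measurable (linFun P Y D X K h c b sl sd n) :=
      Finset.measurable_sum _ fun p _ => (S.measurable_rFun n p).const_mul _
    have hL : MemLp (fun ω => linFun P Y D X K h c b sl sd n (obs Y D X 0 ω)) 2 P :=
      memLp_finsetSum _ fun p _ => (hr p).1.const_mul _
    have hmean : n * ∫ ω, linFun P Y D X K h c b sl sd n (obs Y D X 0 ω) ∂P
        = linBias P Y D X K h c b sl sd n := by
      simp only [linFun, linBias, rMean]
      rw [integral_finsetSum _ fun p _ => ((hr p).1.integrable (by norm_num)).const_mul _,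
        Finset.mul_sum]
      refine Finset.sum_congr rfl fun p _ => ?_
      rw [integral_const_mul]; ring
    have hsq := S.integral_sq_linFun (sd := sd) hn fun p => (hr p).1
    rw [linSum_eq_rowSum, variance_rowSum S.iid n hm hL, variance_eq_sub hL, congrFun hV n]
    simp only [Pi.pow_apply]
    have e : (n : ℝ) * (∫ ω, linFun P Y D X K h c b sl sd n (obs Y D X 0 ω) ∂P) ^ 2
        = linBias P Y D X K h c b sl sd n ^ 2 / n := by
      rw [← hmean]; field_simp
    rw [mul_sub, hsq, e]
    simp only [mul_sub, Finset.sum_sub_distrib]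
    ring
  · rw [hV]
    refine IsBigO.fun_sum fun j _ => ?_
    exact ((hinv j).const_mul_left (vConst K / (f c * tauD b ^ 2) * omegaConst b j)).congr_left
      fun n => mul_comm _ _

end Variance

/-! ### Expansion of the mean squared error -/

section MeanSquaredError

theorem IsKernel.exists_isWeight {K : ℝ → ℝ} (hK : IsKernel K) : ∃ A B, IsWeight K A B := by
  obtain ⟨A, hA⟩ := hK.compactSupport.isCompact.isBounded.subset_closedBall (0 : ℝ)
  obtain ⟨B, hB⟩ := hK.continuous.bounded_above_of_compact_support hK.compactSupport
  refine ⟨max A 1, B, hK.continuous, hK.symm, fun u hu => ?_, hB, le_max_right _ _,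
    (norm_nonneg _).trans (hB 0)⟩
  by_contra hne
  have := hA (subset_tsupport K hne)
  rw [Metric.mem_closedBall, dist_zero_right, Real.norm_eq_abs] at this
  exact absurd (lt_of_le_of_lt (le_max_left A 1) hu) (not_lt.2 this)

theorem HolderClass.differentiableAt {U : Set ℝ} {g : ℝ → ℝ} (hg : HolderClass 1 U g)
    (hU : IsOpen U) {c : ℝ} (hc : c ∈ U) : DifferentiableAt ℝ g c :=
  (hg.1.contDiffAt (hU.mem_nhds hc)).differentiableAt (by simp)

variable {Ω : Type*} [MeasurableSpace Ω] {P : Measure Ω} [IsProbabilityMeasure P]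
  {Y D X : ℕ → Ω → ℝ} {K : ℝ → ℝ} {h : Side → ℕ → ℝ} {c : ℝ} {f : ℝ → ℝ} {δ : ℝ}
  {mY mD sY sD sYD : ℝ → ℝ} {b : Side → BoundaryValues} {η A B : ℝ} {sl sd : Side → ℝ}

theorem Setting.measurableSet_regularEvent
    (S : Setting P Y D X K h c f δ mY mD sY sD sYD b η A B sl sd) (n : ℕ) :
    MeasurableSet (regularEvent D X K c (fun j => h j n) n η) := by
  rw [regularEvent_eq (Y := Y) (b := b) (sd := sd) S.h_pos S.η_pos n]
  exact S.measurable_wSum n (measurableSet_stGood _ _)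

theorem Setting.mse_eq
    (S : Setting P Y D X K h c f δ mY mD sY sD sYD b η A B sl sd) (n : ℕ) :
    mse P Y D X K c (fun j => h j n) n η (tau b)
      = ∫ ω, errSum Y D X K h c b η sl sd n ω ^ 2 ∂P := by
  rw [mse, ← integral_indicator (S.measurableSet_regularEvent n),
    indicator_sqError S.h_pos S.η_pos S.tauD_ne n]

theorem Setting.integrableOn_sqError
    (S : Setting P Y D X K h c f δ mY mD sY sD sYD b η A B sl sd) {n : ℕ}
    (hn : MemLp (errSum Y D X K h c b η sl sd n) 2 P) :
    IntegrableOn (sqError Y D X K c (fun j => h j n) n (tau b))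
      (regularEvent D X K c (fun j => h j n) n η) P := by
  rw [← integrable_indicator_iff (S.measurableSet_regularEvent n),
    indicator_sqError S.h_pos S.η_pos S.tauD_ne n]
  exact hn.integrable_sq

/-- The mean squared error is the squared mean plus the variance of the error extended by zero. The
bias, mean error and variance estimates are exactly the inputs of `exists_mse_remainders`. -/
theorem Setting.mse_expansion
    (S : Setting P Y D X K h c f δ mY mD sY sD sYD b η A B sl sd) :
    (∀ᶠ n : ℕ in atTop, IntegrableOn (sqError Y D X K c (fun j => h j n) n (tau b))
      (regularEvent D X K c (fun j => h j n) n η) P) ∧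
    ∃ r s : ℕ → ℝ,
      r =o[atTop] (fun n => h .pos n ^ 3 + h .neg n ^ 3) ∧ s =o[atTop] rate h ∧
      ∀ᶠ n : ℕ in atTop,
        mse P Y D X K c (fun j => h j n) n η (tau b) =
          1 / tauD b ^ 2 *
            ((phi K b .pos * h .pos n ^ 2 - phi K b .neg * h .neg n ^ 2)
              + (psi K (f c) (deriv f c) b .pos * h .pos n ^ 3
                - psi K (f c) (deriv f c) b .neg * h .neg n ^ 3)
              + r n) ^ 2
          + vConst K / (n * f c * tauD b ^ 2)
            * (omegaConst b .pos / h .pos n + omegaConst b .neg / h .neg n)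
          + s n := by
  obtain ⟨hlin, hVO⟩ := S.variance_linSum_sub
  obtain ⟨hmem, ⟨C, hmean⟩, hvar⟩ := S.errSum_moments hVO hlin
  refine ⟨hmem.mono fun n hn => S.integrableOn_sqError hn, ?_⟩
  refine exists_mse_remainders S.tauD_ne (S.h_pos .pos) (S.h_pos .neg) (S.h_zero .pos)
    (S.h_zero .neg) (β := linBias P Y D X K h c b sl sd)
    (e := fun n => (∫ ω, errSum Y D X K h c b η sl sd n ω ∂P) - linBias P Y D X K h c b sl sd n)
    (v := fun n => Var[errSum Y D X K h c b η sl sd n; P]) ?_ S.tendsto_rate ?_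
    S.linBias_expansion (Eventually.of_forall fun n => by ring) (C := C) hmean hvar ?_
  · filter_upwards [eventually_gt_atTop 0] with n hn
    have h1 := S.h_pos .pos n
    have h2 := S.h_pos .neg n
    have : (0 : ℝ) < n := Nat.cast_pos.2 hn
    unfold rate; positivity
  · have h2 := fun j => ((S.h_zero j).pow 2).const_mul (phi K b j)
    have h3 := fun j => ((S.h_zero j).pow 3).const_mul (psi K (f c) (deriv f c) b j)
    simpa using ((h2 .pos).sub (h2 .neg)).add ((h3 .pos).sub (h3 .neg))
  · filter_upwards [hmem] with n hn
    rw [S.mse_eq, variance_eq_sub hn]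
    simp only [Pi.pow_apply]
    ring

end MeanSquaredError

end FuzzyRD

theorem lemma1 {Ω : Type*} [MeasurableSpace Ω] (P : Measure Ω) [IsProbabilityMeasure P]
    -- i.i.d. observations with binary treatment status
    (Y D X : ℕ → Ω → ℝ)
    (hYm : ∀ i, Measurable (Y i)) (hDm : ∀ i, Measurable (D i)) (hXm : ∀ i, Measurable (X i))
    (hindep : iIndepFun (fun (i : ℕ) (ω : Ω) => (Y i ω, D i ω, X i ω)) P)
    (hident : ∀ i, IdentDistrib (fun ω => (Y i ω, D i ω, X i ω))
      (fun ω => (Y 0 ω, D 0 ω, X 0 ω)) P P)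
    (hD : ∀ i, ∀ᵐ ω ∂P, D i ω = 0 ∨ D i ω = 1)
    -- kernel
    (K : ℝ → ℝ) (hK : IsKernel K) (hKdet : kdet K ≠ 0)
    -- bandwidths
    (h : Side → ℕ → ℝ) (hpos : ∀ j n, 0 < h j n)
    (hzero : ∀ j, Tendsto (h j) atTop (𝓝 0))
    (hinf : ∀ j, Tendsto (fun n : ℕ => (n : ℝ) * h j n) atTop atTop)
    -- density of the assignment variable
    (c : ℝ) (f : ℝ → ℝ) (hfm : Measurable f) (hf0 : ∀ x, 0 ≤ f x)
    (hdens : P.map (X 0) = volume.withDensity (fun x => ENNReal.ofReal (f x)))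
    (hfbdd : ∃ M, ∀ x, f x ≤ M) (hfc : 0 < f c)
    (U : Set ℝ) (hU : IsOpen U) (hcU : c ∈ U) (hfU : HolderClass 1 U f)
    -- conditional means, variances and covariance on the two sides of the cut-off
    (δ : ℝ) (hδ : 0 < δ) (mY mD sY sD sYD : ℝ → ℝ)
    (hcond : ∀ j : Side, IsCondMoments P (Y 0) (D 0) (X 0) (j.nbhd c δ) mY mD sY sD sYD)
    (hmY : ∀ j : Side, HolderClass 3 (j.nbhd c δ) mY)
    (hmD : ∀ j : Side, HolderClass 3 (j.nbhd c δ) mD)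
    (hsY : ∀ j : Side, HolderClass 0 (j.nbhd c δ) sY)
    (hsYD : ∀ j : Side, HolderClass 0 (j.nbhd c δ) sYD)
    (b : Side → BoundaryValues)
    (hb : ∀ j : Side, (b j).IsLimit (j.toC c) mY mD sY sD sYD)
    -- discontinuity of the propensity score
    (hτD : tauD b ≠ 0)
    -- level of non-degeneracy
    (η : ℝ) (hη : 0 < η) (hητ : η < |tauD b|) (hηdet : η < f c ^ 2 * |kdet K|) :
    -- degenerate samples have exponentially small probability
    (∃ C κ : ℝ, 0 < κ ∧ ∀ n : ℕ,
      P.real (regularEvent D X K c (fun j => h j n) n η)ᶜ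
        ≤ C * Real.exp (-κ * (n * min (h .pos n) (h .neg n)))) ∧
    -- the mean squared error is finite
    (∀ᶠ n : ℕ in atTop, IntegrableOn (sqError Y D X K c (fun j => h j n) n (tau b))
      (regularEvent D X K c (fun j => h j n) n η) P) ∧
    -- the expansion of the mean squared error
    ∃ r s : ℕ → ℝ,
      r =o[atTop] (fun n => h .pos n ^ 3 + h .neg n ^ 3) ∧
      s =o[atTop] (fun n => 1 / ((n : ℝ) * h .pos n) + 1 / ((n : ℝ) * h .neg n)) ∧
      ∀ᶠ n : ℕ in atTop,
        mse P Y D X K c (fun j => h j n) n η (tau b) =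
          1 / tauD b ^ 2 *
            ((phi K b .pos * h .pos n ^ 2 - phi K b .neg * h .neg n ^ 2)
              + (psi K (f c) (deriv f c) b .pos * h .pos n ^ 3
                - psi K (f c) (deriv f c) b .neg * h .neg n ^ 3)
              + r n) ^ 2
          + vConst K / (n * f c * tauD b ^ 2)
            * (omegaConst b .pos / h .pos n + omegaConst b .neg / h .neg n)
          + s n := by
  obtain ⟨A, B, hκ⟩ := hK.exists_isWeight
  have hswap : Measurable fun z : ℝ × ℝ × ℝ => (z.2.2, z.1, z.2.1) := by fun_prop
  have hiid : IsIID (obs Y D X) P :=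
    ⟨fun i => (hXm i).prodMk ((hYm i).prodMk (hDm i)), hindep.comp (fun _ => _) fun _ => hswap,
      fun i => (hident i).comp hswap⟩
  have hside : ∀ j, SideModel P (Y 0) (D 0) (X 0) f c δ j mY mD sY sD sYD (b j) := fun j =>
    { measY := hYm 0, measD := hDm 0, measX := hXm 0, binary := hD 0, measf := hfm
      f_nonneg := hf0, density := hdens, differentiable := hfU.differentiableAt hU hcU
      δ_pos := hδ, cond := hcond j, smoothY := (hmY j).1, smoothD := (hmD j).1
      limits := hb j }
  -- Slopes for `Y - τ D` (coefficients `1, -τ`) and for `D` (coefficients `0, 1`). They come from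
  -- the Taylor expansion and drop out of the estimation error.
  choose sl hsl using fun j => (hside j).exists_slope 1 (-tau b)
  choose sd hsd using fun j => (hside j).exists_slope 0 1
  have S : Setting P Y D X K h c f δ mY mD sY sD sYD b η A B sl sd :=
    ⟨hiid, hside, hκ, hKdet, hfc, hpos, hzero, hinf, hτD, hη, hητ, hηdet, hsl, hsd⟩
  exact ⟨S.degenerate_le, S.mse_expansion⟩
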